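/- \textbf{Setting.} An instance consists of the following data. There are $K$ users, $N$ subcarriers, $1\le L\le N$ channel taps $H_0,\dots,H_{L-1}\in\mathbb C^{N_r\times K}$, and transmit powers forming diagonal positive semidefinite matrices $D_1,\dots,D_N\in\mathbb R^{K\times K}$. The users have weights $w_1\ge\dots\ge w_K\ge 0$ (put $w_{K+1}=0$) and queue sizes $Q_k\in[0,\infty]$. There is a finite codebook $\mathcal W$ of orthonormal beams (row vectors in $\mathbb C^{N_r}$), a finite set $\mathcal B$ of positive integers (bit resolutions), and a look-up table $b\mapsto\alpha_b\in(0,1]$ that is nondecreasing on $\mathcal B$. Finally there are costs $c(w,b)\ge 0$ for the pairs $(w,b)\in\Omega=\mathcal W\times\mathcal B$, an energy budget $\hat E\ge 0$ and an integer $M'\ge 1$. Let $G_n=\sum_{\ell=0}^{L-1}H_\ell e^{-2\pi i(n-1)\ell/N}$, let $F$ be the unitary $N\times N$ DFT matrix, $D=\mathrm{BlkDiag}(D_1,\dots,D_N)$ and $B=[H_0,0,\dots,0,H_{L-1},\dots,H_1]$ (with $N$ blocks). For $w\in\mathcal W$ put $\psi_w=1+wB(F^\dagger\otimes I_K)D(F\otimes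 I_K)B^\dagger w^\dagger$. For $G\subseteq\Omega$ let $W_G$ be the matrix whose rows are the distinct beams occurring in $G$, and let $T_G$ be the diagonal matrix whose entry for the beam $w$ is $\alpha^2/(\alpha^2+\alpha(1-\alpha)\psi_w)$, where $\alpha=\alpha_b$ for the largest $b$ with $(w,b)\in G$. Put $\Lambda_{G,n}=T_G^{1/2}W_GG_nD_n^{1/2}$, write $\Lambda_{G,n}^{(A)}$ for its columns indexed by $A\subseteq\{1,\dots,K\}$, and let $$f_G^{(A)}=\sum_{n=1}^N\log_2\det\bigl(I+\Lambda_{G,n}^{(A)}(\Lambda_{G,n}^{(A)})^\dagger\bigr),\qquad g_G^{(\ell)}=\min_{A\subseteq\{1,\dots,\ell\}}\Bigl\{\sum_{k\in\{1,\dots,\ell\}\setminus A}Q_k+f_G^{(A)}\Bigr\}.$$ The weighted sum rate (WSR) of $G$ is $h'(G)=\sum_{\ell=1}^K(w_\ell-w_{\ell+1})\,g_G^{(\ell)}$. Problem (P2) is $$\max_{G\subseteq\Omega}\;h'(G)\quad\text{subject to}\quad\sum_{(w,b)\in G}c(w,b)\le\hat E,\qquad |G|\le M'.$$ \textbf{Corollary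 1.} There is a polynomial-time algorithm for (P2) with the constant-factor guarantee $\frac{1}{2(1+2e)}$: for every instance it outputs a feasible set $G\subseteq\Omega$ with $h'(G)\ge\frac{1}{2(1+2e)}\,h'(G^*)$ for all feasible $G^*$. Here an algorithm is a single program, without real constants, for a random access machine with exact real arithmetic ($+,-,\times,\div,\exp,\log$ and comparison at unit cost, no rounding of reals to integers) whose integer registers are used for counting and indexing. Its input is the data above, complex numbers being given by their real and imaginary parts and the matrix $F$ being available as a table. Its number of steps is bounded by a polynomial in $K+N+L+N_r+|\mathcal W|+|\mathcal B|$. -/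

import Mathlib

open scoped Matrix Kronecker ENNReal

namespace BeamBits

/-! ## The optimization problem -/

/-- An input instance: a single-cell uplink with `K` users, `N` subcarriers, `L` paths and `Nr`
receive antennas, a codebook of `nW` analog beams and `nB` bit resolutions. The users are listed
in the order of decreasing weight, the resolutions in increasing order. -/
structure Uplink where
  /-- number of users -/
  K : ℕ
  /-- number of subcarriers -/
  N : ℕ
  /-- number of paths (channel taps) -/
  L : ℕ
  /-- number of receive antennas -/
  Nr : ℕ
  /-- number of beams in the codebook -/
  nW : ℕ
  /-- number of available bit resolutions -/
  nB : ℕ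
  L_pos : 1 ≤ L
  L_le : L ≤ N
  /-- the codebook; the beams are the rows of this matrix -/
  beam : Matrix (Fin nW) (Fin Nr) ℂ
  beam_orthonormal : beam * beamᴴ = 1
  /-- the available bit resolutions -/
  bits : Fin nB → ℕ
  bits_pos : ∀ b, 0 < bits b
  bits_strictMono : StrictMono bits
  /-- look-up table: quantization scalar as a function of the resolution -/
  alpha : Fin nB → ℝ
  alpha_pos : ∀ b, 0 < alpha b
  alpha_le_one : ∀ b, alpha b ≤ 1
  alpha_mono : Monotone alpha
  /-- channel matrices, one for each tap -/
  tap : Fin L → Matrix (Fin Nr) (Fin K) ℂ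
  /-- transmit power of each user on each subcarrier -/
  power : Fin N → Fin K → ℝ
  power_nonneg : ∀ n k, 0 ≤ power n k
  /-- user weights -/
  weight : Fin K → ℝ
  weight_nonneg : ∀ k, 0 ≤ weight k
  weight_anti : Antitone weight
  /-- queue sizes; the value `∞` is a full buffer -/
  queue : Fin K → ℝ≥0∞
  /-- cost of each pair (beam, resolution) -/
  cost : Fin nW → Fin nB → ℝ
  cost_nonneg : ∀ w b, 0 ≤ cost w b
  /-- energy budget -/
  budget : ℝ
  budget_nonneg : 0 ≤ budget
  /-- maximal number of active RF chains -/
  chains : ℕ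
  chains_pos : 1 ≤ chains

namespace Uplink

variable (I : Uplink)

/-- The ground set of all pairs (beam, resolution). -/
abbrev Ground : Type := Fin I.nW × Fin I.nB

/-- The unitary `N × N` DFT matrix. -/
noncomputable def dft : Matrix (Fin I.N) (Fin I.N) ℂ := fun n j =>
  Complex.exp (-(2 * Real.pi * Complex.I * (n : ℂ) * (j : ℂ) / (I.N : ℂ))) / (Real.sqrt I.N : ℂ)

/-- The block row `[H₀, 0, …, 0, H_{L-1}, …, H₁]` with `N` blocks: block `0` is `H₀`,
block `N - i` is `H_i` for `1 ≤ i < L`, and the other blocks vanish. -/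
noncomputable def tapRow : Matrix (Fin I.Nr) (Fin I.N × Fin I.K) ℂ := fun r jk =>
  if h : (I.N - (jk.1 : ℕ)) % I.N < I.L then I.tap ⟨(I.N - (jk.1 : ℕ)) % I.N, h⟩ r jk.2 else 0

/-- The diagonal covariance matrix of the transmitted frequency-domain symbols. -/
noncomputable def powerMatrix : Matrix (Fin I.N × Fin I.K) (Fin I.N × Fin I.K) ℂ :=
  Matrix.diagonal fun nk => (I.power nk.1 nk.2 : ℂ)

/-- The variance of the time-domain output along each beam. -/
noncomputable def psi (w : Fin I.nW) : ℝ :=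
  ((1 + I.beam * I.tapRow * (I.dftᴴ ⊗ₖ (1 : Matrix (Fin I.K) (Fin I.K) ℂ)) * I.powerMatrix *
    (I.dft ⊗ₖ (1 : Matrix (Fin I.K) (Fin I.K) ℂ)) * I.tapRowᴴ * I.beamᴴ :
    Matrix (Fin I.nW) (Fin I.nW) ℂ) w w).re

/-- The frequency-domain channel matrix on subcarrier `n`. -/
noncomputable def chan (n : Fin I.N) : Matrix (Fin I.Nr) (Fin I.K) ℂ :=
  ∑ l : Fin I.L,
    Complex.exp (-(2 * Real.pi * Complex.I * (n : ℂ) * (l : ℂ) / (I.N : ℂ))) • I.tap l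

/-- The factor `α² / (α² + α (1 - α) ψ)` of a beam that is quantized with resolution `b`. -/
noncomputable def gain (w : Fin I.nW) (b : Fin I.nB) : ℝ :=
  I.alpha b ^ 2 / (I.alpha b ^ 2 + I.alpha b * (1 - I.alpha b) * I.psi w)

/-- The distinct beams that occur in a set of pairs. -/
def beams (G : Finset I.Ground) : Finset (Fin I.nW) := G.image Prod.fst

/-- The highest resolution with which a beam occurs in a set of pairs. -/
def topRes (G : Finset I.Ground) (w : {w // w ∈ I.beams G}) : Fin I.nB :=
  ((G.filter fun e => e.1 = w.1).image Prod.snd).max' (by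
    obtain ⟨w, hw⟩ := w
    obtain ⟨e, he, rfl⟩ := Finset.mem_image.mp hw
    exact ⟨e.2, Finset.mem_image.mpr ⟨e, by simp [he], rfl⟩⟩)

/-- The matrix whose rows are the distinct beams of `G`. -/
def beamRows (G : Finset I.Ground) : Matrix {w // w ∈ I.beams G} (Fin I.Nr) ℂ :=
  I.beam.submatrix Subtype.val id

/-- The effective channel `T^{1/2} W G_n D_n^{1/2}`: one row for each distinct beam of `G`, taken
with its highest resolution in `G`. -/
noncomputable def effChan (G : Finset I.Ground) (n : Fin I.N) :
    Matrix {w // w ∈ I.beams G} (Fin I.K) ℂ :=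
  Matrix.diagonal (fun w : {w // w ∈ I.beams G} => (Real.sqrt (I.gain w.1 (I.topRes G w)) : ℂ)) *
    I.beamRows G * I.chan n *
    Matrix.diagonal (fun k => (Real.sqrt (I.power n k) : ℂ))

/-- The columns of the effective channel that belong to the users in `A`. -/
noncomputable def effChanOn (G : Finset I.Ground) (n : Fin I.N) (A : Finset (Fin I.K)) :
    Matrix {w // w ∈ I.beams G} {k // k ∈ A} ℂ :=
  (I.effChan G n).submatrix id Subtype.val

/-- The maximal sum rate (in bits) of the users in `A` without queue constraints. -/
noncomputable def sumRate (G : Finset I.Ground) (A : Finset (Fin I.K)) : ℝ :=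
  ∑ n : Fin I.N, Real.logb 2 (1 + I.effChanOn G n A * (I.effChanOn G n A)ᴴ).det.re

/-- The maximal sum rate of the users `0, …, l` under queue constraints: the minimum of
`Q({0, …, l} \ A) + f(A)` over `A ⊆ {0, …, l}`. It is finite, as `A = {0, …, l}` shows. -/
noncomputable def queueRate (G : Finset I.Ground) (l : Fin I.K) : ℝ :=
  ((Finset.Iic l).powerset.inf fun A =>
    ∑ k ∈ Finset.Iic l \ A, I.queue k + ENNReal.ofReal (I.sumRate G A)).toReal

/-- The weight of the user after `l`, which is `0` if `l` is the last user. -/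
noncomputable def nextWeight (l : Fin I.K) : ℝ :=
  if h : (l : ℕ) + 1 < I.K then I.weight ⟨l + 1, h⟩ else 0

/-- The weighted sum rate of a set of pairs. -/
noncomputable def wsr (G : Finset I.Ground) : ℝ :=
  ∑ l : Fin I.K, (I.weight l - I.nextWeight l) * I.queueRate G l

/-- The constraints: total cost at most the energy budget, and at most `chains` pairs. -/
def Feasible (G : Finset I.Ground) : Prop :=
  ∑ e ∈ G, I.cost e.1 e.2 ≤ I.budget ∧ G.card ≤ I.chains

/-- The size of an instance, the sum of its dimensions. -/
def size : ℕ := I.K + I.N + I.L + I.Nr + I.nW + I.nB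

end Uplink

/-! ## Programs over the natural and the real numbers, with a step count

A real random access machine: exact arithmetic, `exp`, `log` and comparison of real numbers at unit
cost, and no conversion from real numbers to natural numbers. Natural numbers serve as counters and
indices; they can be added, subtracted (truncated at `0`) and compared, but not multiplied. Memory
consists of arrays with three indices; an array that needs fewer indices uses the index `0`. A
program is one finite text for all instances and contains no real constants. -/

/-- The memory: the entries of array number `a` are `nat a i j k` and `real a i j k`. -/
structure Store where
  nat : ℕ → ℕ → ℕ → ℕ → ℕ
  real : ℕ → ℕ → ℕ → ℕ → ℝ

/-- Expressions of natural number type. -/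
inductive NExp : Type
  | lit (c : ℕ)
  | read (a : ℕ) (i j k : NExp)
  | add (x y : NExp)
  | sub (x y : NExp)

/-- The value of an expression of natural number type. -/
def NExp.eval (s : Store) : NExp → ℕ
  | .lit c => c
  | .read a i j k => s.nat a (i.eval s) (j.eval s) (k.eval s)
  | .add x y => x.eval s + y.eval s
  | .sub x y => x.eval s - y.eval s

/-- Expressions of real number type. -/
inductive RExp : Type
  | ofNat (x : NExp)
  | read (a : ℕ) (i j k : NExp)
  | add (x y : RExp)
  | sub (x y : RExp)
  | mul (x y : RExp)
  | div (x y : RExp)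
  | exp (x : RExp)
  | log (x : RExp)

/-- The value of an expression of real number type. -/
noncomputable def RExp.eval (s : Store) : RExp → ℝ
  | .ofNat x => (x.eval s : ℝ)
  | .read a i j k => s.real a (i.eval s) (j.eval s) (k.eval s)
  | .add x y => x.eval s + y.eval s
  | .sub x y => x.eval s - y.eval s
  | .mul x y => x.eval s * y.eval s
  | .div x y => x.eval s / y.eval s
  | .exp x => Real.exp (x.eval s)
  | .log x => Real.log (x.eval s)

/-- Tests. -/
inductive Test : Type
  | ltN (x y : NExp)
  | ltR (x y : RExp)
  | neg (p : Test)
  | and (p q : Test)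

/-- The truth of a test. -/
def Test.Holds (s : Store) : Test → Prop
  | .ltN x y => x.eval s < y.eval s
  | .ltR x y => x.eval s < y.eval s
  | .neg p => ¬ p.Holds s
  | .and p q => p.Holds s ∧ q.Holds s

/-- Writing one entry of an array of natural numbers. -/
def Store.setNat (s : Store) (a i j k v : ℕ) : Store where
  nat := fun a' i' j' k' => if a' = a ∧ i' = i ∧ j' = j ∧ k' = k then v else s.nat a' i' j' k'
  real := s.real

/-- Writing one entry of an array of real numbers. -/
noncomputable def Store.setReal (s : Store) (a i j k : ℕ) (v : ℝ) : Store where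
  nat := s.nat
  real := fun a' i' j' k' => if a' = a ∧ i' = i ∧ j' = j ∧ k' = k then v else s.real a' i' j' k'

/-- Programs: assignments, sequencing, branching and (unbounded) loops. -/
inductive Prog : Type
  | skip
  | setN (a : ℕ) (i j k : NExp) (x : NExp)
  | setR (a : ℕ) (i j k : NExp) (x : RExp)
  | seq (c d : Prog)
  | branch (p : Test) (c d : Prog)
  | loop (p : Test) (c : Prog)

/-- `Run c s t s'`: started in memory `s`, the program `c` halts in memory `s'` after exactly `t`
steps. A step is the execution of one assignment or the evaluation of one test; the number of
operations in it is bounded by the length of the program text. -/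
inductive Run : Prog → Store → ℕ → Store → Prop
  | skip (s : Store) : Run .skip s 1 s
  | setN (s : Store) (a : ℕ) (i j k x : NExp) :
      Run (.setN a i j k x) s 1 (s.setNat a (i.eval s) (j.eval s) (k.eval s) (x.eval s))
  | setR (s : Store) (a : ℕ) (i j k : NExp) (x : RExp) :
      Run (.setR a i j k x) s 1 (s.setReal a (i.eval s) (j.eval s) (k.eval s) (x.eval s))
  | seq {c d : Prog} {s s' s'' : Store} {t t' : ℕ} :
      Run c s t s' → Run d s' t' s'' → Run (.seq c d) s (t + t') s''
  | branch_true {p : Test} {c d : Prog} {s s' : Store} {t : ℕ} :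
      p.Holds s → Run c s t s' → Run (.branch p c d) s (t + 1) s'
  | branch_false {p : Test} {c d : Prog} {s s' : Store} {t : ℕ} :
      ¬ p.Holds s → Run d s t s' → Run (.branch p c d) s (t + 1) s'
  | loop_true {p : Test} {c : Prog} {s s' s'' : Store} {t t' : ℕ} :
      p.Holds s → Run c s t s' → Run (.loop p c) s' t' s'' → Run (.loop p c) s (t + 1 + t') s''
  | loop_false {p : Test} {c : Prog} {s : Store} :
      ¬ p.Holds s → Run (.loop p c) s 1 s

/-! ## Input and output -/

/-- A vector as an array entry; entries outside the range of indices are `0`. -/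
def pad1 {R : Type} [Zero R] {m : ℕ} (f : Fin m → R) (i : ℕ) : R :=
  if h : i < m then f ⟨i, h⟩ else 0

/-- A two-dimensional table as an array entry; entries outside the range of indices are `0`. -/
def pad2 {R : Type} [Zero R] {m n : ℕ} (f : Fin m → Fin n → R) (i j : ℕ) : R :=
  pad1 (fun x => pad1 (f x) j) i

/-- A three-dimensional table as an array entry; entries outside the range of indices are `0`. -/
def pad3 {R : Type} [Zero R] {m n p : ℕ} (f : Fin m → Fin n → Fin p → R) (i j k : ℕ) : R :=
  pad1 (fun x => pad2 (f x) j k) i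

/-- The memory that holds an instance, and zeros elsewhere. Complex tables are given by their real
and imaginary parts, the DFT matrix is available as a table, and the queue size of a user is given
by its finite value or by a flag for a full buffer. -/
noncomputable def Uplink.input (I : Uplink) : Store where
  nat := fun a i j k =>
    if a = 0 ∧ j = 0 ∧ k = 0 then
      pad1 ![I.K, I.N, I.L, I.Nr, I.nW, I.nB, I.chains] i
    else if a = 1 ∧ j = 0 ∧ k = 0 then pad1 I.bits i
    else if a = 2 ∧ j = 0 ∧ k = 0 then
      pad1 (fun u => if I.queue u = ∞ then 1 else 0) i
    else 0
  real := fun a i j k =>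
    if a = 0 ∧ k = 0 then pad2 (fun w r => (I.beam w r).re) i j
    else if a = 1 ∧ k = 0 then pad2 (fun w r => (I.beam w r).im) i j
    else if a = 2 then pad3 (fun l r u => (I.tap l r u).re) i j k
    else if a = 3 then pad3 (fun l r u => (I.tap l r u).im) i j k
    else if a = 4 ∧ k = 0 then pad2 (fun n m => (I.dft n m).re) i j
    else if a = 5 ∧ k = 0 then pad2 (fun n m => (I.dft n m).im) i j
    else if a = 6 ∧ k = 0 then pad2 I.power i j
    else if a = 7 ∧ j = 0 ∧ k = 0 then pad1 I.weight i
    else if a = 8 ∧ j = 0 ∧ k = 0 then pad1 (fun u => (I.queue u).toReal) i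
    else if a = 9 ∧ j = 0 ∧ k = 0 then pad1 I.alpha i
    else if a = 10 ∧ k = 0 then pad2 I.cost i j
    else if a = 11 ∧ i = 0 ∧ j = 0 ∧ k = 0 then I.budget
    else 0

/-- The set of pairs that is read off the memory at the end: the pairs `(w, b)` for which the entry
`w b` of array number `3` of natural numbers is not `0`. -/
def Uplink.output (I : Uplink) (s : Store) : Finset I.Ground :=
  Finset.univ.filter fun e => s.nat 3 e.1 e.2 0 ≠ 0

end BeamBits

set_option linter.unusedSectionVars false

/-! The weighted sum rate is a monotone submodular function of the set of pairs. A cost-benefit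
greedy algorithm therefore gives a constant factor, provided that the rate can be evaluated
accurately enough in polynomial time.

Submodularity. Take independent Gaussian inputs and a noisy linear output. The minor of their joint
covariance at the inputs outside `A` and the receivers `S` is the determinant of the channel from
`A` to `S` (`minor_jointCov`), and logarithms of principal minors of a positive definite matrix are
submodular (`log_minor_submodular`). Hence f_{G ∪ G'}(A ∩ B) + f_{G ∩ G'}(A ∪ B) ≤ f_G(A) +
f_{G'}(B) (`sumRate_joint`); different resolutions of one beam are handled by splitting each
receiver into two copies (`log_gram_joint`). An inequality of this crossed form survives
minimization over the user sets (`minRate_submodular`), which yields `wsr_submodular`.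

Evaluation. A single rate is a log-determinant, computed by rank one updates of an inverse. The
minimum over exponentially many user sets is avoided by duality: with q_k = min(Q_k, f({k})), the
weighted sum rate h is the maximum of ∑ w_k x_k over the points x ≤ q of the polymatroid of f
(`isMaxRate_minRate`). A fluid recursion approximates this maximum. During one unit of time τ the
users are served at the greedy vertex for the weights w_k y_k, where the urgency y_k falls from 1 to
0 as the served fraction z_k of q_k runs ahead of τ by 0 up to 1/S. Weak duality, with w_k (1 - y_k)
as prices of the bounds x_k ≤ q_k, shows that a Lyapunov function grows at rate at least h
(`le_sum_speedOf`, `lyapunov_step`). At τ = 1 the truncated fractions min(z_k, 1) give a feasible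
point of value at least (1 - 3K/S) h (`le_payoffOf`), after polynomially many steps
(`FluidInv.time_eq_one`).

Greedy. Cost and cardinality are merged into one share per pair, cost/budget + 1/min(M', dim²).
Feasible sets have total share at most 2, and affordable sets of total share at most 1 are feasible.
Pairs of best ratio of gain to share are added until one does not fit; the better of the set built
so far and that single pair has at least 1/10 of the optimum (`GreedyData.guarantee`), and 10 < 2(1
+ 2e).

Machine. The predicates `ImplR` and `ImplA` say that a function of the memory content is computed in
polynomial time. They are closed under arithmetic, comparison, sums, array binding and bounded
recursion, so the algorithm is written as real-valued functions of arrays and compiled expression by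
expression. What remains is to identify these functions with the mathematical objects above. -/

namespace BeamBits

/-! ## Running programs within a time bound -/

/-- Started in `s`, the program `c` halts within `T` steps in a memory that satisfies `Q`. -/
def Does (c : Prog) (T : ℕ) (s : Store) (Q : Store → Prop) : Prop :=
  ∃ t s', t ≤ T ∧ Run c s t s' ∧ Q s'

theorem Does.mono {c : Prog} {T T' : ℕ} {s : Store} {Q Q' : Store → Prop} (h : Does c T s Q)
    (hT : T ≤ T') (hQ : ∀ s', Q s' → Q' s') : Does c T' s Q' := by
  obtain ⟨t, s', ht, hr, hq⟩ := h
  exact ⟨t, s', ht.trans hT, hr, hQ _ hq⟩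

theorem Does.seq {c c' : Prog} {T T' : ℕ} {s : Store} {P Q : Store → Prop} (h : Does c T s P)
    (h' : ∀ s', P s' → Does c' T' s' Q) : Does (.seq c c') (T + T') s Q := by
  obtain ⟨t, s', ht, hr, hp⟩ := h
  obtain ⟨t', s'', ht', hr', hq⟩ := h' s' hp
  exact ⟨t + t', s'', by omega, .seq hr hr', hq⟩

theorem Does.setN {a : ℕ} {i j k x : NExp} {s : Store} {Q : Store → Prop}
    (h : Q (s.setNat a (i.eval s) (j.eval s) (k.eval s) (x.eval s))) :
    Does (.setN a i j k x) 1 s Q := ⟨1, _, le_rfl, .setN .., h⟩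

theorem Does.setR {a : ℕ} {i j k : NExp} {x : RExp} {s : Store} {Q : Store → Prop}
    (h : Q (s.setReal a (i.eval s) (j.eval s) (k.eval s) (x.eval s))) :
    Does (.setR a i j k x) 1 s Q := ⟨1, _, le_rfl, .setR .., h⟩

theorem Does.branch {p : Test} {c c' : Prog} {T T' : ℕ} {s : Store} {Q : Store → Prop}
    (h : p.Holds s → Does c T s Q) (h' : ¬ p.Holds s → Does c' T' s Q) :
    Does (.branch p c c') (T + T' + 1) s Q := by
  by_cases hp : p.Holds s
  · obtain ⟨t, s', ht, hr, hq⟩ := h hp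
    exact ⟨t + 1, s', by omega, .branch_true hp hr, hq⟩
  · obtain ⟨t, s', ht, hr, hq⟩ := h' hp
    exact ⟨t + 1, s', by omega, .branch_false hp hr, hq⟩

/-- The scalar in array number `a` of natural numbers. -/
abbrev cnt (a : ℕ) : NExp := .read a (.lit 0) (.lit 0) (.lit 0)

/-- The scalar in array number `a` of real numbers. -/
abbrev scal (a : ℕ) : RExp := .read a (.lit 0) (.lit 0) (.lit 0)

/-- A counting loop. -/
def Prog.count (m : ℕ) (b : NExp) (c : Prog) : Prog :=
  .seq (.setN m (.lit 0) (.lit 0) (.lit 0) (.lit 0))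
    (.loop (.ltN (cnt m) b)
      (.seq c (.setN m (.lit 0) (.lit 0) (.lit 0) (.add (cnt m) (.lit 1)))))

/-- Bound and counter are read from memory at every test, so the invariant must determine both. A
round costs the body, one test and one increment; the final `2` pays for the initialization and the
failing test. -/
theorem Does.count {m n T : ℕ} {b : NExp} {c : Prog} (Inv : ℕ → Store → Prop) {s : Store}
    (h0 : Inv 0 (s.setNat m 0 0 0 0)) (hb : ∀ i s, Inv i s → b.eval s = n)
    (hi : ∀ i s, Inv i s → s.nat m 0 0 0 = i)
    (hc : ∀ i < n, ∀ s, Inv i s →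
      Does c T s fun s' => s'.nat m 0 0 0 = i ∧ Inv (i + 1) (s'.setNat m 0 0 0 (i + 1))) :
    Does (Prog.count m b c) (n * (T + 2) + 2) s (Inv n) := by
  have key : ∀ r i s, i + r = n → Inv i s →
      Does (.loop (.ltN (cnt m) b)
        (.seq c (.setN m (.lit 0) (.lit 0) (.lit 0) (.add (cnt m) (.lit 1)))))
        (r * (T + 2) + 1) s (Inv n) := by
    intro r
    induction r with
    | zero =>
      intro i s hin hs
      obtain rfl : i = n := by omega
      refine ⟨1, s, by omega, .loop_false ?_, hs⟩
      simp [Test.Holds, NExp.eval, hb _ _ hs, hi _ _ hs]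
    | succ r ih =>
      intro i s hin hs
      obtain ⟨t, s', ht, hr, hcn, hs'⟩ := hc i (by omega) s hs
      obtain ⟨t', s'', ht', hr', hs''⟩ := ih (i + 1) _ (by omega) hs'
      refine ⟨t + 1 + 1 + t', s'', ?_, .loop_true ?_ (.seq hr ?_) hr', hs''⟩
      · rw [Nat.succ_mul]; omega
      · simp only [Test.Holds, NExp.eval, hb _ _ hs, hi _ _ hs]; omega
      · have := Run.setN s' m (.lit 0) (.lit 0) (.lit 0) (.add (cnt m) (.lit 1))
        simpa [NExp.eval, hcn] using this
  have := Does.seq (T := 1) (s := s) (P := Inv 0)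
    (Does.setN (i := .lit 0) (j := .lit 0) (k := .lit 0) (x := .lit 0) (a := m) h0)
    (fun s' hs' => key n 0 s' (by omega) hs')
  exact this.mono (by omega) fun _ h => h

/-! ## Memory layout -/

/-- A real array. -/
abbrev Arr : Type := ℕ → ℕ → ℕ → ℝ

/-- The common range of all indices of auxiliary arrays. -/
def Uplink.dim (I : Uplink) : ℕ := I.size + 3

/-- The array `A` with the entries out of range replaced by `0`. -/
noncomputable def boxed (n : ℕ) (A : Arr) : Arr := fun i j k =>
  if i < n ∧ j < n ∧ k < n then A i j k else 0

theorem boxed_boxed (n : ℕ) (A : Arr) : boxed n (boxed n A) = boxed n A := by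
  funext i j k
  simp only [boxed]
  split_ifs <;> rfl

theorem boxed_apply {n : ℕ} {A : Arr} {i j k : ℕ} (hi : i < n) (hj : j < n) (hk : k < n) :
    boxed n A i j k = A i j k := by simp [boxed, hi, hj, hk]

/-- The auxiliary real arrays vanish out of range. -/
def Clean (I : Uplink) (s : Store) : Prop :=
  ∀ a, 12 ≤ a → ∀ i j k, ¬ (i < I.dim ∧ j < I.dim ∧ k < I.dim) → s.real a i j k = 0

/-- The memories agree below level `d`. -/
def Same (d : ℕ) (s s' : Store) : Prop :=
  (∀ a < 4 + d, s'.nat a = s.nat a) ∧ ∀ a < 12 + d, s'.real a = s.real a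

theorem Same.refl (d : ℕ) (s : Store) : Same d s s := ⟨fun _ _ => rfl, fun _ _ => rfl⟩

theorem Same.trans {d : ℕ} {s s' s'' : Store} (h : Same d s s') (h' : Same d s' s'') :
    Same d s s'' :=
  ⟨fun a ha => (h'.1 a ha).trans (h.1 a ha), fun a ha => (h'.2 a ha).trans (h.2 a ha)⟩

/-- Levels organize scratch memory. Natural arrays 0 to 2 hold input and 3 the output, real arrays 0
to 11 hold input, so level `d` owns the arrays `4 + d` and `12 + d`. Code compiled at level `d`
writes only at level `d` or above, hence respects every lower level. -/
theorem Same.mono {d d' : ℕ} {s s' : Store} (h : Same d' s s') (hd : d ≤ d') : Same d s s' :=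
  ⟨fun a ha => h.1 a (by omega), fun a ha => h.2 a (by omega)⟩

theorem setNat_nat_of_ne {s : Store} {a b i j k v : ℕ} (h : b ≠ a) :
    (s.setNat a i j k v).nat b = s.nat b := by
  funext i' j' k'; simp [Store.setNat, h]

theorem setReal_real_of_ne {s : Store} {a b i j k : ℕ} {v : ℝ} (h : b ≠ a) :
    (s.setReal a i j k v).real b = s.real b := by
  funext i' j' k'; simp [Store.setReal, h]

@[simp] theorem setNat_nat_self {s : Store} {a i j k v : ℕ} :
    (s.setNat a i j k v).nat a i j k = v := by simp [Store.setNat]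

@[simp] theorem setReal_real_self {s : Store} {a i j k : ℕ} {v : ℝ} :
    (s.setReal a i j k v).real a i j k = v := by simp [Store.setReal]

@[simp] theorem setNat_real {s : Store} {a i j k v : ℕ} : (s.setNat a i j k v).real = s.real := rfl

@[simp] theorem setReal_nat {s : Store} {a i j k : ℕ} {v : ℝ} :
    (s.setReal a i j k v).nat = s.nat := rfl

theorem Same.setNat {d a i j k v : ℕ} {s s' : Store} (h : Same d s s') (ha : 4 + d ≤ a) :
    Same d s (s'.setNat a i j k v) :=
  ⟨fun b hb => by rw [setNat_nat_of_ne (by omega), h.1 b hb], fun b hb => h.2 b hb⟩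

theorem Same.setReal {d a i j k : ℕ} {v : ℝ} {s s' : Store} (h : Same d s s') (ha : 12 + d ≤ a) :
    Same d s (s'.setReal a i j k v) :=
  ⟨fun b hb => h.1 b hb, fun b hb => by rw [setReal_real_of_ne (by omega), h.2 b hb]⟩

theorem Clean.setNat {I : Uplink} {s : Store} {a i j k v : ℕ} (h : Clean I s) :
    Clean I (s.setNat a i j k v) := h

theorem Clean.setReal {I : Uplink} {s : Store} {a i j k : ℕ} {v : ℝ} (h : Clean I s)
    (hi : i < I.dim) (hj : j < I.dim) (hk : k < I.dim) : Clean I (s.setReal a i j k v) := by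
  intro b hb i' j' k' hn
  simp only [Store.setReal]
  rw [if_neg]
  · exact h b hb _ _ _ hn
  · rintro ⟨-, rfl, rfl, rfl⟩; exact hn ⟨hi, hj, hk⟩

theorem Clean.setReal_zero {I : Uplink} {s : Store} {a : ℕ} {v : ℝ} (h : Clean I s) :
    Clean I (s.setReal a 0 0 0 v) :=
  h.setReal (by simp [Uplink.dim]) (by simp [Uplink.dim]) (by simp [Uplink.dim])

/-! ## Contexts and implementable functions -/

/-- A context: values of type `X`, each of which belongs to an instance, and their representation
in the memory below level `lvl`. -/
structure Ctx (X : Type) where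
  lvl : ℕ
  inst : X → Uplink
  rep : X → Store → Prop
  rep_same : ∀ {x s s'}, rep x s → Same lvl s s' → rep x s'
  rep_input : ∀ {x s}, rep x s →
    (∀ a < 3, s.nat a = (inst x).input.nat a) ∧ ∀ a < 12, s.real a = (inst x).input.real a

namespace Ctx

variable {X : Type}

/-- The context that knows only the instance. -/
noncomputable def base : Ctx Uplink where
  lvl := 0
  inst := id
  rep I s := (∀ a < 3, s.nat a = I.input.nat a) ∧ ∀ a < 12, s.real a = I.input.real a
  rep_same h h' := ⟨fun a ha => (h'.1 a (by omega)).trans (h.1 a ha),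
    fun a ha => (h'.2 a (by omega)).trans (h.2 a ha)⟩
  rep_input h := h

/-- The context with an additional natural number, at level `l`. -/
def natAt (Γ : Ctx X) (l : ℕ) : Ctx (X × ℕ) where
  lvl := max Γ.lvl (l + 1)
  inst x := Γ.inst x.1
  rep x s := Γ.rep x.1 s ∧ s.nat (4 + l) 0 0 0 = x.2
  rep_same h h' := ⟨Γ.rep_same h.1 (h'.mono (le_max_left _ _)), by
    rw [h'.1 _ (by have := le_max_right Γ.lvl (l + 1); omega)]; exact h.2⟩
  rep_input h := Γ.rep_input h.1

/-- The context with an additional array, at level `l`. -/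
def arrAt (Γ : Ctx X) (l : ℕ) : Ctx (X × Arr) where
  lvl := max Γ.lvl (l + 1)
  inst x := Γ.inst x.1
  rep x s := Γ.rep x.1 s ∧ s.real (12 + l) = x.2
  rep_same h h' := ⟨Γ.rep_same h.1 (h'.mono (le_max_left _ _)), by
    rw [h'.2 _ (by have := le_max_right Γ.lvl (l + 1); omega)]; exact h.2⟩
  rep_input h := Γ.rep_input h.1

end Ctx

variable {X : Type}

/-- The function is given by an expression of natural number type. -/
def ImplN (Γ : Ctx X) (f : X → ℕ) : Prop :=
  ∃ e : NExp, ∀ x s, Γ.rep x s → e.eval s = f x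

/-- The function is given by an expression of natural number type and polynomially bounded. -/
def ImplB (Γ : Ctx X) (b : X → ℕ) : Prop :=
  ImplN Γ b ∧ ∃ p : Polynomial ℕ, ∀ x, b x ≤ p.eval (Γ.inst x).size

/-- The array is available in the memory. -/
def VarA (Γ : Ctx X) (a : X → Arr) : Prop :=
  ∃ m, ∀ x s, Γ.rep x s → s.real m = a x

/-- The real function is computed by a program in polynomial time. -/
def ImplR (Γ : Ctx X) (f : X → ℝ) : Prop :=
  ∀ d, Γ.lvl ≤ d → ∃ (c : Prog) (p : Polynomial ℕ), ∀ x s, Γ.rep x s → Clean (Γ.inst x) s →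
    Does c (p.eval (Γ.inst x).size) s fun s' =>
      Same d s s' ∧ Clean (Γ.inst x) s' ∧ s'.real (12 + d) 0 0 0 = f x

/-- All entries of the array are computed by a program in polynomial time. -/
def ImplA (Γ : Ctx X) (F : X → Arr) : Prop :=
  ∀ l l' l'', ImplR (((Γ.natAt l).natAt l').natAt l'')
    fun x => F x.1.1.1 x.1.1.2 x.1.2 x.2

section weakening

variable {Γ : Ctx X} {l : ℕ}

theorem ImplN.lit (c : ℕ) : ImplN Γ fun _ => c := ⟨.lit c, fun _ _ _ => rfl⟩

theorem ImplN.add {f g : X → ℕ} (hf : ImplN Γ f) (hg : ImplN Γ g) :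
    ImplN Γ fun x => f x + g x := by
  obtain ⟨e, he⟩ := hf
  obtain ⟨e', he'⟩ := hg
  exact ⟨.add e e', fun x s h => by simp [NExp.eval, he x s h, he' x s h]⟩

theorem ImplN.natAt {f : X → ℕ} (h : ImplN Γ f) : ImplN (Γ.natAt l) fun x => f x.1 := by
  obtain ⟨e, he⟩ := h
  exact ⟨e, fun x s hx => he x.1 s hx.1⟩

theorem ImplN.arrAt {f : X → ℕ} (h : ImplN Γ f) : ImplN (Γ.arrAt l) fun x => f x.1 := by
  obtain ⟨e, he⟩ := h
  exact ⟨e, fun x s hx => he x.1 s hx.1⟩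

theorem ImplN.var : ImplN (Γ.natAt l) fun x => x.2 :=
  ⟨cnt (4 + l), fun x s hx => by simpa [NExp.eval] using hx.2⟩

theorem ImplN.input {m : ℕ} (hm : m < 3) {i j k : X → ℕ} (hi : ImplN Γ i) (hj : ImplN Γ j)
    (hk : ImplN Γ k) : ImplN Γ fun x => (Γ.inst x).input.nat m (i x) (j x) (k x) := by
  obtain ⟨e, he⟩ := hi
  obtain ⟨e', he'⟩ := hj
  obtain ⟨e'', he''⟩ := hk
  refine ⟨.read m e e' e'', fun x s hx => ?_⟩
  simp [NExp.eval, he x s hx, he' x s hx, he'' x s hx, (Γ.rep_input hx).1 m hm]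

theorem VarA.natAt {a : X → Arr} (h : VarA Γ a) : VarA (Γ.natAt l) fun x => a x.1 := by
  obtain ⟨m, he⟩ := h
  exact ⟨m, fun x s hx => he x.1 s hx.1⟩

theorem VarA.arrAt {a : X → Arr} (h : VarA Γ a) : VarA (Γ.arrAt l) fun x => a x.1 := by
  obtain ⟨m, he⟩ := h
  exact ⟨m, fun x s hx => he x.1 s hx.1⟩

theorem VarA.var : VarA (Γ.arrAt l) fun x => x.2 := ⟨12 + l, fun _ _ hx => hx.2⟩

theorem VarA.input {m : ℕ} (hm : m < 12) : VarA Γ fun x => (Γ.inst x).input.real m :=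
  ⟨m, fun _ _ hx => (Γ.rep_input hx).2 m hm⟩

end weakening

/-! ### Dimensions of the instance as loop bounds -/

section dims

variable {Γ : Ctx X}

theorem ImplN.dims {m : ℕ} {f : Uplink → ℕ} (h : ∀ I : Uplink, I.input.nat 0 m 0 0 = f I) :
    ImplN Γ fun x => f (Γ.inst x) := by
  have := ImplN.input (Γ := Γ) (m := 0) (by omega) (ImplN.lit m) (ImplN.lit 0) (ImplN.lit 0)
  simpa only [h] using this

theorem ImplN.K : ImplN Γ fun x => (Γ.inst x).K := .dims (m := 0) fun _ => rfl
theorem ImplN.N : ImplN Γ fun x => (Γ.inst x).N := .dims (m := 1) fun _ => rfl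
theorem ImplN.L : ImplN Γ fun x => (Γ.inst x).L := .dims (m := 2) fun _ => rfl
theorem ImplN.Nr : ImplN Γ fun x => (Γ.inst x).Nr := .dims (m := 3) fun _ => rfl
theorem ImplN.nW : ImplN Γ fun x => (Γ.inst x).nW := .dims (m := 4) fun _ => rfl
theorem ImplN.nB : ImplN Γ fun x => (Γ.inst x).nB := .dims (m := 5) fun _ => rfl
theorem ImplN.chains : ImplN Γ fun x => (Γ.inst x).chains := .dims (m := 6) fun _ => rfl

theorem ImplN.dim : ImplN Γ fun x => (Γ.inst x).dim :=
  (((((ImplN.K.add .N).add .L).add .Nr).add .nW).add .nB).add (.lit 3)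

theorem ImplB.of_le {b : X → ℕ} (h : ImplN Γ b) (hb : ∀ x, b x ≤ (Γ.inst x).dim) :
    ImplB Γ b := ⟨h, Polynomial.X + 3, fun x => by simpa [Uplink.dim] using hb x⟩

theorem ImplB.K : ImplB Γ fun x => (Γ.inst x).K :=
  .of_le .K fun x => by simp only [Uplink.dim, Uplink.size]; omega
theorem ImplB.N : ImplB Γ fun x => (Γ.inst x).N :=
  .of_le .N fun x => by simp only [Uplink.dim, Uplink.size]; omega
theorem ImplB.L : ImplB Γ fun x => (Γ.inst x).L :=
  .of_le .L fun x => by simp only [Uplink.dim, Uplink.size]; omega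
theorem ImplB.Nr : ImplB Γ fun x => (Γ.inst x).Nr :=
  .of_le .Nr fun x => by simp only [Uplink.dim, Uplink.size]; omega
theorem ImplB.nW : ImplB Γ fun x => (Γ.inst x).nW :=
  .of_le .nW fun x => by simp only [Uplink.dim, Uplink.size]; omega
theorem ImplB.nB : ImplB Γ fun x => (Γ.inst x).nB :=
  .of_le .nB fun x => by simp only [Uplink.dim, Uplink.size]; omega
theorem ImplB.dim : ImplB Γ fun x => (Γ.inst x).dim := .of_le .dim fun _ => le_rfl

end dims

/-! ## Scalar operations -/

section scalar

variable {Γ : Ctx X}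

theorem ImplR.natCast {f : X → ℕ} (h : ImplN Γ f) : ImplR Γ fun x => (f x : ℝ) := by
  obtain ⟨e, he⟩ := h
  intro d _
  refine ⟨.setR (12 + d) (.lit 0) (.lit 0) (.lit 0) (.ofNat e), 1, fun x s hx hs => ?_⟩
  rw [Polynomial.eval_one]
  refine Does.setR ⟨(Same.refl d s).setReal le_rfl, hs.setReal_zero, ?_⟩
  simp [NExp.eval, RExp.eval, he x s hx]

theorem ImplR.read {a : X → Arr} {i j k : X → ℕ} (ha : VarA Γ a) (hi : ImplN Γ i)
    (hj : ImplN Γ j) (hk : ImplN Γ k) : ImplR Γ fun x => a x (i x) (j x) (k x) := by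
  obtain ⟨m, hm⟩ := ha
  obtain ⟨e, he⟩ := hi
  obtain ⟨e', he'⟩ := hj
  obtain ⟨e'', he''⟩ := hk
  intro d _
  refine ⟨.setR (12 + d) (.lit 0) (.lit 0) (.lit 0) (.read m e e' e''), 1, fun x s hx hs => ?_⟩
  rw [Polynomial.eval_one]
  refine Does.setR ⟨(Same.refl d s).setReal le_rfl, hs.setReal_zero, ?_⟩
  simp [NExp.eval, RExp.eval, he x s hx, he' x s hx, he'' x s hx, hm x s hx]

theorem ImplR.unop {f : X → ℝ} (op : RExp → RExp) (op' : ℝ → ℝ)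
    (h : ∀ e s, (op e).eval s = op' (e.eval s)) (hf : ImplR Γ f) : ImplR Γ fun x => op' (f x) := by
  intro d hd
  obtain ⟨c, p, hc⟩ := hf d hd
  refine ⟨.seq c (.setR (12 + d) (.lit 0) (.lit 0) (.lit 0) (op (scal (12 + d)))), p + 1,
    fun x s hx hs => ?_⟩
  rw [Polynomial.eval_add, Polynomial.eval_one]
  refine (hc x s hx hs).seq ?_
  rintro s' ⟨h1, h2, h3⟩
  refine Does.setR ⟨h1.setReal le_rfl, h2.setReal_zero, ?_⟩
  simp [NExp.eval, h, RExp.eval, h3]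

/-- The second program is compiled one level higher, so the first result survives it. This is why
`ImplR` asks for a program at every sufficiently high level. -/
theorem ImplR.two {f g : X → ℝ} (hf : ImplR Γ f) (hg : ImplR Γ g) {d : ℕ} (hd : Γ.lvl ≤ d) :
    ∃ (c : Prog) (p : Polynomial ℕ), ∀ x s, Γ.rep x s → Clean (Γ.inst x) s →
      Does c (p.eval (Γ.inst x).size) s fun s' => Same d s s' ∧ Clean (Γ.inst x) s' ∧
        s'.real (12 + d) 0 0 0 = f x ∧ s'.real (12 + (d + 1)) 0 0 0 = g x := by
  obtain ⟨c, p, hc⟩ := hf d hd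
  obtain ⟨c', p', hc'⟩ := hg (d + 1) (by omega)
  refine ⟨.seq c c', p + p', fun x s hx hs => ?_⟩
  rw [Polynomial.eval_add]
  refine (hc x s hx hs).seq ?_
  rintro s' ⟨h1, h2, h3⟩
  refine (hc' x s' (Γ.rep_same hx (h1.mono hd)) h2).mono le_rfl ?_
  rintro s'' ⟨h4, h5, h6⟩
  exact ⟨h1.trans (h4.mono (by omega)), h5, by rw [h4.2 _ (by omega), h3], h6⟩

theorem ImplR.binop {f g : X → ℝ} (op : RExp → RExp → RExp) (op' : ℝ → ℝ → ℝ)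
    (h : ∀ e e' s, (op e e').eval s = op' (e.eval s) (e'.eval s)) (hf : ImplR Γ f)
    (hg : ImplR Γ g) : ImplR Γ fun x => op' (f x) (g x) := by
  intro d hd
  obtain ⟨c, p, hc⟩ := hf.two hg hd
  refine ⟨.seq c (.setR (12 + d) (.lit 0) (.lit 0) (.lit 0)
    (op (scal (12 + d)) (scal (12 + (d + 1))))), p + 1, fun x s hx hs => ?_⟩
  rw [Polynomial.eval_add, Polynomial.eval_one]
  refine (hc x s hx hs).seq ?_
  rintro s' ⟨h1, h2, h3, h4⟩
  refine Does.setR ⟨h1.setReal le_rfl, h2.setReal_zero, ?_⟩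
  simp [NExp.eval, h, RExp.eval, h3, h4]

theorem ImplR.add {f g : X → ℝ} (hf : ImplR Γ f) (hg : ImplR Γ g) :
    ImplR Γ fun x => f x + g x := hf.binop .add (· + ·) (fun _ _ _ => rfl) hg

theorem ImplR.sub {f g : X → ℝ} (hf : ImplR Γ f) (hg : ImplR Γ g) :
    ImplR Γ fun x => f x - g x := hf.binop .sub (· - ·) (fun _ _ _ => rfl) hg

theorem ImplR.mul {f g : X → ℝ} (hf : ImplR Γ f) (hg : ImplR Γ g) :
    ImplR Γ fun x => f x * g x := hf.binop .mul (· * ·) (fun _ _ _ => rfl) hg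

theorem ImplR.div {f g : X → ℝ} (hf : ImplR Γ f) (hg : ImplR Γ g) :
    ImplR Γ fun x => f x / g x := hf.binop .div (· / ·) (fun _ _ _ => rfl) hg

theorem ImplR.exp {f : X → ℝ} (hf : ImplR Γ f) : ImplR Γ fun x => Real.exp (f x) :=
  hf.unop .exp _ fun _ _ => rfl

theorem ImplR.log {f : X → ℝ} (hf : ImplR Γ f) : ImplR Γ fun x => Real.log (f x) :=
  hf.unop .log _ fun _ _ => rfl

theorem ImplR.zero : ImplR Γ fun _ => 0 := by simpa using ImplR.natCast (Γ := Γ) (.lit 0)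
theorem ImplR.one : ImplR Γ fun _ => 1 := by simpa using ImplR.natCast (Γ := Γ) (.lit 1)
theorem ImplR.ofNat (n : ℕ) [n.AtLeastTwo] : ImplR Γ fun _ => (OfNat.ofNat n : ℝ) := by
  simpa using ImplR.natCast (Γ := Γ) (.lit (OfNat.ofNat n))

theorem ImplR.neg {f : X → ℝ} (hf : ImplR Γ f) : ImplR Γ fun x => -f x := by
  simpa using ImplR.zero.sub hf

theorem ImplR.pow {f : X → ℝ} (hf : ImplR Γ f) (n : ℕ) : ImplR Γ fun x => f x ^ n := by
  induction n with
  | zero => simpa using ImplR.one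
  | succ n ih => simpa only [pow_succ] using ih.mul hf

theorem ImplR.ite_lt {f g a b : X → ℝ} (hf : ImplR Γ f) (hg : ImplR Γ g) (ha : ImplR Γ a)
    (hb : ImplR Γ b) : ImplR Γ fun x => if f x < g x then a x else b x := by
  intro d hd
  obtain ⟨c, p, hc⟩ := hf.two hg hd
  obtain ⟨c₁, p₁, hc₁⟩ := ha d hd
  obtain ⟨c₂, p₂, hc₂⟩ := hb d hd
  refine ⟨.seq c (.branch (.ltR (scal (12 + d)) (scal (12 + (d + 1)))) c₁ c₂),
    p + (p₁ + p₂ + 1), fun x s hx hs => ?_⟩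
  rw [Polynomial.eval_add, Polynomial.eval_add, Polynomial.eval_add, Polynomial.eval_one]
  refine (hc x s hx hs).seq ?_
  rintro s' ⟨h1, h2, h3, h4⟩
  have hx' := Γ.rep_same hx (h1.mono hd)
  refine Does.branch (fun ht => ?_) fun ht => ?_
  · simp only [Test.Holds, RExp.eval, NExp.eval, h3, h4] at ht
    refine (hc₁ x s' hx' h2).mono le_rfl ?_
    rintro s'' ⟨h5, h6, h7⟩
    exact ⟨h1.trans h5, h6, by simp only [if_pos ht, h7]⟩
  · simp only [Test.Holds, RExp.eval, NExp.eval, h3, h4] at ht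
    refine (hc₂ x s' hx' h2).mono le_rfl ?_
    rintro s'' ⟨h5, h6, h7⟩
    exact ⟨h1.trans h5, h6, by simp only [if_neg ht, h7]⟩

/-- Counter and accumulator live at level `d`; the summand is compiled at `d + 1`, with the counter
as an additional variable of its context, and therefore disturbs neither. -/
theorem ImplR.sum {b : X → ℕ} {f : X → ℕ → ℝ} (hb : ImplB Γ b)
    (hf : ∀ l, ImplR (Γ.natAt l) fun x => f x.1 x.2) :
    ImplR Γ fun x => ∑ i ∈ Finset.range (b x), f x i := by
  obtain ⟨⟨e, he⟩, q, hq⟩ := hb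
  intro d hd
  obtain ⟨c, p, hc⟩ := hf d (d + 1) (by simp only [Ctx.natAt]; omega)
  refine ⟨.seq (.setR (12 + d) (.lit 0) (.lit 0) (.lit 0) (.ofNat (.lit 0)))
    (Prog.count (4 + d) e (.seq c (.setR (12 + d) (.lit 0) (.lit 0) (.lit 0)
      (.add (scal (12 + d)) (scal (12 + (d + 1))))))), 1 + (q * (p + 1 + 2) + 2),
    fun x s hx hs => ?_⟩
  have key : Does (.seq (.setR (12 + d) (.lit 0) (.lit 0) (.lit 0) (.ofNat (.lit 0)))
    (Prog.count (4 + d) e (.seq c (.setR (12 + d) (.lit 0) (.lit 0) (.lit 0)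
      (.add (scal (12 + d)) (scal (12 + (d + 1))))))))
      (1 + (b x * (p.eval (Γ.inst x).size + 1 + 2) + 2)) s fun s' =>
      Same d s s' ∧ Clean (Γ.inst x) s' ∧ s'.nat (4 + d) 0 0 0 = b x ∧
        s'.real (12 + d) 0 0 0 = ∑ i ∈ Finset.range (b x), f x i := by
    refine Does.seq (P := fun s' => Same d s s' ∧ Clean (Γ.inst x) s' ∧
      s'.real (12 + d) 0 0 0 = 0) (Does.setR ⟨(Same.refl d s).setReal le_rfl, hs.setReal_zero, ?_⟩)
      ?_
    · simp [NExp.eval, RExp.eval]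
    rintro s1 ⟨h1, h2, h3⟩
    refine Does.count (fun i s' => Same d s s' ∧ Clean (Γ.inst x) s' ∧ s'.nat (4 + d) 0 0 0 = i ∧
        s'.real (12 + d) 0 0 0 = ∑ i ∈ Finset.range i, f x i) ?_ ?_ ?_ ?_
    · exact ⟨h1.setNat le_rfl, h2.setNat, by simp, by simp [h3]⟩
    · intro i s' h
      exact he x s' (Γ.rep_same hx (h.1.mono hd))
    · exact fun i s' h => h.2.2.1
    · rintro i - s' ⟨h4, h5, h6, h7⟩
      refine (hc (x, i) s' ⟨Γ.rep_same hx (h4.mono hd), h6⟩ h5).seq ?_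
      rintro s'' ⟨h8, h9, h10⟩
      refine Does.setR ⟨?_, ?_, h9.setReal_zero, ?_, ?_⟩
      · simp only [setReal_nat]
        rw [h8.1 _ (by omega), h6]
      · exact ((h4.trans (h8.mono (by omega))).setReal le_rfl).setNat le_rfl
      · simp
      · simp only [setNat_real, NExp.eval, setReal_real_self, RExp.eval]
        rw [h10, h8.2 _ (by omega), h7, Finset.sum_range_succ]
  refine key.mono ?_ fun s' h => ⟨h.1, h.2.1, h.2.2.2⟩
  simp only [Polynomial.eval_add, Polynomial.eval_mul, Polynomial.eval_one, Polynomial.eval_ofNat]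
  have := Nat.mul_le_mul_right (p.eval (Γ.inst x).size + 1 + 2) (hq x)
  omega

end scalar

/-! ## Arrays -/

/-- The array `A` with the entries in `R` replaced by those of `F`. -/
noncomputable def overwrite (R : ℕ → ℕ → ℕ → Prop) (F A : Arr) : Arr := fun i j k =>
  open Classical in if R i j k then F i j k else A i j k

/-- All rounds write values of the one target `F`, so overlaps are harmless and the rewritten region
is the union over the rounds. In this form loops can be nested. -/
theorem Does.forOverwrite {m' m n T : ℕ} {e : NExp} {c : Prog} {F : Arr}
    (R : ℕ → ℕ → ℕ → ℕ → Prop) (Q : Store → Prop) {s : Store}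
    (he : ∀ s, Q s → e.eval s = n) (hn : ∀ s v, Q s → Q (s.setNat m' 0 0 0 v))
    (hc : ∀ i < n, ∀ s, Q s → s.nat m' 0 0 0 = i → Does c T s fun s' =>
      Q s' ∧ s'.nat m' 0 0 0 = i ∧ s'.real m = overwrite (R i) F (s.real m)) (hs : Q s) :
    Does (Prog.count m' e c) (n * (T + 2) + 2) s fun s' =>
      Q s' ∧ s'.real m = overwrite (fun i j k => ∃ r < n, R r i j k) F (s.real m) := by
  refine (Does.count (fun r s' => Q s' ∧ s'.nat m' 0 0 0 = r ∧
    s'.real m = overwrite (fun i j k => ∃ r' < r, R r' i j k) F (s.real m)) ?_ ?_ ?_ ?_).mono le_rfl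
    fun s' h => ⟨h.1, h.2.2⟩
  · refine ⟨hn _ _ hs, by simp, ?_⟩
    funext i j k
    simp [overwrite]
  · exact fun i s h => he s h.1
  · exact fun i s h => h.2.1
  · rintro r hr s' ⟨h1, h2, h3⟩
    refine (hc r hr s' h1 h2).mono le_rfl ?_
    rintro s'' ⟨h4, h5, h6⟩
    refine ⟨h5, hn _ _ h4, by simp, ?_⟩
    rw [setNat_real, h6, h3]
    funext i j k
    simp only [overwrite]
    by_cases h : R r i j k
    · rw [if_pos h, if_pos ⟨r, by omega, h⟩]
    · rw [if_neg h]
      congr 1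
      simp only [eq_iff_iff]
      constructor
      · rintro ⟨r', h', h''⟩; exact ⟨r', by omega, h''⟩
      · rintro ⟨r', h', h''⟩
        refine ⟨r', ?_, h''⟩
        rcases Nat.lt_succ_iff_lt_or_eq.mp h' with h' | rfl
        · exact h'
        · exact absurd h'' h

/-- A threefold loop with its counters at the levels `d`, `d + 1`, `d + 2`. -/
def Prog.loop3 (d : ℕ) (e : NExp) (c : Prog) : Prog :=
  Prog.count (4 + d) e (Prog.count (4 + (d + 1)) e (Prog.count (4 + (d + 2)) e c))

theorem Does.loop3 {d m n T : ℕ} {e : NExp} {c : Prog} {F : Arr} (Q : Store → Prop) {s : Store}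
    (he : ∀ s, Q s → e.eval s = n) (hn : ∀ s a v, 4 + d ≤ a → Q s → Q (s.setNat a 0 0 0 v))
    (hc : ∀ i < n, ∀ j < n, ∀ k < n, ∀ s, Q s → s.nat (4 + d) 0 0 0 = i →
      s.nat (4 + (d + 1)) 0 0 0 = j → s.nat (4 + (d + 2)) 0 0 0 = k → Does c T s fun s' =>
      Q s' ∧ s'.nat (4 + d) 0 0 0 = i ∧ s'.nat (4 + (d + 1)) 0 0 0 = j ∧
      s'.nat (4 + (d + 2)) 0 0 0 = k ∧
      s'.real m = overwrite (fun i' j' k' => i' = i ∧ j' = j ∧ k' = k) F (s.real m)) (hs : Q s) :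
    Does (Prog.loop3 d e c) (n * (n * (n * (T + 2) + 2 + 2) + 2 + 2) + 2) s fun s' =>
      Q s' ∧ s'.real m = overwrite (fun i j k => i < n ∧ j < n ∧ k < n) F (s.real m) := by
  have h1 := Does.forOverwrite (m' := 4 + d) (m := m) (n := n) (e := e) (F := F)
    (T := n * (n * (T + 2) + 2 + 2) + 2) (c := Prog.count (4 + (d + 1)) e (Prog.count (4 + (d + 2)) e c))
    (fun r i j k => ∃ r' < n, ∃ r'' < n, i = r ∧ j = r' ∧ k = r'') Q (s := s) he
    (fun s v => hn s _ v le_rfl) ?_ hs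
  · refine h1.mono le_rfl ?_
    rintro s' ⟨h1, h2⟩
    refine ⟨h1, h2.trans ?_⟩
    congr 1
    funext i j k
    simp only [eq_iff_iff]
    constructor
    · rintro ⟨r, hr, r', hr', r'', hr'', rfl, rfl, rfl⟩; exact ⟨hr, hr', hr''⟩
    · rintro ⟨hi, hj, hk⟩; exact ⟨i, hi, j, hj, k, hk, rfl, rfl, rfl⟩
  intro i hi s hs hsi
  have h2 := Does.forOverwrite (m' := 4 + (d + 1)) (m := m) (n := n) (e := e) (F := F)
    (T := n * (T + 2) + 2) (c := Prog.count (4 + (d + 2)) e c)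
    (fun r' i' j k => ∃ r'' < n, i' = i ∧ j = r' ∧ k = r'')
    (fun s => Q s ∧ s.nat (4 + d) 0 0 0 = i) (s := s) (fun s h => he s h.1)
    (fun s v h => ⟨hn s _ v (by omega) h.1, by
      rw [setNat_nat_of_ne (by omega)]; exact h.2⟩) ?_ ⟨hs, hsi⟩
  · exact h2.mono le_rfl fun s' h => ⟨h.1.1, h.1.2, h.2⟩
  rintro j hj s ⟨hs, hsi⟩ hsj
  have h3 := Does.forOverwrite (m' := 4 + (d + 2)) (m := m) (n := n) (e := e) (F := F)
    (T := T) (c := c) (fun r'' i' j' k => i' = i ∧ j' = j ∧ k = r'')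
    (fun s => Q s ∧ s.nat (4 + d) 0 0 0 = i ∧ s.nat (4 + (d + 1)) 0 0 0 = j) (s := s)
    (fun s h => he s h.1)
    (fun s v h => ⟨hn s _ v (by omega) h.1, by
      rw [setNat_nat_of_ne (by omega), setNat_nat_of_ne (by omega)]; exact h.2⟩) ?_
      ⟨hs, hsi, hsj⟩
  · exact h3.mono le_rfl fun s' h => ⟨⟨h.1.1, h.1.2.1⟩, h.1.2.2, h.2⟩
  rintro k hk s ⟨hs, hsi, hsj⟩ hsk
  exact (hc i hi j hj k hk s hs hsi hsj hsk).mono le_rfl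
    fun s' h => ⟨⟨h.1, h.2.1, h.2.2.1⟩, h.2.2.2.1, h.2.2.2.2⟩

/-- Array variables are compared as functions on all of ℕ³, whereas a loop fills finitely many
entries. The zeros kept outside the box turn the result into an exact equality of functions. -/
theorem overwrite_box {n : ℕ} {F A : Arr}
    (h : ∀ i j k, ¬ (i < n ∧ j < n ∧ k < n) → A i j k = 0) :
    overwrite (fun i j k => i < n ∧ j < n ∧ k < n) F A = boxed n F := by
  funext i j k
  simp only [overwrite, boxed]
  split_ifs with h'
  · rfl
  · exact h i j k h'

theorem setReal_real_overwrite {s : Store} {a i j k : ℕ} {v : ℝ} {F : Arr} (h : v = F i j k) :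
    (s.setReal a i j k v).real a =
      overwrite (fun i' j' k' => i' = i ∧ j' = j ∧ k' = k) F (s.real a) := by
  funext i' j' k'
  simp only [Store.setReal, overwrite, true_and]
  by_cases h' : i' = i ∧ j' = j ∧ k' = k
  · rw [if_pos h', if_pos h']
    obtain ⟨rfl, rfl, rfl⟩ := h'
    exact h
  · rw [if_neg h', if_neg h']

/-- The polynomial time bound of a threefold loop with a body of time `p`. -/
noncomputable def loop3Time (p : Polynomial ℕ) : Polynomial ℕ :=
  let n : Polynomial ℕ := Polynomial.X + 3
  n * (n * (n * (p + 2) + 2 + 2) + 2 + 2) + 2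

theorem eval_loop3Time (p : Polynomial ℕ) (I : Uplink) : (loop3Time p).eval I.size =
    I.dim * (I.dim * (I.dim * (p.eval I.size + 2) + 2 + 2) + 2 + 2) + 2 := by
  simp [loop3Time, Uplink.dim]

section array

variable {Γ : Ctx X}

/-- The three counters occupy the levels `d` to `d + 2` and the array grows at level `d`; the
program for one entry is compiled at `d + 3`, out of their way. -/
theorem ImplA.fill {F : X → Arr} (hF : ImplA Γ F) {d : ℕ} (hd : Γ.lvl ≤ d) :
    ∃ (c : Prog) (p : Polynomial ℕ), ∀ x s, Γ.rep x s → Clean (Γ.inst x) s →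
      Does c (p.eval (Γ.inst x).size) s fun s' => Same d s s' ∧ Clean (Γ.inst x) s' ∧
        s'.real (12 + d) = boxed (Γ.inst x).dim (F x) := by
  obtain ⟨c, p, hc⟩ := hF d (d + 1) (d + 2) (d + 3) (by simp only [Ctx.natAt]; omega)
  obtain ⟨e, he⟩ := ImplN.dim (Γ := Γ)
  refine ⟨Prog.loop3 d e (.seq c (.setR (12 + d) (cnt (4 + d)) (cnt (4 + (d + 1))) (cnt (4 + (d + 2)))
    (scal (12 + (d + 3))))), loop3Time (p + 1), fun x s hx hs => ?_⟩
  rw [eval_loop3Time, Polynomial.eval_add, Polynomial.eval_one]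
  have := Does.loop3 (d := d) (m := 12 + d) (n := (Γ.inst x).dim) (e := e) (F := F x)
    (T := p.eval (Γ.inst x).size + 1)
    (c := .seq c (.setR (12 + d) (cnt (4 + d)) (cnt (4 + (d + 1))) (cnt (4 + (d + 2)))
    (scal (12 + (d + 3))))) (fun s' => Same d s s' ∧ Clean (Γ.inst x) s')
    (fun s' h => he x s' (Γ.rep_same hx (h.1.mono hd)))
    (fun s' a v ha h => ⟨h.1.setNat ha, h.2.setNat⟩) ?_ ⟨Same.refl d s, hs⟩
  · refine this.mono le_rfl ?_
    rintro s' ⟨⟨h1, h2⟩, h3⟩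
    exact ⟨h1, h2, h3.trans (overwrite_box (hs _ (by omega)))⟩
  rintro i hi j hj k hk s1 ⟨h1, h2⟩ hsi hsj hsk
  refine (hc (((x, i), j), k) s1 ⟨⟨⟨Γ.rep_same hx (h1.mono hd), hsi⟩, hsj⟩, hsk⟩ h2).seq ?_
  rintro s2 ⟨h3, h4, h5⟩
  have e1 : s2.nat (4 + d) 0 0 0 = i := by rw [h3.1 _ (by omega), hsi]
  have e2 : s2.nat (4 + (d + 1)) 0 0 0 = j := by rw [h3.1 _ (by omega), hsj]
  have e3 : s2.nat (4 + (d + 2)) 0 0 0 = k := by rw [h3.1 _ (by omega), hsk]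
  refine Does.setR ?_
  simp only [NExp.eval, e1, e2, e3, RExp.eval, setReal_nat]
  refine ⟨⟨(h1.trans (h3.mono (by omega))).setReal le_rfl, h4.setReal hi hj hk⟩,
    trivial, trivial, trivial, ?_⟩
  rw [setReal_real_overwrite (F := F x) h5, h3.2 _ (by omega)]

/-- In a recursion the new state is first built in a buffer at level `d + 1`, because its entries
read the whole old state at level `d`. The copy back uses counters from `d + 2` on, so the round
counter at level `d` is preserved. -/
theorem Does.copy {d : ℕ} {e : NExp} {I : Uplink} {s : Store} (hs : Clean I s)
    (he : ∀ s', Same d s s' → e.eval s' = I.dim) :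
    Does (Prog.loop3 (d + 2) e (.setR (12 + d) (cnt (4 + (d + 2))) (cnt (4 + (d + 2 + 1)))
      (cnt (4 + (d + 2 + 2))) (.read (12 + (d + 1)) (cnt (4 + (d + 2))) (cnt (4 + (d + 2 + 1)))
      (cnt (4 + (d + 2 + 2)))))) ((loop3Time 1).eval I.size) s fun s' =>
      Same d s s' ∧ Clean I s' ∧ s'.nat (4 + d) = s.nat (4 + d) ∧
        s'.real (12 + d) = s.real (12 + (d + 1)) := by
  rw [eval_loop3Time, Polynomial.eval_one]
  have := Does.loop3 (d := d + 2) (m := 12 + d) (n := I.dim) (e := e)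
    (F := s.real (12 + (d + 1))) (T := 1) (s := s)
    (c := .setR (12 + d) (cnt (4 + (d + 2))) (cnt (4 + (d + 2 + 1)))
      (cnt (4 + (d + 2 + 2))) (.read (12 + (d + 1)) (cnt (4 + (d + 2))) (cnt (4 + (d + 2 + 1)))
      (cnt (4 + (d + 2 + 2)))))
    (fun s' => Same d s s' ∧ Clean I s' ∧ s'.nat (4 + d) = s.nat (4 + d) ∧
      s'.real (12 + (d + 1)) = s.real (12 + (d + 1)))
    (fun s' h => he s' h.1)
    (fun s' a v ha h => ⟨h.1.setNat (by omega), h.2.1.setNat, by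
      rw [setNat_nat_of_ne (by omega), h.2.2.1], h.2.2.2⟩) ?_ ⟨Same.refl d s, hs, rfl, rfl⟩
  · refine this.mono le_rfl ?_
    rintro s' ⟨⟨h1, h2, h3, h4⟩, h5⟩
    refine ⟨h1, h2, h3, h5.trans ?_⟩
    rw [overwrite_box (hs _ (by omega))]
    funext i j k
    simp only [boxed]
    split_ifs with h
    · rfl
    · exact (hs _ (by omega) _ _ _ h).symm
  rintro i hi j hj k hk s1 ⟨h1, h2, h3, h4⟩ hsi hsj hsk
  refine Does.setR ?_
  simp only [NExp.eval, hsi, hsj, hsk, RExp.eval, setReal_nat]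
  refine ⟨⟨h1.setReal le_rfl, h2.setReal hi hj hk, h3, ?_⟩, trivial, trivial, trivial, ?_⟩
  · rw [setReal_real_of_ne (by omega), h4]
  · rw [setReal_real_overwrite (F := s.real (12 + (d + 1))) (by rw [h4])]

/-- The array after `t` rounds of the recursion `Φ`. -/
noncomputable def iterN (n : ℕ) (Φ : ℕ → Arr → Arr) (A : Arr) : ℕ → Arr
  | 0 => boxed n A
  | t + 1 => boxed n (Φ t (iterN n Φ A t))

/-- The state array and the round counter sit at level `d` and form the extended context of `Φ`; the
next state is filled in at level `d + 1` and copied down. Afterwards `f` reads the final state as a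
variable. -/
theorem ImplR.iterN {b : X → ℕ} {A : X → Arr} {Φ : X → ℕ → Arr → Arr} {f : X → Arr → ℝ}
    (hb : ImplB Γ b) (hA : ImplA Γ A)
    (hΦ : ∀ l l', ImplA ((Γ.arrAt l).natAt l') fun x => Φ x.1.1 x.2 x.1.2)
    (hf : ∀ l, ImplR (Γ.arrAt l) fun x => f x.1 x.2) :
    ImplR Γ fun x => f x (iterN (Γ.inst x).dim (Φ x) (A x) (b x)) := by
  obtain ⟨⟨e, he⟩, q, hq⟩ := hb
  intro d hd
  obtain ⟨e', he'⟩ := ImplN.dim (Γ := Γ)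
  obtain ⟨c₀, p₀, hc₀⟩ := hA.fill hd
  obtain ⟨c₁, p₁, hc₁⟩ := (hΦ d d).fill (d := d + 1) (by simp only [Ctx.natAt, Ctx.arrAt]; omega)
  obtain ⟨c₂, p₂, hc₂⟩ := hf d (d + 1) (by simp only [Ctx.arrAt]; omega)
  refine ⟨.seq c₀ (.seq (Prog.count (4 + d) e (.seq c₁ (Prog.loop3 (d + 2) e'
      (.setR (12 + d) (cnt (4 + (d + 2))) (cnt (4 + (d + 2 + 1)))
      (cnt (4 + (d + 2 + 2))) (.read (12 + (d + 1)) (cnt (4 + (d + 2))) (cnt (4 + (d + 2 + 1)))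
      (cnt (4 + (d + 2 + 2))))))))
      (.seq c₂ (.setR (12 + d) (.lit 0) (.lit 0) (.lit 0) (scal (12 + (d + 1)))))),
    p₀ + ((q * (p₁ + loop3Time 1 + 2) + 2) + (p₂ + 1)), fun x s hx hs => ?_⟩
  simp only [Polynomial.eval_add, Polynomial.eval_one, Polynomial.eval_mul, Polynomial.eval_ofNat]
  refine (hc₀ x s hx hs).seq ?_
  rintro s1 ⟨h1, h2, h3⟩
  refine Does.seq (P := fun s' => Same d s s' ∧ Clean (Γ.inst x) s' ∧
    s'.real (12 + d) = BeamBits.iterN (Γ.inst x).dim (Φ x) (A x) (b x)) ?_ ?_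
  · refine (Does.count (fun t s' => Same d s s' ∧ Clean (Γ.inst x) s' ∧ s'.nat (4 + d) 0 0 0 = t ∧
      s'.real (12 + d) = BeamBits.iterN (Γ.inst x).dim (Φ x) (A x) t)
      (n := b x) (T := p₁.eval (Γ.inst x).size + (loop3Time 1).eval (Γ.inst x).size)
      ?_ ?_ ?_ ?_).mono ?_ fun s' h => ⟨h.1, h.2.1, h.2.2.2⟩
    · exact ⟨h1.setNat le_rfl, h2.setNat, by simp, h3⟩
    · exact fun t s' h => he x s' (Γ.rep_same hx (h.1.mono hd))
    · exact fun t s' h => h.2.2.1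
    · rintro t - s2 ⟨h4, h5, h6, h7⟩
      refine (hc₁ ((x, BeamBits.iterN (Γ.inst x).dim (Φ x) (A x) t), t) s2
        ⟨⟨Γ.rep_same hx (h4.mono hd), h7⟩, h6⟩ h5).seq ?_
      rintro s3 ⟨h8, h9, h10⟩
      have h11 := h4.trans (h8.mono (by omega))
      refine (Does.copy (d := d) (I := Γ.inst x) h9 fun s' h =>
        he' x s' (Γ.rep_same hx ((h11.trans h).mono hd))).mono le_rfl ?_
      rintro s4 ⟨h12, h13, h14, h15⟩
      refine ⟨?_, ?_, h13.setNat, by simp, ?_⟩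
      · rw [h14, h8.1 _ (by omega), h6]
      · exact (h11.trans h12).setNat le_rfl
      · rw [setNat_real, h15, h10]; rfl
    · have := Nat.mul_le_mul_right
        (p₁.eval (Γ.inst x).size + (loop3Time 1).eval (Γ.inst x).size + 2) (hq x)
      omega
  · rintro s2 ⟨h4, h5, h6⟩
    refine (hc₂ (x, _) s2 ⟨Γ.rep_same hx (h4.mono hd), h6⟩ h5).seq ?_
    rintro s3 ⟨h7, h8, h9⟩
    refine Does.setR ⟨(h4.trans (h7.mono (by omega))).setReal le_rfl, h8.setReal_zero, ?_⟩
    simp [NExp.eval, RExp.eval, h9]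

/-- Binding an array is a recursion of zero rounds, with the identity as an idle step. Storing
truncates the array to the box. -/
theorem ImplR.letA {A : X → Arr} {f : X → Arr → ℝ} (hA : ImplA Γ A)
    (hf : ∀ l, ImplR (Γ.arrAt l) fun x => f x.1 x.2) :
    ImplR Γ fun x => f x (boxed (Γ.inst x).dim (A x)) :=
  ImplR.iterN (b := fun _ => 0) (Φ := fun _ _ A => A) (.of_le (.lit 0) fun _ => Nat.zero_le _) hA
    (fun _ _ _ _ _ => .read VarA.var.natAt.natAt.natAt.natAt ImplN.var.natAt.natAt
      ImplN.var.natAt ImplN.var) hf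

/-- A program that computes the array and marks the pairs with positive entry as the output. -/
theorem ImplA.output {F : Uplink → Arr} (hF : ImplA Ctx.base F) :
    ∃ (P : Prog) (p : Polynomial ℕ), ∀ I : Uplink, ∃ (t : ℕ) (s : Store),
      Run P I.input t s ∧ t ≤ p.eval I.size ∧
      I.output s = Finset.univ.filter fun e => 0 < F I e.1 e.2 0 := by
  obtain ⟨c, p, hc⟩ := hF.fill (d := 0) le_rfl
  obtain ⟨e₁, he₁⟩ := ImplN.nW (Γ := Ctx.base)
  obtain ⟨e₂, he₂⟩ := ImplN.nB (Γ := Ctx.base)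
  let body : Prog := .branch (.ltR (.ofNat (.lit 0)) (.read 12 (cnt 4) (cnt 5) (.lit 0)))
      (.setN 3 (cnt 4) (cnt 5) (.lit 0) (.lit 1)) (.setN 3 (cnt 4) (cnt 5) (.lit 0) (.lit 0))
  refine ⟨.seq c (Prog.count 4 e₁ (Prog.count 5 e₂ body)),
    p + ((.X * (.X * 5 + 2 + 2)) + 2), fun I => ?_⟩
  have hbase : Ctx.base.rep I I.input := ⟨fun _ _ => rfl, fun _ _ => rfl⟩
  have hclean : Clean I I.input := by
    intro a ha i j k _
    simp only [Uplink.input]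
    repeat rw [if_neg (by omega)]
  set A := boxed I.dim (F I) with hA
  -- `Q` tolerates writes to natural arrays from 3 on: the output goes to array 3, the two counters
  -- are arrays 4 and 5.
  let Q : Store → Prop := fun s => (∀ a < 3, s.nat a = I.input.nat a) ∧
    (∀ a < 12, s.real a = I.input.real a) ∧ s.real 12 = A
  have hQ : ∀ s a i j k v, 3 ≤ a → Q s → Q (s.setNat a i j k v) := fun s a i j k v ha h =>
    ⟨fun b hb => by rw [setNat_nat_of_ne (by omega), h.1 b hb], h.2⟩
  have hQb : ∀ s, Q s → Ctx.base.rep I s := fun s h => ⟨h.1, h.2.1⟩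
  have main : Does (.seq c (Prog.count 4 e₁ (Prog.count 5 e₂ body)))
      (p.eval I.size + (I.nW * ((I.nB * (3 + 2) + 2) + 2) + 2)) I.input fun s =>
      ∀ i < I.nW, ∀ j < I.nB, (s.nat 3 i j 0 ≠ 0 ↔ 0 < A i j 0) := by
    refine (hc I I.input hbase hclean).seq ?_
    rintro s ⟨h1, -, h2⟩
    have hs : Q s := ⟨fun a ha => h1.1 a (by omega), fun a ha => h1.2 a (by omega), h2⟩
    refine (Does.count (n := I.nW) (fun r s => Q s ∧ s.nat 4 0 0 0 = r ∧
      ∀ i < r, ∀ j < I.nB, (s.nat 3 i j 0 ≠ 0 ↔ 0 < A i j 0)) ?_ ?_ ?_ ?_).mono le_rfl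
      fun s h => h.2.2
    · exact ⟨hQ _ _ _ _ _ _ (by omega) hs, by simp, fun i hi => absurd hi (by omega)⟩
    · exact fun r s h => he₁ I s (hQb s h.1)
    · exact fun r s h => h.2.1
    rintro r - s ⟨h3, h4, h5⟩
    refine (Does.count (n := I.nB) (fun r' s => Q s ∧ s.nat 5 0 0 0 = r' ∧ s.nat 4 0 0 0 = r ∧
      (∀ i < r, ∀ j < I.nB, (s.nat 3 i j 0 ≠ 0 ↔ 0 < A i j 0)) ∧
      ∀ j < r', (s.nat 3 r j 0 ≠ 0 ↔ 0 < A r j 0)) ?_ ?_ ?_ ?_).mono le_rfl ?_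
    · refine ⟨hQ _ _ _ _ _ _ (by omega) h3, by simp, ?_, ?_, fun i hi => absurd hi (by omega)⟩
      · rw [setNat_nat_of_ne (by omega), h4]
      · rw [setNat_nat_of_ne (by omega)]; exact h5
    · exact fun r s h => he₂ I s (hQb s h.1)
    · exact fun r s h => h.2.1
    · rintro r' - s' ⟨h6, h7, h8, h9, h10⟩
      have step : ∀ v, (v ≠ 0 ↔ 0 < A r r' 0) → (s'.setNat 3 r r' 0 v).nat 5 0 0 0 = r' ∧
          Q ((s'.setNat 3 r r' 0 v).setNat 5 0 0 0 (r' + 1)) ∧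
          ((s'.setNat 3 r r' 0 v).setNat 5 0 0 0 (r' + 1)).nat 5 0 0 0 = r' + 1 ∧
          ((s'.setNat 3 r r' 0 v).setNat 5 0 0 0 (r' + 1)).nat 4 0 0 0 = r ∧
          (∀ i < r, ∀ j < I.nB, (((s'.setNat 3 r r' 0 v).setNat 5 0 0 0 (r' + 1)).nat 3 i j 0 ≠ 0 ↔
            0 < A i j 0)) ∧
          ∀ j < r' + 1, (((s'.setNat 3 r r' 0 v).setNat 5 0 0 0 (r' + 1)).nat 3 r j 0 ≠ 0 ↔
            0 < A r j 0) := by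
        intro v hv
        refine ⟨by rw [setNat_nat_of_ne (by omega), h7],
          hQ _ _ _ _ _ _ (by omega) (hQ _ _ _ _ _ _ (by omega) h6), by simp, ?_, ?_, ?_⟩
        · rw [setNat_nat_of_ne (by omega), setNat_nat_of_ne (by omega), h8]
        · intro i hi j hj
          rw [setNat_nat_of_ne (a := 5) (by omega)]
          simp only [Store.setNat]
          rw [if_neg fun h => by omega]
          exact h9 i hi j hj
        · intro j hj
          rw [setNat_nat_of_ne (by omega)]
          simp only [Store.setNat]
          split_ifs with h
          · obtain ⟨-, -, rfl, -⟩ := h; exact hv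
          · exact h10 j (lt_of_le_of_ne (Nat.lt_succ_iff.mp hj) fun h' => h ⟨trivial, trivial, h', trivial⟩)
      refine Does.branch (T := 1) (T' := 1) (fun ht => Does.setN ?_) fun ht => Does.setN ?_
      · simp only [Test.Holds, RExp.eval, NExp.eval, h6.2.2, h7, h8, Nat.cast_zero] at ht
        simp only [NExp.eval, h7, h8]
        exact step 1 (by simp [ht])
      · simp only [Test.Holds, RExp.eval, NExp.eval, h6.2.2, h7, h8, Nat.cast_zero] at ht
        simp only [NExp.eval, h7, h8]
        exact step 0 (by simpa using ht)
    · rintro s' ⟨h6, h7, h8, h9, h10⟩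
      refine ⟨h8, hQ _ _ _ _ _ _ (by omega) h6, by simp, ?_⟩
      rw [setNat_nat_of_ne (a := 4) (by omega)]
      intro i hi j hj
      rcases Nat.lt_succ_iff_lt_or_eq.mp hi with hi | rfl
      · exact h9 i hi j hj
      · exact h10 j hj
  obtain ⟨t, s, ht, hr, h⟩ := main
  refine ⟨t, s, hr, ht.trans ?_, ?_⟩
  · simp only [Polynomial.eval_add, Polynomial.eval_mul, Polynomial.eval_X, Polynomial.eval_ofNat]
    have h1 : I.nW ≤ I.size := by simp only [Uplink.size]; omega
    have h2 : I.nB ≤ I.size := by simp only [Uplink.size]; omega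
    gcongr
    norm_num
  · ext ⟨w, b⟩
    have hw : (w : ℕ) < I.dim := by have := w.2; simp only [Uplink.dim, Uplink.size]; omega
    have hb : (b : ℕ) < I.dim := by have := b.2; simp only [Uplink.dim, Uplink.size]; omega
    simp only [Uplink.output, Finset.mem_filter, Finset.mem_univ, true_and]
    rw [h w w.2 b b.2, hA, boxed_apply hw hb (by simp [Uplink.dim])]

end array

end BeamBits

/-! ### The algorithm as functions of arrays, and its compilation -/

namespace BeamBits

variable {X : Type} {Γ : Ctx X}

/-! ## Complex functions, array-valued functions, nested iteration -/

/-- The complex function is computed by a program in polynomial time. -/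
def ImplC (Γ : Ctx X) (f : X → ℂ) : Prop :=
  ImplR Γ (fun x => (f x).re) ∧ ImplR Γ fun x => (f x).im

theorem ImplC.sub {f g : X → ℂ} (hf : ImplC Γ f) (hg : ImplC Γ g) :
    ImplC Γ fun x => f x - g x := by
  refine ⟨?_, ?_⟩
  · simpa only [Complex.sub_re] using hf.1.sub hg.1
  · simpa only [Complex.sub_im] using hf.2.sub hg.2

theorem ImplC.mul {f g : X → ℂ} (hf : ImplC Γ f) (hg : ImplC Γ g) :
    ImplC Γ fun x => f x * g x := by
  refine ⟨?_, ?_⟩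
  · simpa only [Complex.mul_re] using (hf.1.mul hg.1).sub (hf.2.mul hg.2)
  · simpa only [Complex.mul_im] using (hf.1.mul hg.2).add (hf.2.mul hg.1)

theorem ImplC.conj {f : X → ℂ} (hf : ImplC Γ f) :
    ImplC Γ fun x => (starRingEnd ℂ) (f x) := by
  refine ⟨?_, ?_⟩
  · simpa only [Complex.conj_re] using hf.1
  · simpa only [Complex.conj_im] using hf.2.neg

theorem ImplC.ofReal {f : X → ℝ} (hf : ImplR Γ f) : ImplC Γ fun x => (f x : ℂ) := by
  refine ⟨?_, ?_⟩
  · simpa only [Complex.ofReal_re] using hf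
  · simpa only [Complex.ofReal_im] using ImplR.zero

theorem ImplC.mk {f g : X → ℝ} (hf : ImplR Γ f) (hg : ImplR Γ g) :
    ImplC Γ fun x => (⟨f x, g x⟩ : ℂ) := ⟨hf, hg⟩

theorem ImplC.sum {b : X → ℕ} {f : X → ℕ → ℂ} (hb : ImplB Γ b)
    (hf : ∀ l, ImplC (Γ.natAt l) fun x => f x.1 x.2) :
    ImplC Γ fun x => ∑ i ∈ Finset.range (b x), f x i := by
  refine ⟨?_, ?_⟩
  · simpa only [Complex.re_sum] using ImplR.sum hb fun l => (hf l).1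
  · simpa only [Complex.im_sum] using ImplR.sum hb fun l => (hf l).2

theorem ImplC.normSq {f : X → ℂ} (hf : ImplC Γ f) : ImplR Γ fun x => Complex.normSq (f x) := by
  simpa only [Complex.normSq_apply] using (hf.1.mul hf.1).add (hf.2.mul hf.2)

/-- An inner loop runs in a context with more variables than its body was compiled for. Forgetting
variables is sound when the larger context represents the smaller one and has at least its level. -/
theorem ImplR.comap {Y : Type} {Γ' : Ctx Y} {f : X → ℝ} (hf : ImplR Γ f) (π : Y → X)
    (hl : Γ.lvl ≤ Γ'.lvl) (hrep : ∀ y s, Γ'.rep y s → Γ.rep (π y) s)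
    (hinst : ∀ y, Γ'.inst y = Γ.inst (π y)) : ImplR Γ' fun y => f (π y) := by
  intro d hd
  obtain ⟨c, p, hc⟩ := hf d (hl.trans hd)
  refine ⟨c, p, fun y s hy hs => ?_⟩
  rw [hinst] at hs ⊢
  exact hc (π y) s (hrep y s hy) hs

theorem ImplN.natAt₃ {f : X → ℕ} (h : ImplN Γ f) (l l' l'' : ℕ) :
    ImplN (((Γ.natAt l).natAt l').natAt l'') fun x => f x.1.1.1 := h.natAt.natAt.natAt

theorem VarA.natAt₃ {a : X → Arr} (h : VarA Γ a) (l l' l'' : ℕ) :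
    VarA (((Γ.natAt l).natAt l').natAt l'') fun x => a x.1.1.1 := h.natAt.natAt.natAt

theorem ImplN.fst₃ (l l' l'' : ℕ) :
    ImplN (((Γ.natAt l).natAt l').natAt l'') fun x => x.1.1.2 := ImplN.var.natAt.natAt

theorem ImplN.snd₃ (l l' l'' : ℕ) :
    ImplN (((Γ.natAt l).natAt l').natAt l'') fun x => x.1.2 := ImplN.var.natAt

/-- The `n ^ m`-fold iteration of `Φ`, organized as an `m`-fold loop. -/
noncomputable def nestIter (n : ℕ) (Φ : Arr → Arr) : ℕ → Arr → Arr
  | 0 => Φ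
  | m + 1 => fun A => iterN n (fun _ => nestIter n Φ m) A n

theorem nestIter_succ (n : ℕ) (Φ : Arr → Arr) (m : ℕ) (A : Arr) :
    nestIter n Φ (m + 1) A = iterN n (fun _ => nestIter n Φ m) A n := rfl

theorem nestIter_zero (n : ℕ) (Φ : Arr → Arr) (A : Arr) : nestIter n Φ 0 A = Φ A := rfl

attribute [irreducible] nestIter

/-- Index expressions contain no multiplication, so a polynomial number of rounds is obtained by
nesting `m` loops of length `dim`. The depth is a constant of the program text. -/
theorem ImplA.nestIter {Φ : X → Arr → Arr} (hΦ : ∀ l, ImplA (Γ.arrAt l) fun x => Φ x.1 x.2)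
    (m : ℕ) : ∀ l, ImplA (Γ.arrAt l) fun x => nestIter (Γ.inst x.1).dim (Φ x.1) m x.2 := by
  induction m with
  | zero => simpa only [nestIter_zero] using hΦ
  | succ m ih =>
    intro l l₁ l₂ l₃
    simp only [nestIter_succ]
    refine ImplR.iterN (Γ := (((Γ.arrAt l).natAt l₁).natAt l₂).natAt l₃)
      (b := fun x => (Γ.inst x.1.1.1.1).dim) (A := fun x => x.1.1.1.2)
      (Φ := fun x _ => BeamBits.nestIter (Γ.inst x.1.1.1.1).dim (Φ x.1.1.1.1) m)
      (f := fun x A => A x.1.1.2 x.1.2 x.2) ImplB.dim ?_ ?_ ?_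
    · intro k₁ k₂ k₃
      have h1 := ((VarA.var (Γ := Γ) (l := l)).natAt₃ l₁ l₂ l₃).natAt₃ k₁ k₂ k₃
      have h2 := ImplN.fst₃ (Γ := (((Γ.arrAt l).natAt l₁).natAt l₂).natAt l₃) k₁ k₂ k₃
      have h3 := ImplN.snd₃ (Γ := (((Γ.arrAt l).natAt l₁).natAt l₂).natAt l₃) k₁ k₂ k₃
      exact ImplR.read h1 h2 h3 ImplN.var
    · intro l' l'' k₁ k₂ k₃
      refine ImplR.comap (Γ := (((Γ.arrAt l').natAt k₁).natAt k₂).natAt k₃)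
        (Γ' := ((((((((Γ.arrAt l).natAt l₁).natAt l₂).natAt l₃).arrAt l').natAt l'').natAt
          k₁).natAt k₂).natAt k₃) (ih l' k₁ k₂ k₃) (fun y : (((((((((X × Arr) × ℕ) × ℕ) × ℕ) ×
          Arr) × ℕ) × ℕ) × ℕ) × ℕ) => ((((y.1.1.1.1.1.1.1.1.1, y.1.1.1.1.2), y.1.1.2), y.1.2), y.2))
        ?_ ?_ ?_
      · have hl : Γ.lvl ≤ ((((Γ.arrAt l).natAt l₁).natAt l₂).natAt l₃).lvl :=
          le_max_of_le_left (le_max_of_le_left (le_max_of_le_left (le_max_left _ _)))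
        exact max_le_max (max_le_max (max_le_max (le_max_of_le_left (max_le_max hl le_rfl))
          le_rfl) le_rfl) le_rfl
      · intro y s hy
        exact ⟨⟨⟨⟨hy.1.1.1.1.1.1.1.1.1, hy.1.1.1.1.2⟩, hy.1.1.2⟩, hy.1.2⟩, hy.2⟩
      · intro y; rfl
    · intro k
      exact ImplR.read VarA.var (ImplN.fst₃ (Γ := Γ.arrAt l) l₁ l₂ l₃).arrAt
        (ImplN.snd₃ (Γ := Γ.arrAt l) l₁ l₂ l₃).arrAt ImplN.var.arrAt

/-! ## The algorithm -/

/-- The square root of a nonnegative number, by exponential and logarithm. -/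
noncomputable def expSqrt (x : ℝ) : ℝ := x / Real.exp (Real.log x / 2)

theorem ImplR.expSqrt {f : X → ℝ} (hf : ImplR Γ f) : ImplR Γ fun x => expSqrt (f x) :=
  hf.div (hf.log.div (.ofNat 2)).exp

theorem ImplR.clamp {f : X → ℝ} (hf : ImplR Γ f) :
    ImplR Γ fun x => if f x < 0 then 0 else if 1 < f x then 1 else f x :=
  hf.ite_lt .zero .zero (.ite_lt .one hf .one hf)

/-- `1` if the numbers are equal and `0` otherwise, by comparison of real numbers. -/
noncomputable def eqInd (i j : ℕ) : ℝ :=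
  if (i : ℝ) < j then 0 else if (j : ℝ) < i then 0 else 1

theorem ImplR.eqInd {i j : X → ℕ} (hi : ImplN Γ i) (hj : ImplN Γ j) :
    ImplR Γ fun x => eqInd (i x) (j x) :=
  .ite_lt (.natCast hi) (.natCast hj) .zero (.ite_lt (.natCast hj) (.natCast hi) .zero .one)

/-- The array whose entry `k` is `1` and whose other entries are `0`. -/
noncomputable def unitArr (k : ℕ) : Arr := fun j _ _ => eqInd j k

/-- The state of the recursion for the inverse matrix, at the beginning. -/
noncomputable def invInit : Arr := fun i j k => if (k : ℝ) < 1 then eqInd i j else 0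

/-- The complex matrix in an array. -/
noncomputable def invEntry (J : Arr) (w w' : ℕ) : ℂ := ⟨J w w' 0, J w w' 1⟩

/-- The indicator of the users before `k` in the order of decreasing `o`, with `k`. -/
noncomputable def upTo (o : Arr) (k : ℕ) : Arr := fun j _ _ =>
  if o k 0 0 < o j 0 0 then 1 else if o j 0 0 < o k 0 0 then 0 else if (k : ℝ) < j then 0 else 1

/-- The indicator of the users before `k` in the order of decreasing `o`, without `k`. -/
noncomputable def below (o : Arr) (k : ℕ) : Arr := fun j _ _ =>
  if o k 0 0 < o j 0 0 then 1 else if o j 0 0 < o k 0 0 then 0 else if (j : ℝ) < k then 1 else 0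

/-- The set of pairs `g` with the pair `(w, b)` added. -/
noncomputable def addPair (g : Arr) (w b : ℕ) : Arr := fun w' b' _ =>
  if 0 < eqInd w' w * eqInd b' b then 1 else g w' b' 0

/-- `1` if the pair `(w', b')` is preferred to `(w, b)`: it has the higher score, or the same
score and comes first. -/
noncomputable def prefer (sc : Arr) (w b w' b' : ℕ) : ℝ :=
  if sc w b 0 < sc w' b' 0 then 1 else if sc w' b' 0 < sc w b 0 then 0
  else if (w' : ℝ) < w then 1 else if (w : ℝ) < w' then 0 else if (b' : ℝ) < b then 1 else 0

namespace Uplink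

variable (I : Uplink)

/-- The table number `m` of the input. -/
noncomputable abbrev tab (m : ℕ) : Arr := I.input.real m

/-- The complex table with real part `a` and imaginary part `b` of the input. -/
noncomputable def ctab (a b i j k : ℕ) : ℂ := ⟨I.tab a i j k, I.tab b i j k⟩

/-- The channel from user `k` through beam `w` on subcarrier `n`. -/
noncomputable def route (n w k : ℕ) : ℂ :=
  (∑ r ∈ Finset.range I.Nr, ∑ l ∈ Finset.range I.L,
    I.ctab 0 1 w r 0 * I.ctab 2 3 l r k * I.ctab 4 5 n l 0) * ((1 / I.tab 4 0 0 0 : ℝ) : ℂ)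

/-- The variance `psi` computed from the tables. -/
noncomputable def psiTab (w : ℕ) : ℝ :=
  1 + ∑ n ∈ Finset.range I.N, ∑ k ∈ Finset.range I.K,
    Complex.normSq (I.route n w k) * I.tab 6 n k 0 * I.tab 4 0 0 0 ^ 2

/-- The factor `gain` computed from the tables. -/
noncomputable def gainTab (w b : ℕ) : ℝ :=
  I.tab 9 b 0 0 ^ 2 / (I.tab 9 b 0 0 ^ 2 + I.tab 9 b 0 0 * (1 - I.tab 9 b 0 0) * I.psiTab w)

/-- The factor of the beam `w` with its highest resolution in `g`. -/
noncomputable def topGain (g : Arr) (w : ℕ) : ℝ :=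
  ∑ b ∈ Finset.range I.nB, if 0 < g w b 0 then
    (if 0 < ∑ b' ∈ Finset.range I.nB,
      (if (b : ℝ) < b' then (if 0 < g w b' 0 then 1 else 0) else 0 : ℝ) then 0 else I.gainTab w b)
    else 0

/-- The amplitudes of the beams. -/
noncomputable def amp (g : Arr) : Arr := fun w _ _ => expSqrt (I.topGain g w)

/-- The column of the effective channel that belongs to user `j`. -/
noncomputable def column (T : Arr) (n j w : ℕ) : ℂ :=
  (T w 0 0 : ℂ) * I.route n w j * (expSqrt (I.tab 6 n j 0) : ℂ)

/-- The product of the inverse matrix and a column. -/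
noncomputable def invCol (T : Arr) (n j : ℕ) (J : Arr) (w : ℕ) : ℂ :=
  ∑ w' ∈ Finset.range I.nW, invEntry J w w' * I.column T n j w'

/-- The ratio of determinants at a rank one update. -/
noncomputable def detRatio (T : Arr) (n j : ℕ) (J : Arr) : ℝ :=
  1 + (∑ w ∈ Finset.range I.nW, (starRingEnd ℂ) (I.column T n j w) * I.invCol T n j J w).re

/-- The rank one update of the inverse matrix, entry by entry. -/
noncomputable def invUpdate (T : Arr) (n j : ℕ) (J : Arr) (w w' : ℕ) : ℂ :=
  invEntry J w w' - I.invCol T n j J w * (starRingEnd ℂ) (I.invCol T n j J w') *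
    ((1 / I.detRatio T n j J : ℝ) : ℂ)

/-- One round of the recursion: if user `j` belongs to `A`, update the inverse matrix and add the
logarithm of the ratio of determinants. -/
noncomputable def invStep (T A : Arr) (n j : ℕ) (J : Arr) : Arr := fun w w' k =>
  if 0 < A j 0 0 then
    (if (k : ℝ) < 1 then (I.invUpdate T n j J w w').re
    else if (k : ℝ) < 2 then (I.invUpdate T n j J w w').im
    else J w w' k + Real.log (I.detRatio T n j J))
  else J w w' k

/-- The sum rate of the users in `A`, for given amplitudes of the beams. -/
noncomputable def rate (T A : Arr) : ℝ :=
  (∑ n ∈ Finset.range I.N, iterN I.dim (I.invStep T A n) invInit I.K 0 0 2) / Real.log 2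

/-- The rate of a single user, limited by its queue size. -/
noncomputable def cap (T : Arr) : Arr := fun k _ _ =>
  if 0 < ((I.input.nat 2 k 0 0 : ℕ) : ℝ) then I.rate T (boxed I.dim (unitArr k))
  else if I.tab 8 k 0 0 < I.rate T (boxed I.dim (unitArr k)) then I.tab 8 k 0 0
  else I.rate T (boxed I.dim (unitArr k))

/-- The reciprocal accuracy. -/
noncomputable def fine : ℝ := (I.dim : ℝ) ^ 5

/-- The urgency of user `k` in the state `Z`. -/
noncomputable def urgency (q Z : Arr) (k : ℕ) : ℝ :=
  if 0 < q k 0 0 then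
    (if 1 - I.fine * (Z k 0 0 - Z 0 1 0) < 0 then 0
    else if 1 < 1 - I.fine * (Z k 0 0 - Z 0 1 0) then 1 else 1 - I.fine * (Z k 0 0 - Z 0 1 0))
  else 0

/-- The priorities of the users in the state `Z`. -/
noncomputable def priority (q Z : Arr) : Arr := fun k _ _ => I.tab 7 k 0 0 * I.urgency q Z k

/-- The rates of the users in the order of priority, relative to `q`. -/
noncomputable def speed (T q Z o : Arr) : Arr := fun k _ _ =>
  if 0 < I.urgency q Z k then
    (I.rate T (boxed I.dim (upTo o k)) - I.rate T (boxed I.dim (below o k))) / q k 0 0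
  else 0

/-- The length of a time step. -/
noncomputable def timeStep (Z v : Arr) : ℝ :=
  if 1 - Z 0 1 0 < 1 / (I.fine ^ 2 * (1 + ∑ k ∈ Finset.range I.K, v k 0 0)) then 1 - Z 0 1 0
  else 1 / (I.fine ^ 2 * (1 + ∑ k ∈ Finset.range I.K, v k 0 0))

/-- One time step with given speeds. -/
noncomputable def advance (Z v : Arr) : Arr := fun i j _ =>
  if (j : ℝ) < 1 then Z i 0 0 + I.timeStep Z v * v i 0 0
  else if (j : ℝ) < 2 then Z 0 1 0 + I.timeStep Z v else 0

/-- One time step. -/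
noncomputable def flow (T q Z : Arr) : Arr :=
  I.advance Z (boxed I.dim (I.speed T q Z (boxed I.dim (I.priority q Z))))

/-- The weighted sum of the truncated rates at the end. -/
noncomputable def payoff (q Z : Arr) : ℝ :=
  ∑ k ∈ Finset.range I.K, I.tab 7 k 0 0 * q k 0 0 * (if Z k 0 0 < 1 then Z k 0 0 else 1)

/-- The value for given amplitudes and limits. -/
noncomputable def flowValue (T q : Arr) : ℝ :=
  I.payoff q (boxed I.dim (nestIter I.dim (I.flow T q) 12 (boxed I.dim fun _ _ _ => 0)))

/-- The approximate value of a set of pairs. -/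
noncomputable def value (g : Arr) : ℝ :=
  I.flowValue (boxed I.dim (I.amp g)) (boxed I.dim (I.cap (boxed I.dim (I.amp g))))

/-- The share of the constraints that is used by a pair. -/
noncomputable def share (w b : ℕ) : ℝ :=
  I.tab 10 w b 0 / I.tab 11 0 0 0 +
    1 / (if (I.chains : ℝ) < (I.dim : ℝ) ^ 2 then (I.chains : ℝ) else (I.dim : ℝ) ^ 2)

/-- The candidates: the affordable pairs outside `g`. -/
noncomputable def candidate (g : Arr) (w b : ℕ) : ℝ :=
  if 0 < g w b 0 then 0 else if I.tab 11 0 0 0 < I.tab 10 w b 0 then 0 else 1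

/-- The gain of the value relative to the share. -/
noncomputable def score (g : Arr) : Arr := fun w b _ =>
  (I.value (boxed I.dim (addPair g w b)) - I.value g) / I.share w b

/-- The indicator of the best candidate. -/
noncomputable def best (g sc : Arr) : Arr := fun w b _ =>
  if 0 < I.candidate g w b then
    (if 0 < ∑ w' ∈ Finset.range I.nW, ∑ b' ∈ Finset.range I.nB,
      (if 0 < I.candidate g w' b' then prefer sc w b w' b' else 0) then 0 else 1)
  else 0

/-- The share that is used by a set of pairs. -/
noncomputable def spent (g : Arr) : ℝ :=
  ∑ w ∈ Finset.range I.nW, ∑ b ∈ Finset.range I.nB, if 0 < g w b 0 then I.share w b else 0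

/-- Add the marked pair if its share fits. -/
noncomputable def addIfFits (g m : Arr) : Arr := fun w b _ =>
  if 0 < g w b 0 then 1
  else if 0 < m w b 0 then (if 1 < I.spent g + I.share w b then 0 else 1) else 0

/-- The best candidate. -/
noncomputable def mark (g : Arr) : Arr := boxed I.dim (I.best g (boxed I.dim (I.score g)))

/-- One round of the greedy algorithm. -/
noncomputable def grow (g : Arr) : Arr := I.addIfFits g (I.mark g)

/-- The better one of the sets `g` and `m`. -/
noncomputable def choose (g m : Arr) : Arr := fun w b _ =>
  if I.value g < I.value m then m w b 0 else g w b 0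

/-- The result of the greedy rounds. -/
noncomputable def greedy : Arr :=
  boxed I.dim (nestIter I.dim I.grow 2 (boxed I.dim fun _ _ _ => 0))

/-- The result of the algorithm. -/
noncomputable def result : Arr := I.choose I.greedy (I.mark I.greedy)

end Uplink

/-! ## Implementation of the algorithm -/

theorem ImplR.tab {m : ℕ} (hm : m < 12) {i j k : X → ℕ} (hi : ImplN Γ i) (hj : ImplN Γ j)
    (hk : ImplN Γ k) : ImplR Γ fun x => (Γ.inst x).tab m (i x) (j x) (k x) :=
  .read (.input hm) hi hj hk

theorem ImplC.ctab {a b : ℕ} (ha : a < 12) (hb : b < 12) {i j k : X → ℕ} (hi : ImplN Γ i)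
    (hj : ImplN Γ j) (hk : ImplN Γ k) :
    ImplC Γ fun x => (Γ.inst x).ctab a b (i x) (j x) (k x) :=
  .mk (.tab ha hi hj hk) (.tab hb hi hj hk)

theorem ImplC.route {n w k : X → ℕ} (hn : ImplN Γ n) (hw : ImplN Γ w) (hk : ImplN Γ k) :
    ImplC Γ fun x => (Γ.inst x).route (n x) (w x) (k x) :=
  (ImplC.sum .Nr fun _ => .sum .L fun _ =>
    ((ImplC.ctab (by omega) (by omega) hw.natAt.natAt ImplN.var.natAt (.lit 0)).mul
      (ImplC.ctab (by omega) (by omega) ImplN.var ImplN.var.natAt hk.natAt.natAt)).mul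
      (ImplC.ctab (by omega) (by omega) hn.natAt.natAt ImplN.var (.lit 0))).mul
    (.ofReal (ImplR.one.div (.tab (by omega) (.lit 0) (.lit 0) (.lit 0))))

theorem ImplR.psiTab {w : X → ℕ} (hw : ImplN Γ w) : ImplR Γ fun x => (Γ.inst x).psiTab (w x) :=
  ImplR.one.add (.sum .N fun _ => .sum .K fun _ =>
    ((ImplC.route ImplN.var.natAt hw.natAt.natAt ImplN.var).normSq.mul
      (.tab (by omega) ImplN.var.natAt ImplN.var (.lit 0))).mul
      ((ImplR.tab (by omega) (.lit 0) (.lit 0) (.lit 0)).pow 2))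

theorem ImplR.gainTab {w b : X → ℕ} (hw : ImplN Γ w) (hb : ImplN Γ b) :
    ImplR Γ fun x => (Γ.inst x).gainTab (w x) (b x) := by
  have ha : ImplR Γ fun x => (Γ.inst x).tab 9 (b x) 0 0 := .tab (by omega) hb (.lit 0) (.lit 0)
  exact (ha.pow 2).div ((ha.pow 2).add ((ha.mul (ImplR.one.sub ha)).mul (.psiTab hw)))

theorem ImplR.topGain {g : X → Arr} {w : X → ℕ} (hg : VarA Γ g) (hw : ImplN Γ w) :
    ImplR Γ fun x => (Γ.inst x).topGain (g x) (w x) :=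
  .sum .nB fun _ => .ite_lt .zero (.read hg.natAt hw.natAt ImplN.var (.lit 0))
    (.ite_lt .zero (.sum .nB fun _ => .ite_lt (.natCast ImplN.var.natAt) (.natCast ImplN.var)
      (.ite_lt .zero (.read hg.natAt.natAt hw.natAt.natAt ImplN.var (.lit 0)) .one .zero) .zero)
      .zero (.gainTab hw.natAt ImplN.var)) .zero

theorem ImplA.amp {g : X → Arr} (hg : VarA Γ g) : ImplA Γ fun x => (Γ.inst x).amp (g x) :=
  fun _ _ _ => (ImplR.topGain hg.natAt.natAt.natAt ImplN.var.natAt.natAt).expSqrt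

theorem ImplC.column {T : X → Arr} {n j w : X → ℕ} (hT : VarA Γ T) (hn : ImplN Γ n)
    (hj : ImplN Γ j) (hw : ImplN Γ w) :
    ImplC Γ fun x => (Γ.inst x).column (T x) (n x) (j x) (w x) :=
  ((ImplC.ofReal (.read hT hw (.lit 0) (.lit 0))).mul (.route hn hw hj)).mul
    (.ofReal (ImplR.tab (by omega) hn hj (.lit 0)).expSqrt)

theorem ImplC.invEntry {J : X → Arr} {w w' : X → ℕ} (hJ : VarA Γ J) (hw : ImplN Γ w)
    (hw' : ImplN Γ w') : ImplC Γ fun x => invEntry (J x) (w x) (w' x) :=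
  .mk (.read hJ hw hw' (.lit 0)) (.read hJ hw hw' (.lit 1))

theorem ImplC.invCol {T J : X → Arr} {n j w : X → ℕ} (hT : VarA Γ T) (hn : ImplN Γ n)
    (hj : ImplN Γ j) (hJ : VarA Γ J) (hw : ImplN Γ w) :
    ImplC Γ fun x => (Γ.inst x).invCol (T x) (n x) (j x) (J x) (w x) :=
  .sum .nW fun _ => (ImplC.invEntry hJ.natAt hw.natAt ImplN.var).mul
    (.column hT.natAt hn.natAt hj.natAt ImplN.var)

theorem ImplR.detRatio {T J : X → Arr} {n j : X → ℕ} (hT : VarA Γ T) (hn : ImplN Γ n)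
    (hj : ImplN Γ j) (hJ : VarA Γ J) :
    ImplR Γ fun x => (Γ.inst x).detRatio (T x) (n x) (j x) (J x) :=
  ImplR.one.add (ImplC.sum .nW fun _ =>
    (ImplC.column hT.natAt hn.natAt hj.natAt ImplN.var).conj.mul
      (.invCol hT.natAt hn.natAt hj.natAt hJ.natAt ImplN.var)).1

theorem ImplC.invUpdate {T J : X → Arr} {n j w w' : X → ℕ} (hT : VarA Γ T) (hn : ImplN Γ n)
    (hj : ImplN Γ j) (hJ : VarA Γ J) (hw : ImplN Γ w) (hw' : ImplN Γ w') :
    ImplC Γ fun x => (Γ.inst x).invUpdate (T x) (n x) (j x) (J x) (w x) (w' x) :=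
  (ImplC.invEntry hJ hw hw').sub (((ImplC.invCol hT hn hj hJ hw).mul
    (ImplC.invCol hT hn hj hJ hw').conj).mul (.ofReal (ImplR.one.div (.detRatio hT hn hj hJ))))

theorem ImplA.invStep {T A J : X → Arr} {n j : X → ℕ} (hT : VarA Γ T) (hA : VarA Γ A)
    (hn : ImplN Γ n) (hj : ImplN Γ j) (hJ : VarA Γ J) :
    ImplA Γ fun x => (Γ.inst x).invStep (T x) (A x) (n x) (j x) (J x) := by
  intro l l' l''
  have hT := hT.natAt₃ l l' l''
  have hn := hn.natAt₃ l l' l''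
  have hj := hj.natAt₃ l l' l''
  have hJ := hJ.natAt₃ l l' l''
  have hw := ImplN.fst₃ (Γ := Γ) l l' l''
  have hw' := ImplN.snd₃ (Γ := Γ) l l' l''
  have hr := ImplR.read hJ hw hw' ImplN.var
  have hu := ImplC.invUpdate hT hn hj hJ hw hw'
  exact .ite_lt .zero (.read (hA.natAt₃ l l' l'') hj (.lit 0) (.lit 0))
    (.ite_lt (.natCast ImplN.var) .one hu.1 (.ite_lt (.natCast ImplN.var) (.ofNat 2) hu.2
      (hr.add (ImplR.detRatio hT hn hj hJ).log))) hr

theorem ImplR.rate {T A : X → Arr} (hT : VarA Γ T) (hA : VarA Γ A) :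
    ImplR Γ fun x => (Γ.inst x).rate (T x) (A x) :=
  (ImplR.sum .N fun l => .iterN (Γ := Γ.natAt l) (A := fun _ => invInit)
    (Φ := fun x => (Γ.inst x.1).invStep (T x.1) (A x.1) x.2) (f := fun _ J => J 0 0 2)
    .K
    (fun _ _ _ => .ite_lt (.natCast ImplN.var) .one (.eqInd ImplN.var.natAt.natAt ImplN.var.natAt)
      .zero)
    (fun _ _ => .invStep hT.natAt.arrAt.natAt hA.natAt.arrAt.natAt ImplN.var.arrAt.natAt ImplN.var
      VarA.var.natAt)
    (fun _ => .read VarA.var (.lit 0) (.lit 0) (.lit 2))).div (ImplR.ofNat 2).log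

theorem ImplA.unitArr {k : X → ℕ} (hk : ImplN Γ k) : ImplA Γ fun x => unitArr (k x) :=
  fun _ _ _ => .eqInd ImplN.var.natAt.natAt hk.natAt.natAt.natAt

theorem ImplA.cap {T : X → Arr} (hT : VarA Γ T) : ImplA Γ fun x => (Γ.inst x).cap (T x) := by
  intro l l' l''
  have hk : ImplN (((Γ.natAt l).natAt l').natAt l'') fun x => x.1.1.2 := ImplN.var.natAt.natAt
  have hr : ImplR (((Γ.natAt l).natAt l').natAt l'') fun x =>
      (Γ.inst x.1.1.1).rate (T x.1.1.1) (boxed (Γ.inst x.1.1.1).dim (BeamBits.unitArr x.1.1.2)) :=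
    ImplR.letA (Γ := ((Γ.natAt l).natAt l').natAt l'')
      (f := fun x A => (Γ.inst x.1.1.1).rate (T x.1.1.1) A) (.unitArr hk)
      fun _ => .rate hT.natAt.natAt.natAt.arrAt VarA.var
  have hq := ImplR.tab (Γ := ((Γ.natAt l).natAt l').natAt l'') (m := 8) (by omega) hk (.lit 0)
    (.lit 0)
  exact .ite_lt .zero (.natCast (.input (by omega) hk (.lit 0) (.lit 0))) hr
    (.ite_lt hq hr hq hr)

theorem ImplR.fine : ImplR Γ fun x => (Γ.inst x).fine := (ImplR.natCast .dim).pow 5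

theorem ImplR.urgency {q Z : X → Arr} {k : X → ℕ} (hq : VarA Γ q) (hZ : VarA Γ Z)
    (hk : ImplN Γ k) : ImplR Γ fun x => (Γ.inst x).urgency (q x) (Z x) (k x) :=
  .ite_lt .zero (.read hq hk (.lit 0) (.lit 0))
    (.clamp (ImplR.one.sub (ImplR.fine.mul ((ImplR.read hZ hk (.lit 0) (.lit 0)).sub
      (.read hZ (.lit 0) (.lit 1) (.lit 0)))))) .zero

theorem ImplA.priority {q Z : X → Arr} (hq : VarA Γ q) (hZ : VarA Γ Z) :
    ImplA Γ fun x => (Γ.inst x).priority (q x) (Z x) :=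
  fun _ _ _ => (ImplR.tab (by omega) ImplN.var.natAt.natAt (.lit 0) (.lit 0)).mul
    (.urgency hq.natAt.natAt.natAt hZ.natAt.natAt.natAt ImplN.var.natAt.natAt)

theorem ImplA.upTo {o : X → Arr} {k : X → ℕ} (ho : VarA Γ o) (hk : ImplN Γ k) :
    ImplA Γ fun x => upTo (o x) (k x) := by
  intro l l' l''
  have hk := hk.natAt₃ l l' l''
  have hj := ImplN.fst₃ (Γ := Γ) l l' l''
  have h1 := ImplR.read (ho.natAt₃ l l' l'') hk (.lit 0) (.lit 0)
  have h2 := ImplR.read (ho.natAt₃ l l' l'') hj (.lit 0) (.lit 0)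
  exact .ite_lt h1 h2 .one (.ite_lt h2 h1 .zero (.ite_lt (.natCast hk) (.natCast hj) .zero .one))

theorem ImplA.below {o : X → Arr} {k : X → ℕ} (ho : VarA Γ o) (hk : ImplN Γ k) :
    ImplA Γ fun x => below (o x) (k x) := by
  intro l l' l''
  have hk := hk.natAt₃ l l' l''
  have hj := ImplN.fst₃ (Γ := Γ) l l' l''
  have h1 := ImplR.read (ho.natAt₃ l l' l'') hk (.lit 0) (.lit 0)
  have h2 := ImplR.read (ho.natAt₃ l l' l'') hj (.lit 0) (.lit 0)
  exact .ite_lt h1 h2 .one (.ite_lt h2 h1 .zero (.ite_lt (.natCast hj) (.natCast hk) .one .zero))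

theorem ImplA.speed {T q Z o : X → Arr} (hT : VarA Γ T) (hq : VarA Γ q) (hZ : VarA Γ Z)
    (ho : VarA Γ o) : ImplA Γ fun x => (Γ.inst x).speed (T x) (q x) (Z x) (o x) := by
  intro l l' l''
  have hk : ImplN (((Γ.natAt l).natAt l').natAt l'') fun x => x.1.1.2 := ImplN.var.natAt.natAt
  have h1 : ImplR (((Γ.natAt l).natAt l').natAt l'') fun x =>
      (Γ.inst x.1.1.1).rate (T x.1.1.1)
        (boxed (Γ.inst x.1.1.1).dim (BeamBits.upTo (o x.1.1.1) x.1.1.2)) :=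
    ImplR.letA (Γ := ((Γ.natAt l).natAt l').natAt l'')
      (f := fun x A => (Γ.inst x.1.1.1).rate (T x.1.1.1) A) (.upTo ho.natAt.natAt.natAt hk)
      fun _ => .rate hT.natAt.natAt.natAt.arrAt VarA.var
  have h2 : ImplR (((Γ.natAt l).natAt l').natAt l'') fun x =>
      (Γ.inst x.1.1.1).rate (T x.1.1.1)
        (boxed (Γ.inst x.1.1.1).dim (BeamBits.below (o x.1.1.1) x.1.1.2)) :=
    ImplR.letA (Γ := ((Γ.natAt l).natAt l').natAt l'')
      (f := fun x A => (Γ.inst x.1.1.1).rate (T x.1.1.1) A) (.below ho.natAt.natAt.natAt hk)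
      fun _ => .rate hT.natAt.natAt.natAt.arrAt VarA.var
  exact .ite_lt .zero (.urgency hq.natAt.natAt.natAt hZ.natAt.natAt.natAt hk)
    ((h1.sub h2).div (.read hq.natAt.natAt.natAt hk (.lit 0) (.lit 0))) .zero

theorem ImplR.timeStep {Z v : X → Arr} (hZ : VarA Γ Z) (hv : VarA Γ v) :
    ImplR Γ fun x => (Γ.inst x).timeStep (Z x) (v x) := by
  have h1 : ImplR Γ fun x => 1 - Z x 0 1 0 :=
    ImplR.one.sub (.read hZ (.lit 0) (.lit 1) (.lit 0))
  have h2 : ImplR Γ fun x => 1 / ((Γ.inst x).fine ^ 2 *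
      (1 + ∑ k ∈ Finset.range (Γ.inst x).K, v x k 0 0)) :=
    ImplR.one.div ((ImplR.fine.pow 2).mul (ImplR.one.add
      (.sum .K fun _ => .read hv.natAt ImplN.var (.lit 0) (.lit 0))))
  exact .ite_lt h1 h2 h1 h2

theorem ImplA.flow {T q Z : X → Arr} (hT : VarA Γ T) (hq : VarA Γ q) (hZ : VarA Γ Z) :
    ImplA Γ fun x => (Γ.inst x).flow (T x) (q x) (Z x) := by
  intro l l' l''
  have hT := hT.natAt₃ l l' l''
  have hq := hq.natAt₃ l l' l''
  have hZ := hZ.natAt₃ l l' l''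
  refine ImplR.letA (Γ := ((Γ.natAt l).natAt l').natAt l'')
    (A := fun x => (Γ.inst x.1.1.1).priority (q x.1.1.1) (Z x.1.1.1))
    (f := fun x o => (Γ.inst x.1.1.1).advance (Z x.1.1.1) (boxed (Γ.inst x.1.1.1).dim
      ((Γ.inst x.1.1.1).speed (T x.1.1.1) (q x.1.1.1) (Z x.1.1.1) o)) x.1.1.2 x.1.2 x.2)
    (.priority hq hZ) fun m => ?_
  refine ImplR.letA (Γ := (((Γ.natAt l).natAt l').natAt l'').arrAt m)
    (A := fun x => (Γ.inst x.1.1.1.1).speed (T x.1.1.1.1) (q x.1.1.1.1) (Z x.1.1.1.1) x.2)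
    (f := fun x v => (Γ.inst x.1.1.1.1).advance (Z x.1.1.1.1) v x.1.1.1.2 x.1.1.2 x.1.2)
    (.speed hT.arrAt hq.arrAt hZ.arrAt VarA.var) fun m' => ?_
  have hv : VarA (((((Γ.natAt l).natAt l').natAt l'').arrAt m).arrAt m') fun x => x.2 := VarA.var
  have ht := ImplR.timeStep hZ.arrAt.arrAt hv
  have hi := ((ImplN.var (Γ := Γ) (l := l)).natAt (l := l')).natAt (l := l'')
    |>.arrAt (l := m) |>.arrAt (l := m')
  have hj := ((ImplN.var (Γ := Γ.natAt l) (l := l')).natAt (l := l''))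
    |>.arrAt (l := m) |>.arrAt (l := m')
  exact .ite_lt (.natCast hj) .one
    ((ImplR.read hZ.arrAt.arrAt hi (.lit 0) (.lit 0)).add (ht.mul (.read hv hi (.lit 0) (.lit 0))))
    (.ite_lt (.natCast hj) (.ofNat 2)
      ((ImplR.read hZ.arrAt.arrAt (.lit 0) (.lit 1) (.lit 0)).add ht) .zero)

theorem ImplR.payoff {q Z : X → Arr} (hq : VarA Γ q) (hZ : VarA Γ Z) :
    ImplR Γ fun x => (Γ.inst x).payoff (q x) (Z x) := by
  refine .sum .K fun l => ?_
  have hz := ImplR.read (hZ.natAt (l := l)) ImplN.var (.lit 0) (.lit 0)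
  exact ((ImplR.tab (by omega) ImplN.var (.lit 0) (.lit 0)).mul
    (.read hq.natAt ImplN.var (.lit 0) (.lit 0))).mul (.ite_lt hz .one hz .one)

theorem ImplR.flowValue {T q : X → Arr} (hT : VarA Γ T) (hq : VarA Γ q) :
    ImplR Γ fun x => (Γ.inst x).flowValue (T x) (q x) := by
  refine ImplR.letA (A := fun _ _ _ _ => 0)
    (f := fun x Z => (Γ.inst x).payoff (q x) (boxed (Γ.inst x).dim
      (BeamBits.nestIter (Γ.inst x).dim ((Γ.inst x).flow (T x) (q x)) 12 Z)))
    (fun _ _ _ => .zero) fun l => ?_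
  exact ImplR.letA (Γ := Γ.arrAt l)
    (A := fun x => BeamBits.nestIter (Γ.inst x.1).dim
      ((Γ.inst x.1).flow (T x.1) (q x.1)) 12 x.2)
    (f := fun x Z => (Γ.inst x.1).payoff (q x.1) Z)
    (ImplA.nestIter (Γ := Γ) (Φ := fun x => (Γ.inst x).flow (T x) (q x))
      (fun _ => .flow hT.arrAt hq.arrAt VarA.var) 12 l)
    fun _ => .payoff hq.arrAt.arrAt VarA.var

theorem ImplR.value {g : X → Arr} (hg : VarA Γ g) :
    ImplR Γ fun x => (Γ.inst x).value (g x) := by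
  refine ImplR.letA (A := fun x => (Γ.inst x).amp (g x))
    (f := fun x T => (Γ.inst x).flowValue T (boxed (Γ.inst x).dim ((Γ.inst x).cap T)))
    (.amp hg) fun l => ?_
  exact ImplR.letA (Γ := Γ.arrAt l) (A := fun x => (Γ.inst x.1).cap x.2)
    (f := fun x q => (Γ.inst x.1).flowValue x.2 q) (.cap VarA.var)
    fun _ => .flowValue VarA.var.arrAt VarA.var

theorem ImplR.share {w b : X → ℕ} (hw : ImplN Γ w) (hb : ImplN Γ b) :
    ImplR Γ fun x => (Γ.inst x).share (w x) (b x) := by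
  have h1 : ImplR Γ fun x => ((Γ.inst x).chains : ℝ) := .natCast .chains
  have h2 : ImplR Γ fun x => ((Γ.inst x).dim : ℝ) ^ 2 := (ImplR.natCast .dim).pow 2
  exact ((ImplR.tab (by omega) hw hb (.lit 0)).div
    (.tab (by omega) (.lit 0) (.lit 0) (.lit 0))).add (ImplR.one.div (.ite_lt h1 h2 h1 h2))

theorem ImplR.candidate {g : X → Arr} {w b : X → ℕ} (hg : VarA Γ g) (hw : ImplN Γ w)
    (hb : ImplN Γ b) : ImplR Γ fun x => (Γ.inst x).candidate (g x) (w x) (b x) :=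
  .ite_lt .zero (.read hg hw hb (.lit 0)) .zero
    (.ite_lt (.tab (by omega) (.lit 0) (.lit 0) (.lit 0)) (.tab (by omega) hw hb (.lit 0))
      .zero .one)

theorem ImplA.addPair {g : X → Arr} {w b : X → ℕ} (hg : VarA Γ g) (hw : ImplN Γ w)
    (hb : ImplN Γ b) : ImplA Γ fun x => addPair (g x) (w x) (b x) :=
  fun _ _ _ => .ite_lt .zero
    ((ImplR.eqInd ImplN.var.natAt.natAt hw.natAt.natAt.natAt).mul
      (.eqInd ImplN.var.natAt hb.natAt.natAt.natAt)) .one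
    (.read hg.natAt.natAt.natAt ImplN.var.natAt.natAt ImplN.var.natAt (.lit 0))

theorem ImplA.score {g : X → Arr} (hg : VarA Γ g) :
    ImplA Γ fun x => (Γ.inst x).score (g x) := by
  intro l l' l''
  have hg := hg.natAt₃ l l' l''
  have hw : ImplN (((Γ.natAt l).natAt l').natAt l'') fun x => x.1.1.2 := ImplN.var.natAt.natAt
  have hb : ImplN (((Γ.natAt l).natAt l').natAt l'') fun x => x.1.2 := ImplN.var.natAt
  have h1 : ImplR (((Γ.natAt l).natAt l').natAt l'') fun x => (Γ.inst x.1.1.1).value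
      (boxed (Γ.inst x.1.1.1).dim (BeamBits.addPair (g x.1.1.1) x.1.1.2 x.1.2)) :=
    ImplR.letA (Γ := ((Γ.natAt l).natAt l').natAt l'')
      (f := fun x A => (Γ.inst x.1.1.1).value A) (.addPair hg hw hb) fun _ => .value VarA.var
  exact (h1.sub (.value hg)).div (.share hw hb)

theorem ImplR.prefer {sc : X → Arr} {w b w' b' : X → ℕ} (hs : VarA Γ sc) (hw : ImplN Γ w)
    (hb : ImplN Γ b) (hw' : ImplN Γ w') (hb' : ImplN Γ b') :
    ImplR Γ fun x => prefer (sc x) (w x) (b x) (w' x) (b' x) := by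
  have h1 := ImplR.read hs hw hb (.lit 0)
  have h2 := ImplR.read hs hw' hb' (.lit 0)
  exact .ite_lt h1 h2 .one (.ite_lt h2 h1 .zero (.ite_lt (.natCast hw') (.natCast hw) .one
    (.ite_lt (.natCast hw) (.natCast hw') .zero (.ite_lt (.natCast hb') (.natCast hb) .one .zero))))

theorem ImplA.best {g sc : X → Arr} (hg : VarA Γ g) (hs : VarA Γ sc) :
    ImplA Γ fun x => (Γ.inst x).best (g x) (sc x) := by
  intro l l' l''
  have hg := hg.natAt₃ l l' l''
  have hs := hs.natAt₃ l l' l''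
  have hw : ImplN (((Γ.natAt l).natAt l').natAt l'') fun x => x.1.1.2 := ImplN.var.natAt.natAt
  have hb : ImplN (((Γ.natAt l).natAt l').natAt l'') fun x => x.1.2 := ImplN.var.natAt
  exact .ite_lt .zero (.candidate hg hw hb) (.ite_lt .zero (.sum .nW fun _ => .sum .nB fun _ =>
    .ite_lt .zero (.candidate hg.natAt.natAt ImplN.var.natAt ImplN.var)
      (.prefer hs.natAt.natAt hw.natAt.natAt hb.natAt.natAt ImplN.var.natAt ImplN.var) .zero)
      .zero .one) .zero

theorem ImplR.spent {g : X → Arr} (hg : VarA Γ g) : ImplR Γ fun x => (Γ.inst x).spent (g x) :=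
  .sum .nW fun _ => .sum .nB fun _ =>
    .ite_lt .zero (.read hg.natAt.natAt ImplN.var.natAt ImplN.var (.lit 0))
      (.share ImplN.var.natAt ImplN.var) .zero

theorem ImplR.let_mark {g : X → Arr} {f : X → Arr → ℝ} (hg : VarA Γ g)
    (hf : ∀ l l', ImplR ((Γ.arrAt l).arrAt l') fun x => f x.1.1 x.2) :
    ImplR Γ fun x => f x ((Γ.inst x).mark (g x)) := by
  refine ImplR.letA (A := fun x => (Γ.inst x).score (g x))
    (f := fun x sc => f x (boxed (Γ.inst x).dim ((Γ.inst x).best (g x) sc)))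
    (.score hg) fun l => ?_
  exact ImplR.letA (Γ := Γ.arrAt l) (A := fun x => (Γ.inst x.1).best (g x.1) x.2)
    (f := fun x m => f x.1 m) (.best hg.arrAt VarA.var) fun l' => hf l l'

theorem ImplA.grow {g : X → Arr} (hg : VarA Γ g) : ImplA Γ fun x => (Γ.inst x).grow (g x) := by
  intro l l' l''
  have hg' := hg.natAt₃ l l' l''
  refine ImplR.let_mark (Γ := ((Γ.natAt l).natAt l').natAt l'') (g := fun x => g x.1.1.1)
    (f := fun x m => (Γ.inst x.1.1.1).addIfFits (g x.1.1.1) m x.1.1.2 x.1.2 x.2) hg' fun m m' => ?_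
  have hg := (hg'.arrAt (l := m)).arrAt (l := m')
  have hm : VarA (((((Γ.natAt l).natAt l').natAt l'').arrAt m).arrAt m') fun x => x.2 := VarA.var
  have hw := ((ImplN.var (Γ := Γ) (l := l)).natAt (l := l')).natAt (l := l'')
    |>.arrAt (l := m) |>.arrAt (l := m')
  have hb := ((ImplN.var (Γ := Γ.natAt l) (l := l')).natAt (l := l''))
    |>.arrAt (l := m) |>.arrAt (l := m')
  exact .ite_lt .zero (.read hg hw hb (.lit 0)) .one
    (.ite_lt .zero (.read hm hw hb (.lit 0))
      (.ite_lt .one ((ImplR.spent hg).add (.share hw hb)) .zero .one) .zero)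

theorem ImplA.result : ImplA Ctx.base Uplink.result := by
  intro l l' l''
  let Δ := ((Ctx.base.natAt l).natAt l').natAt l''
  refine ImplR.letA (Γ := Δ) (A := fun _ _ _ _ => 0)
    (f := fun x A => x.1.1.1.choose (boxed x.1.1.1.dim (BeamBits.nestIter x.1.1.1.dim
      x.1.1.1.grow 2 A)) (x.1.1.1.mark (boxed x.1.1.1.dim (BeamBits.nestIter x.1.1.1.dim
      x.1.1.1.grow 2 A))) x.1.1.2 x.1.2 x.2) (fun _ _ _ => .zero) fun k => ?_
  refine ImplR.letA (Γ := Δ.arrAt k)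
    (A := fun x => BeamBits.nestIter x.1.1.1.1.dim x.1.1.1.1.grow 2 x.2)
    (f := fun x g => x.1.1.1.1.choose g (x.1.1.1.1.mark g) x.1.1.1.2 x.1.1.2 x.1.2)
    (ImplA.nestIter (Γ := Δ) (Φ := fun x => x.1.1.1.grow) (fun _ => .grow VarA.var) 2 k)
    fun k' => ?_
  refine ImplR.let_mark (Γ := (Δ.arrAt k).arrAt k') (g := fun x => x.2)
    (f := fun x m => x.1.1.1.1.1.choose x.2 m x.1.1.1.1.2 x.1.1.1.2 x.1.1.2) VarA.var
    fun m m' => ?_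
  have hw := ((ImplN.var (Γ := Ctx.base) (l := l)).natAt (l := l')).natAt (l := l'')
    |>.arrAt (l := k) |>.arrAt (l := k') |>.arrAt (l := m) |>.arrAt (l := m')
  have hb := ((ImplN.var (Γ := Ctx.base.natAt l) (l := l')).natAt (l := l''))
    |>.arrAt (l := k) |>.arrAt (l := k') |>.arrAt (l := m) |>.arrAt (l := m')
  have hg := ((VarA.var (Γ := Δ.arrAt k) (l := k')).arrAt (l := m)).arrAt (l := m')
  have hm := VarA.var (Γ := ((Δ.arrAt k).arrAt k').arrAt m) (l := m')
  exact .ite_lt (.value hg) (.value hm) (.read hm hw hb (.lit 0)) (.read hg hw hb (.lit 0))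

end BeamBits

/-! ### Submodularity of Gaussian log-determinants -/

namespace BeamBits

open scoped ComplexOrder
open Matrix

/-! ## Submodular set functions -/

section submodular

variable {ι : Type*} [DecidableEq ι]

/-- Diminishing returns across one extra element are accumulated along chains: first the base set is
enlarged one element at a time, then the added set. -/
theorem submodular_of_local {F : Finset ι → ℝ}
    (h : ∀ C i j, i ∉ C → j ∉ C → i ≠ j →
      F (insert i (insert j C)) + F C ≤ F (insert i C) + F (insert j C)) (A B : Finset ι) :
    F (A ∪ B) + F (A ∩ B) ≤ F A + F B := by
  have h1 : ∀ (T C : Finset ι) (i : ι), Disjoint T C → i ∉ C → i ∉ T →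
      F (insert i (C ∪ T)) - F (C ∪ T) ≤ F (insert i C) - F C := by
    intro T
    induction T using Finset.induction_on with
    | empty => intro C i _ _ _; simp
    | insert t T ht ih =>
      intro C i hd hC hT
      rw [Finset.disjoint_insert_left] at hd
      have e1 := ih C i hd.2 hC (fun h => hT (Finset.mem_insert_of_mem h))
      have e2 := h (C ∪ T) i t (by
        simp only [Finset.mem_union, not_or]; exact ⟨hC, fun h => hT (Finset.mem_insert_of_mem h)⟩)
        (by simp only [Finset.mem_union, not_or]; exact ⟨hd.1, ht⟩)
        (fun h => hT (h ▸ Finset.mem_insert_self _ _))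
      rw [Finset.union_insert]
      linarith
  have h2 : ∀ (T A C : Finset ι), C ⊆ A → Disjoint T A →
      F (A ∪ T) - F A ≤ F (C ∪ T) - F C := by
    intro T
    induction T using Finset.induction_on with
    | empty => intro A C _ _; simp
    | insert t T ht ih =>
      intro A C hCA hd
      rw [Finset.disjoint_insert_left] at hd
      have e1 := ih A C hCA hd.2
      have e2 := h1 (A \ C) (C ∪ T) t (by
        rw [Finset.disjoint_union_right]
        exact ⟨Finset.sdiff_disjoint, (hd.2.mono_right Finset.sdiff_subset).symm⟩)
        (by simp only [Finset.mem_union, not_or]; exact ⟨fun h => hd.1 (hCA h), ht⟩)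
        (fun h => hd.1 (Finset.mem_sdiff.mp h).1)
      have e3 : C ∪ T ∪ A \ C = A ∪ T := by
        ext x
        simp only [Finset.mem_union, Finset.mem_sdiff]
        by_cases hx : x ∈ C
        · simp [hx, hCA hx]
        · simp [hx, or_comm]
      rw [e3] at e2
      rw [Finset.union_insert, Finset.union_insert]
      linarith
  -- Adding `B \ A` to the base `A` gives `A ∪ B`, and to the smaller base `A ∩ B` gives `B`.
  have h3 := h2 (B \ A) A (A ∩ B) Finset.inter_subset_left Finset.sdiff_disjoint
  rw [Finset.union_sdiff_self_eq_union] at h3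
  have e : A ∩ B ∪ B \ A = B := by
    ext x
    simp only [Finset.mem_union, Finset.mem_inter, Finset.mem_sdiff]
    tauto
  rw [e] at h3
  linarith

end submodular

/-! ## Principal minors of positive definite matrices -/

section minors

variable {ι κ : Type*} [Fintype ι] [DecidableEq ι] [Fintype κ] [DecidableEq κ]

/-- The principal minor of the matrix with rows and columns `C`. -/
noncomputable def minor (M : Matrix ι ι ℂ) (C : Finset ι) : ℂ :=
  (M.submatrix (Subtype.val : {x // x ∈ C} → ι) Subtype.val).det

theorem minor_eq (M : Matrix ι ι ℂ) (C : Finset ι) (h : κ → ι) (hi : Function.Injective h)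
    (hC : ∀ x, x ∈ C ↔ ∃ k, h k = x) : minor M C = (M.submatrix h h).det := by
  let e : κ ≃ {x // x ∈ C} := Equiv.ofBijective (fun k => ⟨h k, (hC _).mpr ⟨k, rfl⟩⟩)
    ⟨fun k k' hk => hi (Subtype.ext_iff.mp hk), fun x => by
      obtain ⟨k, hk⟩ := (hC _).mp x.2
      exact ⟨k, Subtype.ext hk⟩⟩
  rw [minor, ← det_submatrix_equiv_self e, submatrix_submatrix]
  rfl

/-- The Schur complement entry. -/
noncomputable def schur (M : Matrix ι ι ℂ) (e : κ → ι) (a b : ι) : ℂ :=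
  M a b - ((fun c => M a (e c)) ᵥ* (M.submatrix e e)⁻¹) ⬝ᵥ fun c => M (e c) b

/-- The Schur determinant formula. It reduces inequalities between minors that share a block to the
small matrix of Schur complement entries. -/
theorem det_submatrix_sumElim {M : Matrix ι ι ℂ} {e : κ → ι} {l : Type*} [Fintype l]
    [DecidableEq l] (g : l → ι) (h : IsUnit (M.submatrix e e).det) :
    (M.submatrix (Sum.elim e g) (Sum.elim e g)).det =
      (M.submatrix e e).det * (of fun a b => schur M e (g a) (g b)).det := by
  have h1 : M.submatrix (Sum.elim e g) (Sum.elim e g) =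
      fromBlocks (M.submatrix e e) (M.submatrix e g) (M.submatrix g e) (M.submatrix g g) := by
    ext (a | a) (b | b) <;> rfl
  let := invertibleOfIsUnitDet _ h
  rw [h1, det_fromBlocks₁₁, invOf_eq_nonsing_inv]
  congr 2

theorem schur_conj {M : Matrix ι ι ℂ} (hM : M.IsHermitian) (e : κ → ι) (a b : ι) :
    (starRingEnd ℂ) (schur M e a b) = schur M e b a := by
  have hA : (M.submatrix e e)⁻¹.IsHermitian := (hM.submatrix e).inv
  simp only [schur, map_sub, dotProduct, vecMul, map_sum, map_mul]
  have h1 : ∀ x y, (starRingEnd ℂ) (M x y) = M y x := fun x y => hM.apply y x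
  have h2 : ∀ x y, (starRingEnd ℂ) ((M.submatrix e e)⁻¹ x y) = (M.submatrix e e)⁻¹ y x :=
    fun x y => hA.apply y x
  simp only [h1, h2, Finset.sum_mul]
  rw [Finset.sum_comm]
  congr 1
  refine Finset.sum_congr rfl fun x _ => Finset.sum_congr rfl fun y _ => ?_
  ring

theorem minor_pos {M : Matrix ι ι ℂ} (hM : M.PosDef) (C : Finset ι) : 0 < minor M C :=
  (hM.submatrix Subtype.val_injective).det_pos

/-- After factoring out the minor of `C`, this is Hadamard's inequality for the 2 × 2 Schur
complement: s_ii s_jj - |s_ij|² ≤ s_ii s_jj. -/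
theorem minor_local {M : Matrix ι ι ℂ} (hM : M.PosDef) (C : Finset ι) {i j : ι} (hi : i ∉ C)
    (hj : j ∉ C) (hij : i ≠ j) :
    (minor M (insert i (insert j C))).re * (minor M C).re ≤
      (minor M (insert i C)).re * (minor M (insert j C)).re := by
  let e : {x // x ∈ C} → ι := Subtype.val
  have hu : IsUnit (M.submatrix e e).det :=
    isUnit_iff_ne_zero.mpr (hM.submatrix (e := e) Subtype.val_injective).det_pos.ne'
  have one : ∀ a, a ∉ C → minor M (insert a C) = minor M C * schur M e a a := by
    intro a ha
    rw [minor_eq M (insert a C) (Sum.elim e (fun _ : Unit => a)), det_submatrix_sumElim _ hu]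
    · rw [det_unique (of fun _ _ : Unit => schur M e a a)]
      rfl
    · refine Function.Injective.sumElim Subtype.val_injective
        (Function.injective_of_subsingleton _) ?_
      rintro x - rfl
      exact ha x.2
    · intro x
      simp only [Finset.mem_insert, Sum.exists, Sum.elim_inl, Sum.elim_inr]
      simp [e, eq_comm, or_comm]
  have two : minor M (insert i (insert j C)) =
      minor M C * (schur M e i i * schur M e j j - schur M e i j * schur M e j i) := by
    rw [minor_eq M (insert i (insert j C)) (Sum.elim e ![i, j]), det_submatrix_sumElim _ hu,
      det_fin_two]
    · rfl
    · refine Function.Injective.sumElim Subtype.val_injective ?_ ?_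
      · intro x y hxy
        fin_cases x <;> fin_cases y <;> simp_all
      · intro x y hxy
        fin_cases y
        · exact hi ((show e x = i from hxy) ▸ x.2)
        · exact hj ((show e x = j from hxy) ▸ x.2)
    · intro x
      simp only [Finset.mem_insert, Sum.exists, Sum.elim_inl, Sum.elim_inr, Fin.exists_fin_two]
      simp only [e, Subtype.exists, exists_prop, exists_eq_right]
      simp [eq_comm, or_comm, or_assoc]
  have h0 := minor_pos hM C
  have hr : ∀ a, (schur M e a a).im = 0 := fun a =>
    Complex.conj_eq_iff_im.mp (schur_conj hM.1 e a a)
  have hc : schur M e i j * schur M e j i = (Complex.normSq (schur M e i j) : ℂ) := by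
    rw [← schur_conj hM.1 e i j, Complex.mul_conj]
  have him : (minor M C).im = 0 := (Complex.lt_def.mp h0).2.symm
  have hre : 0 < (minor M C).re := (Complex.lt_def.mp h0).1
  rw [two, one i hi, one j hj, hc]
  simp only [Complex.mul_re, Complex.sub_re, Complex.sub_im, Complex.mul_im, him, hr,
    Complex.ofReal_re, Complex.ofReal_im]
  have := Complex.normSq_nonneg (schur M e i j)
  have h2 : 0 ≤ (minor M C).re * (minor M C).re * Complex.normSq (schur M e i j) := by positivity
  nlinarith

theorem log_minor_submodular {M : Matrix ι ι ℂ} (hM : M.PosDef) (A B : Finset ι) :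
    Real.log (minor M (A ∪ B)).re + Real.log (minor M (A ∩ B)).re ≤
      Real.log (minor M A).re + Real.log (minor M B).re := by
  have hp : ∀ C, 0 < (minor M C).re := fun C => (Complex.lt_def.mp (minor_pos hM C)).1
  refine submodular_of_local (F := fun C => Real.log (minor M C).re) ?_ A B
  intro C i j hi hj hij
  rw [← Real.log_mul (hp _).ne' (hp _).ne', ← Real.log_mul (hp _).ne' (hp _).ne']
  exact Real.log_le_log (mul_pos (hp _) (hp _)) (minor_local hM C hi hj hij)

end minors

/-! ## Determinants of sums of rank one matrices -/

section gram

variable {R K : Type*} [Fintype R] [DecidableEq R] [Fintype K] [DecidableEq K]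

/-- The diagonal projection to the indices in `A`. -/
noncomputable def proj (A : Finset K) : Matrix K K ℂ := diagonal fun k => if k ∈ A then 1 else 0

theorem proj_mul_proj (A : Finset K) : proj A * proj A = proj A := by
  simp [proj, diagonal_mul_diagonal]

theorem proj_conjTranspose (A : Finset K) : (proj A)ᴴ = proj A := by
  rw [proj, diagonal_conjTranspose]
  congr 1
  funext k
  simp only [Pi.star_apply]
  split_ifs <;> simp

theorem mul_diagonal_mul_apply {l m n : Type*} [Fintype m] [DecidableEq m] (Y : Matrix l m ℂ)
    (d : m → ℂ) (Z : Matrix m n ℂ) (i : l) (j : n) :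
    (Y * diagonal d * Z) i j = ∑ k, Y i k * d k * Z k j := by
  rw [Matrix.mul_apply]
  exact Finset.sum_congr rfl fun k _ => by rw [Matrix.mul_diagonal]

/-- The determinant of `1 + Q` with the rows outside `A` of `Q` deleted. -/
noncomputable def gramDet (Q : Matrix K K ℂ) (A : Finset K) : ℂ := (1 + proj A * Q).det

/-- The sum of the rank one matrices of the columns in `A`. -/
noncomputable def rankSum (Y : Matrix R K ℂ) (A : Finset K) : Matrix R R ℂ :=
  1 + Y * proj A * Yᴴ

theorem det_rankSum (Y : Matrix R K ℂ) (A : Finset K) :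
    (rankSum Y A).det = gramDet (Yᴴ * Y) A := by
  rw [rankSum, gramDet, Matrix.mul_assoc, det_one_add_mul_comm, Matrix.mul_assoc]

theorem rankSum_posDef (Y : Matrix R K ℂ) (A : Finset K) : (rankSum Y A).PosDef := by
  have h : Y * proj A * Yᴴ = (Y * proj A) * (Y * proj A)ᴴ := by
    rw [conjTranspose_mul, proj_conjTranspose, Matrix.mul_assoc, Matrix.mul_assoc,
      ← Matrix.mul_assoc (proj A) (proj A), proj_mul_proj]
  rw [rankSum, h]
  exact PosDef.one.add_posSemidef (posSemidef_self_mul_conjTranspose _)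

theorem rankSum_empty (Y : Matrix R K ℂ) : rankSum Y ∅ = 1 := by
  simp [rankSum, proj]

theorem rankSum_insert (Y : Matrix R K ℂ) {A : Finset K} {k : K} (hk : k ∉ A) :
    rankSum Y (insert k A) =
      rankSum Y A + replicateCol Unit (fun r => Y r k) * replicateRow Unit fun r => star (Y r k) := by
  ext r r'
  simp only [rankSum, proj, Matrix.add_apply, mul_diagonal_mul_apply, Matrix.conjTranspose_apply,
    add_assoc]
  congr 1
  simp only [mul_ite, mul_one, mul_zero, ite_mul, zero_mul, Finset.sum_ite_mem, Finset.univ_inter]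
  rw [Finset.sum_insert hk, add_comm]
  simp [Matrix.mul_apply]

/-- The matrix determinant lemma for the rank one term of the new user. The second factor is at
least 1 because the inverse is positive definite. -/
theorem det_rankSum_insert (Y : Matrix R K ℂ) {A : Finset K} {k : K} (hk : k ∉ A) :
    (rankSum Y (insert k A)).det = (rankSum Y A).det *
      (1 + (fun r => star (Y r k)) ⬝ᵥ ((rankSum Y A)⁻¹ *ᵥ fun r => Y r k)) := by
  rw [rankSum_insert Y hk, det_add_replicateCol_mul_replicateRow
    (isUnit_iff_ne_zero.mpr (rankSum_posDef Y A).det_pos.ne'), Matrix.mul_assoc,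
    det_unique (n := Unit)]
  rfl

theorem inv_rankSum_nonneg (Y : Matrix R K ℂ) (A : Finset K) (x : R → ℂ) :
    0 ≤ star x ⬝ᵥ ((rankSum Y A)⁻¹ *ᵥ x) :=
  (rankSum_posDef Y A).inv.posSemidef.dotProduct_mulVec_nonneg x

theorem gramDet_empty (Q : Matrix K K ℂ) : gramDet Q ∅ = 1 := by simp [gramDet, proj]

theorem re_le_mul_re {z x : ℂ} (hz : 0 < z) (hx : 0 ≤ x) : z.re ≤ (z * (1 + x)).re := by
  obtain ⟨h1, h2⟩ := Complex.lt_def.mp hz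
  obtain ⟨h3, h4⟩ := Complex.le_def.mp hx
  simp only [Complex.zero_re, Complex.zero_im] at h1 h2 h3 h4
  simp only [Complex.mul_re, Complex.add_re, Complex.one_re, Complex.add_im, Complex.one_im,
    ← h2, ← h4]
  nlinarith

theorem gramDet_mono (Y : Matrix R K ℂ) : Monotone fun A : Finset K => (gramDet (Yᴴ * Y) A).re := by
  refine Finset.monotone_iff_forall_le_insert.mpr fun A k hk => ?_
  simp only [← det_rankSum]
  rw [det_rankSum_insert Y hk]
  exact re_le_mul_re (rankSum_posDef Y A).det_pos (inv_rankSum_nonneg Y A fun r => Y r k)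

/-- By Sylvester's identity, receivers and users play symmetric roles in the determinant.
Monotonicity in the receivers thus reduces to monotonicity in the users. -/
theorem gramDet_swap (Y : Matrix R K ℂ) (A : Finset K) (S : Finset R) :
    gramDet (Yᴴ * proj S * Y) A = gramDet (((Y * proj A)ᴴ)ᴴ * (Y * proj A)ᴴ) S := by
  rw [gramDet, gramDet, conjTranspose_conjTranspose, conjTranspose_mul, proj_conjTranspose]
  have h : Y * proj A * (proj A * Yᴴ) = Y * (proj A * Yᴴ) := by
    rw [← Matrix.mul_assoc, Matrix.mul_assoc Y, proj_mul_proj, Matrix.mul_assoc]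
  rw [h, det_one_add_mul_comm (proj A) (Yᴴ * proj S * Y)]
  have h2 := det_one_add_mul_comm Yᴴ (proj S * (Y * proj A))
  simp only [Matrix.mul_assoc] at h2 ⊢
  exact h2

theorem gramDet_mono_rows (Y : Matrix R K ℂ) (A : Finset K) :
    Monotone fun S : Finset R => (gramDet (Yᴴ * proj S * Y) A).re := by
  simp only [gramDet_swap]
  exact gramDet_mono _

/-- The joint covariance matrix of the input and the output of a Gaussian channel. -/
noncomputable def jointCov (Y : Matrix R K ℂ) : Matrix (K ⊕ R) (K ⊕ R) ℂ :=
  fromBlocks 1 Yᴴ Y (1 + Y * Yᴴ)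

/-- The factor is the unit triangular map that sends independent input and noise to input and
output. -/
theorem jointCov_posDef (Y : Matrix R K ℂ) : (jointCov Y).PosDef := by
  have h : jointCov Y = fromBlocks 1 0 Y 1 * (fromBlocks 1 0 Y 1)ᴴ := by
    rw [fromBlocks_conjTranspose, fromBlocks_multiply, jointCov]
    simp [add_comm]
  rw [h]
  refine PosDef.mul_conjTranspose_self _ (vecMul_injective_of_isUnit ?_)
  rw [isUnit_iff_isUnit_det, det_fromBlocks_zero₁₂]
  simp

/-- Eliminating the identity block of the known inputs outside `A` subtracts their contribution from
the output covariance, so only the users in `A` remain as signal. In terms of entropy this is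
conditioning, and it explains why users enter through their complement. -/
theorem minor_jointCov (Y : Matrix R K ℂ) (A : Finset K) (S : Finset R) :
    minor (jointCov Y) (Aᶜ.disjSum S) = gramDet (Yᴴ * proj S * Y) A := by
  rw [minor_eq (jointCov Y) (Aᶜ.disjSum S)
    (Sum.map (Subtype.val : {x // x ∈ Aᶜ} → K) (Subtype.val : {x // x ∈ S} → R))]
  · let B : Matrix {x // x ∈ S} K ℂ := Y.submatrix Subtype.val id
    let C : Matrix {x // x ∈ S} {x // x ∈ Aᶜ} ℂ := B.submatrix id Subtype.val
    have h1 : (jointCov Y).submatrix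
        (Sum.map (Subtype.val : {x // x ∈ Aᶜ} → K) (Subtype.val : {x // x ∈ S} → R))
        (Sum.map (Subtype.val : {x // x ∈ Aᶜ} → K) (Subtype.val : {x // x ∈ S} → R)) =
        fromBlocks 1 Cᴴ C (1 + B * Bᴴ) := by
      ext (a | a) (b | b)
      · simp only [jointCov, Matrix.submatrix_apply, Sum.map_inl, fromBlocks_apply₁₁,
          Matrix.one_apply]
        exact if_congr Subtype.ext_iff.symm rfl rfl
      · rfl
      · rfl
      · simp only [jointCov, Matrix.submatrix_apply, Sum.map_inr, fromBlocks_apply₂₂,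
          Matrix.add_apply, Matrix.one_apply, Subtype.ext_iff]
        rfl
    have h2 : 1 + B * Bᴴ - C * Cᴴ = 1 + B * proj A * Bᴴ := by
      ext s s'
      simp only [Matrix.sub_apply, Matrix.add_apply, proj, mul_diagonal_mul_apply]
      simp only [Matrix.mul_apply, Matrix.conjTranspose_apply]
      have h3 : ∑ x : {x // x ∈ Aᶜ}, C s x * star (C s' x) =
          ∑ x, if x ∈ Aᶜ then B s x * star (B s' x) else 0 := by
        refine (Finset.sum_coe_sort Aᶜ fun x => B s x * star (B s' x)).trans ?_
        rw [Finset.sum_ite_mem, Finset.univ_inter]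
      rw [h3, add_sub_assoc, ← Finset.sum_sub_distrib]
      congr 1
      refine Finset.sum_congr rfl fun x _ => ?_
      by_cases hx : x ∈ A <;> simp [hx]
    rw [h1, det_fromBlocks_one₁₁, h2, gramDet, Matrix.mul_assoc, det_one_add_mul_comm,
      Matrix.mul_assoc]
    congr 3
    ext k k'
    rw [proj, mul_diagonal_mul_apply, Matrix.mul_apply]
    refine (Finset.sum_coe_sort S fun x => star (Y x k) * Y x k').trans ?_
    simp only [mul_ite, mul_one, mul_zero, ite_mul, zero_mul, Finset.sum_ite_mem,
      Finset.univ_inter, Matrix.conjTranspose_apply]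
  · exact Sum.map_injective.mpr ⟨Subtype.val_injective, Subtype.val_injective⟩
  · rintro (x | x) <;> simp

/-- The logarithm of the determinant is submodular jointly in the receivers and in the complement
of the set of users. -/
theorem log_gramDet_joint (Y : Matrix R K ℂ) (A B : Finset K) (S S' : Finset R) :
    Real.log (gramDet (Yᴴ * proj (S ∪ S') * Y) (A ∩ B)).re +
      Real.log (gramDet (Yᴴ * proj (S ∩ S') * Y) (A ∪ B)).re ≤
    Real.log (gramDet (Yᴴ * proj S * Y) A).re + Real.log (gramDet (Yᴴ * proj S' * Y) B).re := by
  have h := log_minor_submodular (jointCov_posDef Y) (Aᶜ.disjSum S) (Bᶜ.disjSum S')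
  have h1 : Aᶜ.disjSum S ∪ Bᶜ.disjSum S' = (A ∩ B)ᶜ.disjSum (S ∪ S') := by
    ext (x | x) <;> simp
  have h2 : Aᶜ.disjSum S ∩ Bᶜ.disjSum S' = (A ∪ B)ᶜ.disjSum (S ∩ S') := by
    ext (x | x) <;> simp
  rwa [h1, h2, minor_jointCov, minor_jointCov, minor_jointCov, minor_jointCov] at h

end gram

/-! ## Gains of the receivers -/

section gains

variable {W K : Type*} [Fintype W] [DecidableEq W] [Fintype K] [DecidableEq K]

/-- The Gram matrix of the columns of `X` for the gains `t` of the rows. -/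
noncomputable def gram (X : Matrix W K ℂ) (t : W → ℝ) : Matrix K K ℂ :=
  Xᴴ * diagonal (fun w => (t w : ℂ)) * X

/-- The matrix `X` with its rows scaled by the square roots of the gains. -/
noncomputable def scaled (X : Matrix W K ℂ) (t : W → ℝ) : Matrix W K ℂ :=
  of fun w k => (Real.sqrt (t w) : ℂ) * X w k

theorem gram_eq_scaled (X : Matrix W K ℂ) {t : W → ℝ} (ht : ∀ w, 0 ≤ t w) :
    gram X t = (scaled X t)ᴴ * scaled X t := by
  ext k k'
  rw [gram, mul_diagonal_mul_apply, Matrix.mul_apply]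
  simp only [scaled, Matrix.conjTranspose_apply, of_apply, star_mul']
  refine Finset.sum_congr rfl fun w _ => ?_
  have : (Real.sqrt (t w) : ℂ) * (Real.sqrt (t w) : ℂ) = (t w : ℂ) := by
    rw [← Complex.ofReal_mul, Real.mul_self_sqrt (ht w)]
  rw [← this]
  simp only [Complex.star_def, Complex.conj_ofReal]
  ring

/-- Two copies of the rows of `X`, scaled by the minimum and by the difference of two gains. -/
noncomputable def splitRows (X : Matrix W K ℂ) (t t' : W → ℝ) : Matrix (W ⊕ W) K ℂ :=
  of (Sum.elim (fun w k => (Real.sqrt (min (t w) (t' w)) : ℂ) * X w k)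
    fun w k => (Real.sqrt |t w - t' w| : ℂ) * X w k)

/-- Gains are real numbers, while submodularity concerns sets of receivers. Splitting each receiver
into a copy of gain min(t, t') and a copy of gain |t - t'| realizes t, t', their maximum and their
minimum by choosing among the second copies. -/
theorem gram_splitRows (X : Matrix W K ℂ) {t t' : W → ℝ} (ht : ∀ w, 0 ≤ t w)
    (ht' : ∀ w, 0 ≤ t' w) (S : Finset W) :
    (splitRows X t t')ᴴ * proj ((Finset.univ.disjSum S : Finset (W ⊕ W))) * splitRows X t t' =
      gram X fun w => min (t w) (t' w) + if w ∈ S then |t w - t' w| else 0 := by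
  ext k k'
  rw [gram, proj, mul_diagonal_mul_apply, mul_diagonal_mul_apply, Fintype.sum_sum_type]
  simp only [splitRows, Matrix.conjTranspose_apply, of_apply, Sum.elim_inl, Sum.elim_inr,
    star_mul', Finset.inl_mem_disjSum, Finset.inr_mem_disjSum, Finset.mem_univ, if_true]
  rw [← Finset.sum_add_distrib]
  refine Finset.sum_congr rfl fun w _ => ?_
  have h1 : (Real.sqrt (min (t w) (t' w)) : ℂ) * (Real.sqrt (min (t w) (t' w)) : ℂ) =
      ((min (t w) (t' w) : ℝ) : ℂ) := by
    rw [← Complex.ofReal_mul, Real.mul_self_sqrt (le_min (ht w) (ht' w))]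
  have h2 : (Real.sqrt |t w - t' w| : ℂ) * (Real.sqrt |t w - t' w| : ℂ) =
      ((|t w - t' w| : ℝ) : ℂ) := by
    rw [← Complex.ofReal_mul, Real.mul_self_sqrt (abs_nonneg _)]
  simp only [Complex.star_def, Complex.conj_ofReal]
  split_ifs
  · rw [Complex.ofReal_add, ← h1, ← h2]; ring
  · rw [add_zero, ← h1]; ring

theorem log_gram_joint (X : Matrix W K ℂ) {t t' : W → ℝ} (ht : ∀ w, 0 ≤ t w)
    (ht' : ∀ w, 0 ≤ t' w) (A B : Finset K) :
    Real.log (gramDet (gram X fun w => max (t w) (t' w)) (A ∩ B)).re +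
      Real.log (gramDet (gram X fun w => min (t w) (t' w)) (A ∪ B)).re ≤
    Real.log (gramDet (gram X t) A).re + Real.log (gramDet (gram X t') B).re := by
  classical
  -- The second copies in `S` raise the minimum to `t`, those in `S'` raise it to `t'`. The two sets
  -- partition the receivers, so union and intersection give maximum and minimum.
  let S : Finset W := Finset.univ.filter fun w => t' w ≤ t w
  let S' : Finset W := Finset.univ.filter fun w => t w < t' w
  have h := log_gramDet_joint (splitRows X t t') A B (Finset.univ.disjSum S)
    (Finset.univ.disjSum S')
  have h1 : (Finset.univ : Finset W).disjSum S ∪ Finset.univ.disjSum S' =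
      Finset.univ.disjSum Finset.univ := by
    ext (x | x) <;> simp [S, S', le_or_gt]
  have h2 : (Finset.univ : Finset W).disjSum S ∩ Finset.univ.disjSum S' =
      Finset.univ.disjSum ∅ := by
    ext (x | x) <;> simp [S, S']
  rw [h1, h2] at h
  simp only [gram_splitRows X ht ht'] at h
  have e1 : (fun w => min (t w) (t' w) + if w ∈ (Finset.univ : Finset W) then |t w - t' w| else 0)
      = fun w => max (t w) (t' w) := by
    funext w
    rw [if_pos (Finset.mem_univ w), ← max_sub_min_eq_abs']; ring
  have e2 : (fun w => min (t w) (t' w) + if w ∈ (∅ : Finset W) then |t w - t' w| else 0)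
      = fun w => min (t w) (t' w) := by
    funext w; simp
  have e3 : (fun w => min (t w) (t' w) + if w ∈ S then |t w - t' w| else 0) = t := by
    funext w
    by_cases hw : t' w ≤ t w
    · rw [if_pos (by simp [S, hw]), min_eq_right hw, abs_of_nonneg (by linarith)]; ring
    · rw [if_neg (by simpa [S] using hw), min_eq_left (by linarith)]; ring
  have e4 : (fun w => min (t w) (t' w) + if w ∈ S' then |t w - t' w| else 0) = t' := by
    funext w
    by_cases hw : t w < t' w
    · rw [if_pos (by simp [S', hw]), min_eq_left hw.le, abs_of_nonpos (by linarith)]; ring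
    · rw [if_neg (by simpa [S'] using hw), min_eq_right (by linarith)]; ring
  rwa [e1, e2, e3, e4] at h

/-- Larger user sets are handled by `gramDet_mono`. For larger gains the receivers are split, and
all second copies are switched on. -/
theorem gram_mono (X : Matrix W K ℂ) {t t' : W → ℝ} (ht : ∀ w, 0 ≤ t w)
    (h : ∀ w, t w ≤ t' w) {A B : Finset K} (hA : A ⊆ B) :
    (gramDet (gram X t) A).re ≤ (gramDet (gram X t') B).re := by
  have ht' : ∀ w, 0 ≤ t' w := fun w => (ht w).trans (h w)
  have h1 : (gramDet (gram X t) A).re ≤ (gramDet (gram X t) B).re := by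
    rw [gram_eq_scaled X ht]; exact gramDet_mono _ hA
  refine h1.trans ?_
  have h2 := gramDet_mono_rows (splitRows X t t') B
    (Finset.disjSum_mono_right Finset.univ (Finset.empty_subset (Finset.univ : Finset W)))
  simp only [gram_splitRows X ht ht'] at h2
  have e1 : (fun w => min (t w) (t' w) + if w ∈ (Finset.univ : Finset W) then |t w - t' w| else 0)
      = t' := by
    funext w
    rw [if_pos (Finset.mem_univ w), min_eq_left (h w), abs_of_nonpos (by linarith [h w])]; ring
  have e2 : (fun w => min (t w) (t' w) + if w ∈ (∅ : Finset W) then |t w - t' w| else 0) = t := by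
    funext w; simp [h w]
  rwa [e1, e2] at h2

theorem one_le_gramDet (X : Matrix W K ℂ) {t : W → ℝ} (ht : ∀ w, 0 ≤ t w) (A : Finset K) :
    1 ≤ (gramDet (gram X t) A).re := by
  have := gram_mono X ht (fun _ => le_rfl) (Finset.empty_subset A)
  rwa [gramDet_empty, Complex.one_re] at this

end gains

end BeamBits

/-! ### The weighted sum rate is monotone and submodular -/

namespace BeamBits

open scoped ComplexOrder
open Matrix

/-! ## Minima over subsets -/

section minRate

variable {ι : Type*} [DecidableEq ι]

/-- The minimum of `q(S \ A) + f(A)` over `A ⊆ S`. -/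
noncomputable def minRate (q : ι → ℝ) (f : Finset ι → ℝ) (S : Finset ι) : ℝ :=
  S.powerset.inf' ⟨∅, Finset.empty_mem_powerset S⟩ fun A => ∑ k ∈ S \ A, q k + f A

theorem minRate_le (q : ι → ℝ) (f : Finset ι → ℝ) {S A : Finset ι} (h : A ⊆ S) :
    minRate q f S ≤ ∑ k ∈ S \ A, q k + f A :=
  Finset.inf'_le _ (Finset.mem_powerset.mpr h)

theorem exists_minRate (q : ι → ℝ) (f : Finset ι → ℝ) (S : Finset ι) :
    ∃ A ⊆ S, minRate q f S = ∑ k ∈ S \ A, q k + f A := by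
  obtain ⟨A, hA, h⟩ := Finset.exists_mem_eq_inf' (s := S.powerset) ⟨∅, Finset.empty_mem_powerset S⟩
    fun A => ∑ k ∈ S \ A, q k + f A
  exact ⟨A, Finset.mem_powerset.mp hA, h⟩

/-- A normalized monotone submodular function. -/
structure Polymatroid (f : Finset ι → ℝ) : Prop where
  empty : f ∅ = 0
  mono : Monotone f
  submodular : ∀ A B, f (A ∪ B) + f (A ∩ B) ≤ f A + f B

theorem Polymatroid.nonneg {f : Finset ι → ℝ} (hf : Polymatroid f) (A : Finset ι) : 0 ≤ f A :=
  hf.empty ▸ hf.mono (Finset.empty_subset A)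

theorem Polymatroid.union_le {f : Finset ι → ℝ} (hf : Polymatroid f) (A B : Finset ι) :
    f (A ∪ B) ≤ f A + ∑ k ∈ B, f {k} := by
  induction B using Finset.induction_on with
  | empty => simp
  | insert k B hk ih =>
    rw [Finset.sum_insert hk, Finset.union_insert, Finset.insert_eq]
    have h1 := hf.submodular {k} (A ∪ B)
    have h2 := hf.nonneg ({k} ∩ (A ∪ B))
    linarith

/-- With minimizers `A` and `B` on the right, `A ∩ B` and `A ∪ B` are admissible on the left, and
the queue terms balance exactly. -/
theorem minRate_submodular {q : ι → ℝ} {f f' g h : Finset ι → ℝ} (S : Finset ι)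
    (H : ∀ A B, g (A ∩ B) + h (A ∪ B) ≤ f A + f' B) :
    minRate q g S + minRate q h S ≤ minRate q f S + minRate q f' S := by
  obtain ⟨A, hA, eA⟩ := exists_minRate q f S
  obtain ⟨B, hB, eB⟩ := exists_minRate q f' S
  have h1 := minRate_le q g (S := S) (A := A ∩ B) (Finset.inter_subset_left.trans hA)
  have h2 := minRate_le q h (S := S) (A := A ∪ B) (Finset.union_subset hA hB)
  have h3 := Finset.sum_union_inter (s₁ := S \ A) (s₂ := S \ B) (f := q)
  have e1 : S \ A ∪ S \ B = S \ (A ∩ B) := by ext; simp; tauto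
  have e2 : S \ A ∩ (S \ B) = S \ (A ∪ B) := by ext; simp; tauto
  rw [e1, e2] at h3
  have := H A B
  linarith

theorem minRate_mono {q : ι → ℝ} {f g : Finset ι → ℝ} (S : Finset ι) (H : ∀ A, f A ≤ g A) :
    minRate q f S ≤ minRate q g S := by
  obtain ⟨A, hA, eA⟩ := exists_minRate q g S
  have h1 := minRate_le q f hA
  have := H A
  linarith

theorem minRate_nonneg {q : ι → ℝ} {f : Finset ι → ℝ} (S : Finset ι) (hq : ∀ k, 0 ≤ q k)
    (hf : ∀ A, 0 ≤ f A) : 0 ≤ minRate q f S := by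
  obtain ⟨A, hA, eA⟩ := exists_minRate q f S
  rw [eA]
  exact add_nonneg (Finset.sum_nonneg fun k _ => hq k) (hf A)

/-- Queue sizes may be replaced by their minimum with the rate of a single user. -/
theorem inf_queue_eq {f : Finset ι → ℝ} (hf : Polymatroid f) {Q : ι → ℝ≥0∞} {q : ι → ℝ}
    (hq : ∀ k, 0 ≤ q k) (h1 : ∀ k, ENNReal.ofReal (q k) ≤ Q k)
    (h2 : ∀ k, min (Q k) (ENNReal.ofReal (f {k})) ≤ ENNReal.ofReal (q k)) (S : Finset ι) :
    (S.powerset.inf fun A => ∑ k ∈ S \ A, Q k + ENNReal.ofReal (f A)).toReal = minRate q f S := by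
  have e : ∀ A, ENNReal.ofReal (∑ k ∈ S \ A, q k + f A) =
      ∑ k ∈ S \ A, ENNReal.ofReal (q k) + ENNReal.ofReal (f A) := fun A => by
    rw [ENNReal.ofReal_add (Finset.sum_nonneg fun k _ => hq k) (hf.nonneg A),
      ENNReal.ofReal_sum_of_nonneg fun k _ => hq k]
  suffices h : (S.powerset.inf fun A => ∑ k ∈ S \ A, Q k + ENNReal.ofReal (f A)) =
      ENNReal.ofReal (minRate q f S) by
    rw [h, ENNReal.toReal_ofReal (minRate_nonneg S hq hf.nonneg)]
  apply le_antisymm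
  · obtain ⟨A, hA, eA⟩ := exists_minRate q f S
    -- On `T` the queue was really shortened, so `q k` is at least the single rate. Moving `T` into
    -- `A` raises `f` by at most the sum of single rates, by subadditivity, and saves `q` on `T`;
    -- outside `A ∪ T` both kinds of queue agree.
    let T : Finset ι := (S \ A).filter fun k => ENNReal.ofReal (q k) < Q k
    have hT : T ⊆ S \ A := Finset.filter_subset _ _
    have hTA : A ∪ T ⊆ S := Finset.union_subset hA (hT.trans Finset.sdiff_subset)
    have hfT : ∀ k ∈ T, f {k} ≤ q k := by
      intro k hk
      have h3 := (Finset.mem_filter.mp hk).2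
      rcases min_le_iff.mp (h2 k) with h4 | h4
      · exact absurd h4 (not_le.mpr h3)
      · exact (ENNReal.ofReal_le_ofReal_iff (hq k)).mp h4
    have hQ : ∀ k ∈ S \ (A ∪ T), Q k = ENNReal.ofReal (q k) := by
      intro k hk
      simp only [Finset.mem_sdiff, Finset.mem_union, not_or, T, Finset.mem_filter, not_and,
        not_lt] at hk
      exact le_antisymm (hk.2.2 ⟨hk.1, hk.2.1⟩) (h1 k)
    refine (Finset.inf_le (Finset.mem_powerset.mpr hTA)).trans ?_
    rw [Finset.sum_congr rfl hQ, ← e]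
    apply ENNReal.ofReal_le_ofReal
    rw [eA]
    have h5 := hf.union_le A T
    have h6 := Finset.sum_le_sum hfT
    have h7 := Finset.sum_sdiff hT (f := q)
    rw [sdiff_sdiff_left] at h7
    simp only [Finset.sup_eq_union] at h7
    linarith
  · refine Finset.le_inf fun A hA => ?_
    refine (ENNReal.ofReal_le_ofReal (minRate_le q f (Finset.mem_powerset.mp hA))).trans ?_
    rw [e]
    gcongr with k _
    exact h1 k

end minRate

/-! ## The variance of the output of a beam -/

/-- Factor the projection through the coordinates in `A` and apply Sylvester's identity. -/
theorem gramDet_eq_submatrix {K : Type*} [Fintype K] [DecidableEq K] (Q : Matrix K K ℂ)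
    (A : Finset K) :
    gramDet Q A = (1 + Q.submatrix (Subtype.val : {k // k ∈ A} → K) Subtype.val).det := by
  let P : Matrix K {k // k ∈ A} ℂ := of fun k a => if k = a then 1 else 0
  have h1 : proj A = P * Pᵀ := by
    ext k k'
    rw [Matrix.mul_apply, proj, diagonal_apply]
    simp only [P, transpose_apply, of_apply, mul_ite, mul_one, mul_zero]
    by_cases hk' : k' ∈ A
    · rw [Finset.sum_eq_single ⟨k', hk'⟩]
      · simp only [if_true]
        by_cases h : k = k' <;> simp [h, hk']
      · rintro b - hb
        rw [if_neg]
        rintro rfl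
        exact hb rfl
      · simp
    · rw [Finset.sum_eq_zero]
      · by_cases h : k = k'
        · rw [if_pos h, if_neg (h ▸ hk')]
        · rw [if_neg h]
      · rintro b -
        rw [if_neg]
        rintro rfl
        exact hk' b.2
  have h2 : Pᵀ * Q * P = Q.submatrix Subtype.val Subtype.val := by
    ext a b
    simp [P, Matrix.mul_apply]
  rw [gramDet, h1, Matrix.mul_assoc, det_one_add_mul_comm, h2]

namespace Uplink

variable (I : Uplink)

theorem N_pos : 0 < I.N := lt_of_lt_of_le I.L_pos I.L_le

/-- The phase factor of the path `l` on the subcarrier `n`. -/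
noncomputable def phase (n : Fin I.N) (l : ℕ) : ℂ :=
  Complex.exp (-(2 * Real.pi * Complex.I * (n : ℂ) * (l : ℂ) / (I.N : ℂ)))

theorem conj_phase (n : Fin I.N) (j : ℕ) (hj : j < I.N) :
    (starRingEnd ℂ) (I.phase n j) = I.phase n ((I.N - j) % I.N) := by
  have hN : (I.N : ℂ) ≠ 0 := Nat.cast_ne_zero.mpr I.N_pos.ne'
  rw [phase, phase, ← Complex.exp_conj]
  simp only [map_neg, map_div₀, map_mul, Complex.conj_ofReal, Complex.conj_I, Complex.conj_natCast,
    map_ofNat]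
  rcases Nat.eq_zero_or_pos j with rfl | hj0
  · simp
  · rw [Nat.mod_eq_of_lt (by omega), Complex.exp_eq_exp_iff_exists_int]
    -- Replacing the delay `j` by `N - j` changes the exponent by the multiple `n` of 2πi.
    refine ⟨(n : ℕ), ?_⟩
    rw [Nat.cast_sub hj.le]
    push_cast
    field_simp
    ring

theorem dft_eq (n j : Fin I.N) : I.dft n j = I.phase n j / (Real.sqrt I.N : ℂ) := rfl

theorem chan_apply (n : Fin I.N) (r : Fin I.Nr) (k : Fin I.K) :
    I.chan n r k = ∑ l : Fin I.L, I.phase n l * I.tap l r k := by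
  simp [chan, Matrix.sum_apply, phase]

/-- The taps appear in reversed cyclic order, and conjugating a phase negates the delay modulo `N`.
The substitution `j ↦ -j` therefore gives the Fourier sum over the taps, that is, the channel on
subcarrier `n`. -/
theorem tapRow_dft (n : Fin I.N) (r : Fin I.Nr) (k : Fin I.K) :
    ∑ j, I.tapRow r (j, k) * (starRingEnd ℂ) (I.dft n j) =
      I.chan n r k / (Real.sqrt I.N : ℂ) := by
  have : NeZero I.N := ⟨I.N_pos.ne'⟩
  let c : Fin I.N → ℂ := fun l => if h : (l : ℕ) < I.L then I.phase n l * I.tap ⟨l, h⟩ r k else 0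
  have h1 : ∀ j, I.tapRow r (j, k) * (starRingEnd ℂ) (I.dft n j) =
      c (-j) / (Real.sqrt I.N : ℂ) := by
    intro j
    have h2 : ((-j : Fin I.N) : ℕ) = (I.N - j) % I.N := Fin.val_neg' j ▸ rfl
    simp only [tapRow, dft_eq, map_div₀, Complex.conj_ofReal, c, h2]
    rw [I.conj_phase n j j.2]
    split_ifs
    · ring
    · simp
  rw [Finset.sum_congr rfl fun j _ => h1 j, ← Finset.sum_div,
    chan_apply]
  congr 1
  refine (Equiv.sum_comp (Equiv.neg (Fin I.N)) c).trans ?_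
  simp only [c]
  rw [← Finset.sum_subset (Finset.subset_univ (Finset.univ.map (Fin.castLEEmb I.L_le)))]
  · rw [Finset.sum_map]
    exact Finset.sum_congr rfl fun l _ => by simp
  · intro l _ hl
    rw [dif_neg]
    intro h
    exact hl (Finset.mem_map.mpr ⟨⟨l, h⟩, Finset.mem_univ _, rfl⟩)

/-- The effective channel of each beam before quantization. -/
noncomputable def paths (n : Fin I.N) : Matrix (Fin I.nW) (Fin I.K) ℂ := I.beam * I.chan n

theorem beam_tapRow_dft (w : Fin I.nW) (n : Fin I.N) (k : Fin I.K) :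
    (I.beam * I.tapRow * (I.dftᴴ ⊗ₖ (1 : Matrix (Fin I.K) (Fin I.K) ℂ))) w (n, k) =
      I.paths n w k / (Real.sqrt I.N : ℂ) := by
  rw [Matrix.mul_assoc, Matrix.mul_apply, paths, Matrix.mul_apply, Finset.sum_div]
  refine Finset.sum_congr rfl fun r _ => ?_
  rw [mul_div_assoc, ← tapRow_dft, Matrix.mul_apply, Fintype.sum_prod_type]
  congr 1
  refine Finset.sum_congr rfl fun j _ => ?_
  rw [Finset.sum_eq_single k]
  · simp [kroneckerMap_apply]
  · intro k' _ hk'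
    simp [kroneckerMap_apply, hk']
  · simp

/-- The Fourier transform decouples the subcarriers, so the variance is a sum of nonnegative terms.
This gives ψ ≥ 1 and a formula that is direct to evaluate. -/
theorem psi_eq (w : Fin I.nW) :
    I.psi w = 1 + ∑ n, ∑ k, Complex.normSq (I.paths n w k) * I.power n k / I.N := by
  have h1 : (I.dft ⊗ₖ (1 : Matrix (Fin I.K) (Fin I.K) ℂ)) * I.tapRowᴴ * I.beamᴴ =
      (I.beam * I.tapRow * (I.dftᴴ ⊗ₖ (1 : Matrix (Fin I.K) (Fin I.K) ℂ)))ᴴ := by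
    rw [conjTranspose_mul, conjTranspose_mul, conjTranspose_kronecker, conjTranspose_conjTranspose,
      conjTranspose_one, Matrix.mul_assoc]
  have h2 : I.beam * I.tapRow * (I.dftᴴ ⊗ₖ (1 : Matrix (Fin I.K) (Fin I.K) ℂ)) * I.powerMatrix *
      (I.dft ⊗ₖ (1 : Matrix (Fin I.K) (Fin I.K) ℂ)) * I.tapRowᴴ * I.beamᴴ =
      I.beam * I.tapRow * (I.dftᴴ ⊗ₖ (1 : Matrix (Fin I.K) (Fin I.K) ℂ)) * I.powerMatrix *
      (I.beam * I.tapRow * (I.dftᴴ ⊗ₖ (1 : Matrix (Fin I.K) (Fin I.K) ℂ)))ᴴ := by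
    rw [← h1]; simp only [Matrix.mul_assoc]
  rw [psi, h2, Matrix.add_apply, powerMatrix, mul_diagonal_mul_apply, Fintype.sum_prod_type]
  simp only [Matrix.conjTranspose_apply, beam_tapRow_dft, Matrix.one_apply_eq, Complex.add_re,
    Complex.one_re, Complex.re_sum]
  congr 1
  refine Finset.sum_congr rfl fun n _ => Finset.sum_congr rfl fun k _ => ?_
  have h3 : I.paths n w k / (Real.sqrt I.N : ℂ) * (I.power n k : ℂ) *
      star (I.paths n w k / (Real.sqrt I.N : ℂ)) =
      ((Complex.normSq (I.paths n w k) * I.power n k / I.N : ℝ) : ℂ) := by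
    have h4 : ((Real.sqrt I.N : ℝ) : ℂ) * (Real.sqrt I.N : ℝ) = (I.N : ℂ) := by
      rw [← Complex.ofReal_mul, Real.mul_self_sqrt (Nat.cast_nonneg _), Complex.ofReal_natCast]
    rw [Complex.star_def, map_div₀, Complex.conj_ofReal]
    push_cast
    rw [← h4, Complex.normSq_eq_conj_mul_self]
    ring
  rw [h3, Complex.ofReal_re]

theorem one_le_psi (w : Fin I.nW) : 1 ≤ I.psi w := by
  rw [psi_eq, le_add_iff_nonneg_right]
  exact Finset.sum_nonneg fun n _ => Finset.sum_nonneg fun k _ => div_nonneg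
    (mul_nonneg (Complex.normSq_nonneg _) (I.power_nonneg n k)) (Nat.cast_nonneg _)

theorem gain_denom_pos (w : Fin I.nW) (b : Fin I.nB) :
    0 < I.alpha b ^ 2 + I.alpha b * (1 - I.alpha b) * I.psi w := by
  have h1 := I.alpha_pos b
  have h2 := I.alpha_le_one b
  have h3 := I.one_le_psi w
  have : 0 ≤ I.alpha b * (1 - I.alpha b) * I.psi w :=
    mul_nonneg (mul_nonneg h1.le (by linarith)) (by linarith)
  positivity

theorem gain_pos (w : Fin I.nW) (b : Fin I.nB) : 0 < I.gain w b :=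
  div_pos (pow_pos (I.alpha_pos b) 2) (I.gain_denom_pos w b)

theorem gain_mono (w : Fin I.nW) : Monotone (I.gain w) := by
  intro b c hbc
  have h1 := I.alpha_pos b
  have h2 := I.alpha_pos c
  have h3 := I.one_le_psi w
  have h4 := I.alpha_mono hbc
  rw [gain, gain, div_le_div_iff₀ (I.gain_denom_pos w b) (I.gain_denom_pos w c)]
  -- After cross-multiplication the ψ-free terms cancel and the sign is that of α_c - α_b.
  have : I.alpha c ^ 2 * (I.alpha b ^ 2 + I.alpha b * (1 - I.alpha b) * I.psi w) -
      I.alpha b ^ 2 * (I.alpha c ^ 2 + I.alpha c * (1 - I.alpha c) * I.psi w) =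
      I.alpha b * I.alpha c * I.psi w * (I.alpha c - I.alpha b) := by ring
  have h5 : 0 ≤ I.alpha b * I.alpha c * I.psi w * (I.alpha c - I.alpha b) :=
    mul_nonneg (by positivity) (by linarith)
  linarith

/-! ## The gains of a set of pairs -/

/-- The gain of the beam `w` in `G`, with `0` for the beams that do not occur in `G`. -/
noncomputable def level (G : Finset I.Ground) (w : Fin I.nW) : ℝ :=
  if h : w ∈ I.beams G then I.gain w (I.topRes G ⟨w, h⟩) else 0

theorem mem_beams {G : Finset I.Ground} {e : I.Ground} (he : e ∈ G) : e.1 ∈ I.beams G :=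
  Finset.mem_image_of_mem _ he

theorem gain_le_level {G : Finset I.Ground} {w : Fin I.nW} {b : Fin I.nB} (he : (w, b) ∈ G) :
    I.gain w b ≤ I.level G w := by
  have h : w ∈ I.beams G := I.mem_beams he
  rw [level, dif_pos h]
  refine I.gain_mono w (Finset.le_max' _ _ ?_)
  exact Finset.mem_image.mpr ⟨(w, b), by simp [he], rfl⟩

theorem level_cases (G : Finset I.Ground) (w : Fin I.nW) :
    ((∀ b, (w, b) ∉ G) ∧ I.level G w = 0) ∨ ∃ b, (w, b) ∈ G ∧ I.level G w = I.gain w b := by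
  by_cases h : w ∈ I.beams G
  · right
    refine ⟨I.topRes G ⟨w, h⟩, ?_, by rw [level, dif_pos h]⟩
    obtain ⟨⟨w', b⟩, he, h2⟩ := Finset.mem_image.mp (Finset.max'_mem
      ((G.filter fun e => e.1 = w).image Prod.snd) (by
        obtain ⟨e, he, rfl⟩ := Finset.mem_image.mp h
        exact ⟨e.2, Finset.mem_image.mpr ⟨e, by simp [he], rfl⟩⟩))
    obtain ⟨he1, he2⟩ := Finset.mem_filter.mp he
    have h3 : I.topRes G ⟨w, h⟩ = b := h2.symm
    rw [h3]
    simp only at he2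
    rwa [← he2]
  · left
    exact ⟨fun b hb => h (I.mem_beams hb), by rw [level, dif_neg h]⟩

theorem level_nonneg (G : Finset I.Ground) (w : Fin I.nW) : 0 ≤ I.level G w := by
  rcases I.level_cases G w with ⟨-, h⟩ | ⟨b, -, h⟩
  · rw [h]
  · rw [h]; exact (I.gain_pos w b).le

theorem level_mono {G G' : Finset I.Ground} (h : G ⊆ G') (w : Fin I.nW) :
    I.level G w ≤ I.level G' w := by
  rcases I.level_cases G w with ⟨-, h1⟩ | ⟨b, hb, h1⟩
  · rw [h1]; exact I.level_nonneg G' w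
  · rw [h1]; exact I.gain_le_level (h hb)

theorem level_union (G G' : Finset I.Ground) (w : Fin I.nW) :
    I.level (G ∪ G') w = max (I.level G w) (I.level G' w) := by
  apply le_antisymm
  · rcases I.level_cases (G ∪ G') w with ⟨-, h1⟩ | ⟨b, hb, h1⟩
    · rw [h1]; exact le_max_of_le_left (I.level_nonneg G w)
    · rw [h1]
      rcases Finset.mem_union.mp hb with h | h
      · exact le_max_of_le_left (I.gain_le_level h)
      · exact le_max_of_le_right (I.gain_le_level h)
  · exact max_le (I.level_mono Finset.subset_union_left w)
      (I.level_mono Finset.subset_union_right w)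

/-- Equality can fail: a beam may occur in both sets at different resolutions and then be absent
from the intersection. Monotonicity in the gains absorbs the difference. -/
theorem level_inter_le (G G' : Finset I.Ground) (w : Fin I.nW) :
    I.level (G ∩ G') w ≤ min (I.level G w) (I.level G' w) :=
  le_min (I.level_mono Finset.inter_subset_left w) (I.level_mono Finset.inter_subset_right w)

/-- The effective channel of each beam and user before quantization. -/
noncomputable def signal (n : Fin I.N) : Matrix (Fin I.nW) (Fin I.K) ℂ :=
  of fun w k => I.paths n w k * (Real.sqrt (I.power n k) : ℂ)

/-- Absent beams get gain 0 and contribute nothing, so the full codebook can index the rows for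
every set. Sets are then compared through their gains alone. -/
theorem det_effChanOn (G : Finset I.Ground) (n : Fin I.N) (A : Finset (Fin I.K)) :
    (1 + I.effChanOn G n A * (I.effChanOn G n A)ᴴ).det =
      gramDet (gram (I.signal n) (I.level G)) A := by
  rw [det_one_add_mul_comm, gramDet_eq_submatrix]
  congr 2
  ext a b
  rw [Matrix.mul_apply, Matrix.submatrix_apply, gram, mul_diagonal_mul_apply]
  have h1 : ∀ w : {w // w ∈ I.beams G}, ∀ k : {k // k ∈ A}, I.effChanOn G n A w k =
      (Real.sqrt (I.level G w) : ℂ) * I.signal n w k := by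
    intro w k
    have h2 : I.level G w = I.gain w.1 (I.topRes G w) := by rw [level, dif_pos w.2]
    rw [effChanOn, Matrix.submatrix_apply, effChan, Matrix.mul_diagonal, Matrix.mul_assoc,
      Matrix.diagonal_mul, h2, signal, of_apply, paths, id, mul_assoc]
    rfl
  have h3 : ∀ w ∉ I.beams G, (I.signal n)ᴴ a w * (I.level G w : ℂ) * I.signal n w b = 0 := by
    intro w hw
    rw [level, dif_neg hw]; simp
  rw [← Finset.sum_subset (Finset.subset_univ (I.beams G)) fun w _ hw => h3 w hw,
    ← Finset.sum_coe_sort (I.beams G)]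
  refine Finset.sum_congr rfl fun w _ => ?_
  rw [Matrix.conjTranspose_apply, Matrix.conjTranspose_apply, h1, h1, star_mul']
  have h4 : (Real.sqrt (I.level G w) : ℂ) * (Real.sqrt (I.level G w) : ℂ) = (I.level G w : ℂ) := by
    rw [← Complex.ofReal_mul, Real.mul_self_sqrt (I.level_nonneg G w)]
  rw [← h4, Complex.star_def, Complex.conj_ofReal]
  ring

theorem sumRate_eq (G : Finset I.Ground) (A : Finset (Fin I.K)) :
    I.sumRate G A = ∑ n, Real.logb 2 (gramDet (gram (I.signal n) (I.level G)) A).re := by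
  simp only [sumRate, det_effChanOn]

theorem sumRate_mono {G G' : Finset I.Ground} {A A' : Finset (Fin I.K)} (hG : G ⊆ G')
    (hA : A ⊆ A') : I.sumRate G A ≤ I.sumRate G' A' := by
  rw [sumRate_eq, sumRate_eq]
  refine Finset.sum_le_sum fun n _ => Real.logb_le_logb_of_le one_lt_two ?_ ?_
  · exact zero_lt_one.trans_le (one_le_gramDet _ (I.level_nonneg G) A)
  · exact gram_mono _ (I.level_nonneg G) (fun w => I.level_mono hG w) hA

theorem sumRate_empty (G : Finset I.Ground) : I.sumRate G ∅ = 0 := by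
  simp [sumRate_eq, gramDet_empty]

/-- The larger set of pairs meets the smaller set of users. It is this crossing that passes through
the minimum over user sets; for `G = G'` it is ordinary submodularity in the users. -/
theorem sumRate_joint (G G' : Finset I.Ground) (A B : Finset (Fin I.K)) :
    I.sumRate (G ∪ G') (A ∩ B) + I.sumRate (G ∩ G') (A ∪ B) ≤ I.sumRate G A + I.sumRate G' B := by
  simp only [sumRate_eq, ← Finset.sum_add_distrib]
  refine Finset.sum_le_sum fun n _ => ?_
  have h0 : I.level (G ∪ G') = fun w => max (I.level G w) (I.level G' w) :=
    funext fun w => I.level_union G G' w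
  have h1 := log_gram_joint (I.signal n) (I.level_nonneg G) (I.level_nonneg G') A B
  have h2 : Real.log (gramDet (gram (I.signal n) (I.level (G ∩ G'))) (A ∪ B)).re ≤
      Real.log (gramDet (gram (I.signal n) fun w => min (I.level G w) (I.level G' w)) (A ∪ B)).re :=
    Real.log_le_log (zero_lt_one.trans_le (one_le_gramDet _ (I.level_nonneg _) _))
      (gram_mono _ (I.level_nonneg _) (I.level_inter_le G G') subset_rfl)
  rw [h0]
  simp only [Real.logb, ← add_div]
  exact div_le_div_of_nonneg_right (by linarith) (Real.log_nonneg one_le_two)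

theorem sumRate_polymatroid (G : Finset I.Ground) : Polymatroid (I.sumRate G) where
  empty := I.sumRate_empty G
  mono := fun _ _ h => I.sumRate_mono subset_rfl h
  submodular := fun A B => by
    have := I.sumRate_joint G G A B
    rw [Finset.union_self, Finset.inter_self] at this
    linarith

/-- The queue sizes, bounded by the rate of the single user. -/
noncomputable def limit (G : Finset I.Ground) (k : Fin I.K) : ℝ :=
  (min (I.queue k) (ENNReal.ofReal (I.sumRate G {k}))).toReal

theorem limit_nonneg (G : Finset I.Ground) (k : Fin I.K) : 0 ≤ I.limit G k :=
  ENNReal.toReal_nonneg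

theorem ofReal_limit (G : Finset I.Ground) (k : Fin I.K) :
    ENNReal.ofReal (I.limit G k) = min (I.queue k) (ENNReal.ofReal (I.sumRate G {k})) :=
  ENNReal.ofReal_toReal (min_lt_of_right_lt ENNReal.ofReal_lt_top).ne

/-- The caps may come from any larger set, since a cap above the single rate does not bind. In the
submodular inequality all four sets can thus use the caps of the union. -/
theorem queueRate_eq {G G' : Finset I.Ground} (h : G ⊆ G') (l : Fin I.K) :
    I.queueRate G l = minRate (I.limit G') (I.sumRate G) (Finset.Iic l) := by
  refine inf_queue_eq (I.sumRate_polymatroid G) (I.limit_nonneg G') (fun k => ?_) (fun k => ?_) _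
  · rw [ofReal_limit]; exact min_le_left _ _
  · rw [ofReal_limit]
    exact min_le_min_left _ (ENNReal.ofReal_le_ofReal (I.sumRate_mono h subset_rfl))

theorem queueRate_nonneg (G : Finset I.Ground) (l : Fin I.K) : 0 ≤ I.queueRate G l :=
  ENNReal.toReal_nonneg

theorem nextWeight_le (l : Fin I.K) : I.nextWeight l ≤ I.weight l := by
  rw [nextWeight]
  split_ifs with h
  · exact I.weight_anti (by rw [Fin.le_def]; simp)
  · exact I.weight_nonneg l

theorem wsr_nonneg (G : Finset I.Ground) : 0 ≤ I.wsr G :=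
  Finset.sum_nonneg fun l _ =>
    mul_nonneg (sub_nonneg.mpr (I.nextWeight_le l)) (I.queueRate_nonneg G l)

theorem wsr_mono {G G' : Finset I.Ground} (h : G ⊆ G') : I.wsr G ≤ I.wsr G' := by
  refine Finset.sum_le_sum fun l _ =>
    mul_le_mul_of_nonneg_left ?_ (sub_nonneg.mpr (I.nextWeight_le l))
  rw [I.queueRate_eq h, I.queueRate_eq subset_rfl]
  exact minRate_mono _ fun A => I.sumRate_mono h subset_rfl

theorem wsr_submodular (G G' : Finset I.Ground) :
    I.wsr (G ∪ G') + I.wsr (G ∩ G') ≤ I.wsr G + I.wsr G' := by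
  simp only [wsr, ← Finset.sum_add_distrib, ← mul_add]
  refine Finset.sum_le_sum fun l _ =>
    mul_le_mul_of_nonneg_left ?_ (sub_nonneg.mpr (I.nextWeight_le l))
  have h : ∀ H ⊆ G ∪ G', I.queueRate H l = _ := fun H hH => I.queueRate_eq hH l
  rw [h _ subset_rfl, h _ (Finset.inter_subset_left.trans Finset.subset_union_left),
    h _ Finset.subset_union_left, h _ Finset.subset_union_right]
  exact minRate_submodular _ fun A B => I.sumRate_joint G G' A B

end Uplink

end BeamBits

/-! ### Linear optimization over a capped polymatroid by a fluid recursion -/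

namespace BeamBits

/-! ## Polymatroids -/

section polymatroid

variable {ι α : Type*} [Fintype ι] [DecidableEq ι] [LinearOrder α]

/-- The indices up to `k` in the order given by `key`. -/
def upSet (key : ι → α) (k : ι) : Finset ι := Finset.univ.filter fun j => key j ≤ key k

/-- The indices before `k` in the order given by `key`. -/
def lowSet (key : ι → α) (k : ι) : Finset ι := Finset.univ.filter fun j => key j < key k

/-- The marginal values of `f` along the order given by `key`. -/
def marginal (key : ι → α) (f : Finset ι → ℝ) (k : ι) : ℝ := f (upSet key k) - f (lowSet key k)

/-- Edmonds' greedy vertex lies in the polymatroid: the last element of `A` contributes its marginal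
over all its predecessors, which is at most its marginal over the rest of `A`. -/
theorem sum_marginal_le {key : ι → α} (hk : Function.Injective key) {f : Finset ι → ℝ}
    (h0 : f ∅ = 0) (hf : ∀ A B, f (A ∪ B) + f (A ∩ B) ≤ f A + f B) (A : Finset ι) :
    ∑ k ∈ A, marginal key f k ≤ f A := by
  induction A using Finset.induction_on_max_value key with
  | empty => simp [h0]
  | insert k B hB hmax ih =>
    rw [Finset.sum_insert hB]
    have h1 := hf (insert k B) (lowSet key k)
    have h2 : insert k B ∪ lowSet key k = upSet key k := by
      ext j
      simp only [Finset.mem_union, Finset.mem_insert, lowSet, upSet, Finset.mem_filter,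
        Finset.mem_univ, true_and]
      constructor
      · rintro ((rfl | h) | h)
        · exact le_rfl
        · exact hmax j h
        · exact h.le
      · intro h
        rcases h.lt_or_eq with h | h
        · exact .inr h
        · exact .inl (.inl (hk h))
    have h3 : insert k B ∩ lowSet key k = B := by
      ext j
      simp only [Finset.mem_inter, Finset.mem_insert, lowSet, Finset.mem_filter,
        Finset.mem_univ, true_and]
      constructor
      · rintro ⟨rfl | h, h'⟩
        · exact absurd h' (lt_irrefl _)
        · exact h
      · intro h
        exact ⟨.inr h, (hmax j h).lt_of_ne fun e => hB (hk e ▸ h)⟩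
    rw [h2, h3] at h1
    unfold marginal at ih ⊢
    linarith

/-- Initial segments of the order given by `key`. -/
def Initial (key : ι → α) (D : Finset ι) : Prop := ∀ k ∈ D, ∀ j, key j ≤ key k → j ∈ D

theorem Initial.insert_max {key : ι → α} (hk : Function.Injective key) {k : ι} {B : Finset ι}
    (hB : k ∉ B) (hmax : ∀ j ∈ B, key j ≤ key k) (h : Initial key (insert k B)) :
    upSet key k = insert k B ∧ lowSet key k = B ∧ Initial key B := by
  have h1 : ∀ j, j ∈ B ↔ key j < key k := fun j => by
    constructor
    · exact fun hj => (hmax j hj).lt_of_ne fun e => hB (hk e ▸ hj)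
    · intro hj
      rcases Finset.mem_insert.mp (h k (Finset.mem_insert_self k B) j hj.le) with rfl | h2
      · exact absurd hj (lt_irrefl _)
      · exact h2
  refine ⟨?_, ?_, ?_⟩
  · ext j
    simp only [upSet, Finset.mem_filter, Finset.mem_univ, true_and, Finset.mem_insert, h1]
    rw [le_iff_lt_or_eq, or_comm, hk.eq_iff]
  · ext j
    simp only [lowSet, Finset.mem_filter, Finset.mem_univ, true_and, h1]
  · intro j hj i hi
    rw [h1] at hj ⊢
    exact hi.trans_lt hj

theorem sum_marginal_initial {key : ι → α} (hk : Function.Injective key) {f : Finset ι → ℝ}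
    (h0 : f ∅ = 0) {D : Finset ι} (hD : Initial key D) : ∑ k ∈ D, marginal key f k = f D := by
  induction D using Finset.induction_on_max_value key with
  | empty => simp [h0]
  | insert k B hB hmax ih =>
    obtain ⟨h1, h2, h3⟩ := Initial.insert_max hk hB hmax hD
    rw [Finset.sum_insert hB, ih h3, marginal, h1, h2]
    ring

/-- Abel summation, as an induction that removes the last element `k`: the coefficient `m` is raised
to `c k`, which is in turn a lower bound for the coefficients of the remaining elements. -/
theorem mul_sum_le_of_initial {key : ι → α} (hk : Function.Injective key) {c d : ι → ℝ}
    (hc : ∀ j k, key j ≤ key k → c k ≤ c j) {D : Finset ι} (hD : Initial key D)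
    (hd : ∀ E ⊆ D, Initial key E → 0 ≤ ∑ k ∈ E, d k) {m : ℝ} (hm : ∀ k ∈ D, m ≤ c k) :
    m * ∑ k ∈ D, d k ≤ ∑ k ∈ D, c k * d k := by
  induction D using Finset.induction_on_max_value key generalizing m with
  | empty => simp
  | insert k B hB hmax ih =>
    obtain ⟨-, -, h3⟩ := Initial.insert_max hk hB hmax hD
    have h4 := ih h3 (fun E hE => hd E (hE.trans (Finset.subset_insert k B))) (m := c k)
      fun j hj => hc j k (hmax j hj)
    have h5 := hd _ subset_rfl hD
    have h6 := mul_le_mul_of_nonneg_right (hm k (Finset.mem_insert_self k B)) h5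
    rw [Finset.sum_insert hB] at h5 h6 ⊢
    rw [Finset.sum_insert hB]
    linarith

/-- The marginal values maximize a linear function that decreases along the order. -/
theorem sum_mul_le_marginal {key : ι → α} (hk : Function.Injective key) {f : Finset ι → ℝ}
    (h0 : f ∅ = 0) {c x : ι → ℝ} (hc : ∀ j k, key j ≤ key k → c k ≤ c j) (hc0 : ∀ k, 0 ≤ c k)
    (hx : ∀ A, ∑ k ∈ A, x k ≤ f A) : ∑ k, c k * x k ≤ ∑ k, c k * marginal key f k := by
  have h := mul_sum_le_of_initial hk hc (D := Finset.univ) (fun _ _ j _ => Finset.mem_univ j)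
    (d := fun k => marginal key f k - x k) (fun E _ hE => by
      rw [Finset.sum_sub_distrib, sum_marginal_initial hk h0 hE]
      linarith [hx E]) (m := 0) fun k _ => hc0 k
  simp only [zero_mul, mul_sub, Finset.sum_sub_distrib] at h
  linarith

/-- `h` is the maximum of the weighted sum of `x` over all `x` in the polymatroid of `f` that are
bounded by `q`. -/
structure IsMaxRate (w q : ι → ℝ) (f : Finset ι → ℝ) (h : ℝ) : Prop where
  exists_eq : ∃ x : ι → ℝ, (∀ A, ∑ k ∈ A, x k ≤ f A) ∧ (∀ k, x k ≤ q k) ∧ ∑ k, w k * x k = h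
  le : ∀ x : ι → ℝ, (∀ A, ∑ k ∈ A, x k ≤ f A) → (∀ k, x k ≤ q k) → ∑ k, w k * x k ≤ h

/-- Truncating by a box preserves submodularity, so the greedy vertex of the truncation is
available; it meets both the rate bounds and the caps. -/
theorem minRate_self_submodular {q : ι → ℝ} {f : Finset ι → ℝ} (hf : Polymatroid f)
    (S T : Finset ι) :
    minRate q f (S ∪ T) + minRate q f (S ∩ T) ≤ minRate q f S + minRate q f T := by
  obtain ⟨A, hA, eA⟩ := exists_minRate q f S
  obtain ⟨B, hB, eB⟩ := exists_minRate q f T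
  have hU : A ∪ B ⊆ S ∪ T := Finset.union_subset_union hA hB
  have hI : A ∩ B ⊆ S ∩ T := Finset.inter_subset_inter hA hB
  have h1 := minRate_le q f hU
  have h2 := minRate_le q f hI
  have h3 := hf.submodular A B
  have h4 := Finset.sum_union_inter (s₁ := S) (s₂ := T) (f := q)
  have h5 := Finset.sum_union_inter (s₁ := A) (s₂ := B) (f := q)
  have h6 := Finset.sum_sdiff hU (f := q)
  have h7 := Finset.sum_sdiff hI (f := q)
  have h8 := Finset.sum_sdiff hA (f := q)
  have h9 := Finset.sum_sdiff hB (f := q)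
  linarith

theorem minRate_le_self (q : ι → ℝ) (f : Finset ι → ℝ) (S : Finset ι) : minRate q f S ≤ f S := by
  simpa using minRate_le q f (subset_refl S)

theorem minRate_empty (q : ι → ℝ) (f : Finset ι → ℝ) : minRate q f ∅ = f ∅ := by
  simp [minRate]

theorem le_minRate {q x : ι → ℝ} {f : Finset ι → ℝ} (hx : ∀ A, ∑ k ∈ A, x k ≤ f A)
    (hq : ∀ k, x k ≤ q k) (S : Finset ι) : ∑ k ∈ S, x k ≤ minRate q f S := by
  obtain ⟨A, hA, eA⟩ := exists_minRate q f S
  have h1 := Finset.sum_sdiff hA (f := x)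
  have h2 := Finset.sum_le_sum fun k (_ : k ∈ S \ A) => hq k
  have h3 := hx A
  linarith

end polymatroid

theorem sum_mul_eq_sum_Iic {n : ℕ} (w u x : Fin n → ℝ)
    (hu : ∀ l : Fin n, u l = if h : (l : ℕ) + 1 < n then w ⟨l + 1, h⟩ else 0) :
    ∑ k, w k * x k = ∑ l, (w l - u l) * ∑ k ∈ Finset.Iic l, x k := by
  induction n with
  | zero => simp
  | succ n ih =>
    have h1 : ∀ l : Fin n, Finset.Iic l.castSucc = (Finset.Iic l).map Fin.castSuccEmb := by
      intro l
      ext j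
      simp only [Finset.mem_Iic, Finset.mem_map, Fin.castSuccEmb_apply]
      constructor
      · intro h
        refine ⟨j.castLT (lt_of_le_of_lt h l.2), h, ?_⟩
        simp
      · rintro ⟨i, hi, rfl⟩
        exact hi
    have h2 : Finset.Iic (Fin.last n) = Finset.univ := by
      ext j; simp [Fin.le_last]
    have h3 := ih (fun l => w l.castSucc) (fun l => if h : (l : ℕ) + 1 < n then
      w (⟨l + 1, h⟩ : Fin n).castSucc else 0) (fun l => x l.castSucc) fun l => rfl
    rw [Fin.sum_univ_castSucc, Fin.sum_univ_castSucc, h2, h3]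
    have h4 : u (Fin.last n) = 0 := by rw [hu]; simp
    simp only [h1, Finset.sum_map, Fin.castSuccEmb_apply]
    rw [h4, sub_zero, Fin.sum_univ_castSucc (f := x), mul_add, ← add_assoc]
    congr 1
    rcases n with - | m
    · simp
    rw [← sub_eq_iff_eq_add', ← Finset.sum_sub_distrib]
    rw [Finset.sum_eq_single (Fin.last m)]
    · have h5 : Finset.Iic (Fin.last m) = Finset.univ := by
        ext j; simp [Fin.le_last]
      rw [h5, hu]
      simp only [Fin.val_castSucc, Fin.val_last, lt_add_iff_pos_right, zero_lt_one, dif_pos,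
        lt_self_iff_false, dif_neg, not_false_eq_true]
      have h6 : (⟨m + 1, by omega⟩ : Fin (m + 1 + 1)) = Fin.last (m + 1) := rfl
      rw [h6]
      ring
    · intro l _ hl
      have h7 : (l : ℕ) + 1 < m + 1 := by
        have := Fin.val_lt_last hl
        omega
      rw [hu, dif_pos h7, dif_pos (by simp; omega)]
      simp
    · simp

/-- The maximizer is the greedy vertex of the truncated function in the order of the weights: it is
tight on every initial segment. Abel summation turns the weighted sum into partial sums over these
segments, which also gives the upper bound. -/
theorem isMaxRate_minRate {n : ℕ} {w u q : Fin n → ℝ} {f : Finset (Fin n) → ℝ}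
    (hu : ∀ l : Fin n, u l = if h : (l : ℕ) + 1 < n then w ⟨l + 1, h⟩ else 0)
    (huw : ∀ l, u l ≤ w l) (hf : Polymatroid f) :
    IsMaxRate w q f (∑ l, (w l - u l) * minRate q f (Finset.Iic l)) where
  exists_eq := by
    have hid : Function.Injective (id : Fin n → Fin n) := Function.injective_id
    have h0 : minRate q f ∅ = 0 := by rw [minRate_empty, hf.empty]
    have h1 := sum_marginal_le hid h0 (minRate_self_submodular hf)
    refine ⟨marginal id (minRate q f), fun A => (h1 A).trans (minRate_le_self q f A), fun k => ?_, ?_⟩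
    · have h2 := h1 {k}
      have h3 := minRate_le q f (Finset.empty_subset {k})
      rw [hf.empty] at h3
      simp only [Finset.sdiff_empty, Finset.sum_singleton] at h2 h3
      linarith
    · rw [sum_mul_eq_sum_Iic w u _ hu]
      refine Finset.sum_congr rfl fun l _ => ?_
      rw [sum_marginal_initial hid h0]
      intro k hk j hj
      exact Finset.mem_Iic.mpr ((show j ≤ k from hj).trans (Finset.mem_Iic.mp hk))
  le := by
    intro x hx hq
    rw [sum_mul_eq_sum_Iic w u x hu]
    exact Finset.sum_le_sum fun l _ =>
      mul_le_mul_of_nonneg_left (le_minRate hx hq _) (sub_nonneg.mpr (huw l))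

/-! ## The fluid recursion -/

section fluid

/-- The value restricted to the unit interval. -/
noncomputable def clamp (x : ℝ) : ℝ := if x < 0 then 0 else if 1 < x then 1 else x

theorem clamp_nonneg (x : ℝ) : 0 ≤ clamp x := by
  unfold clamp; split_ifs <;> linarith

theorem clamp_le_one (x : ℝ) : clamp x ≤ 1 := by
  unfold clamp; split_ifs <;> linarith

/-- The primitive of `clamp (1 - a)`. -/
noncomputable def potential (a : ℝ) : ℝ := min a 0 + (1 - clamp (1 - a) ^ 2) / 2

theorem potential_zero : potential 0 = 0 := by norm_num [potential, clamp]

theorem potential_le (a : ℝ) : potential a ≤ min a 0 + 1 / 2 := by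
  unfold potential
  nlinarith [sq_nonneg (clamp (1 - a))]

/-- The potential has slope `clamp (1 - a)`, which is 1-Lipschitz, so its first-order expansion errs
by at most half the squared increment. -/
theorem potential_add_le (a b : ℝ) :
    potential a + clamp (1 - a) * (b - a) - (b - a) ^ 2 / 2 ≤ potential b := by
  unfold potential clamp
  rcases le_total a 0 with ha | ha <;> rcases le_total b 0 with hb | hb
  all_goals simp only [min_eq_left, min_eq_right, ha, hb]
  all_goals split_ifs <;> nlinarith [sq_nonneg (b - a), sq_nonneg a, sq_nonneg b, sq_nonneg (1 - a),
    sq_nonneg (1 - b)]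

variable {ι : Type*} [Fintype ι] [DecidableEq ι] [LinearOrder ι]

/-- The Lyapunov function of the recursion. -/
noncomputable def lyapunov (w q : ι → ℝ) (S : ℝ) (z : ι → ℝ) (τ : ℝ) : ℝ :=
  ∑ k, w k * q k * (τ + potential (S * (z k - τ)) / S + (z k + τ) / (2 * S))

/-- To first order the summand of `k` grows by δ((1 - y) + y v), as τ contributes 1 and the
potential y(v - 1). The second-order loss is at most δ(v + 1)/(2S) by the bound on the step length,
and the term (z + τ)/(2S) grows by exactly this amount. -/
theorem lyapunov_step {w q : ι → ℝ} {S δ τ : ℝ} {z v : ι → ℝ} (hw : ∀ k, 0 ≤ w k)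
    (hq : ∀ k, 0 ≤ q k) (hS : 0 < S) (hδ : 0 ≤ δ) (hv : ∀ k, 0 ≤ v k)
    (h : S ^ 2 * δ * (1 + ∑ k, v k) ≤ 1) :
    lyapunov w q S z τ + δ * ∑ k, w k * q k *
      ((1 - clamp (1 - S * (z k - τ))) + clamp (1 - S * (z k - τ)) * v k) ≤
    lyapunov w q S (fun k => z k + δ * v k) (τ + δ) := by
  unfold lyapunov
  rw [Finset.mul_sum, ← Finset.sum_add_distrib]
  refine Finset.sum_le_sum fun k _ => ?_
  have hwq : 0 ≤ w k * q k := mul_nonneg (hw k) (hq k)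
  have h1 := potential_add_le (S * (z k - τ)) (S * (z k + δ * v k - (τ + δ)))
  set y := clamp (1 - S * (z k - τ))
  have h2 : v k ≤ ∑ k, v k := Finset.single_le_sum (fun j _ => hv j) (Finset.mem_univ k)
  have h3 : S ^ 2 * δ * (1 + v k) ≤ 1 :=
    le_trans (mul_le_mul_of_nonneg_left (by linarith) (by positivity)) h
  have h4 : S ^ 2 * δ * (v k - 1) ^ 2 ≤ v k + 1 := by
    have h5 : (v k - 1) ^ 2 ≤ (1 + v k) ^ 2 := by nlinarith [hv k]
    have h6 : S ^ 2 * δ * (v k - 1) ^ 2 ≤ S ^ 2 * δ * (1 + v k) ^ 2 :=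
      mul_le_mul_of_nonneg_left h5 (by positivity)
    have h7 : S ^ 2 * δ * (1 + v k) * (1 + v k) ≤ 1 * (1 + v k) :=
      mul_le_mul_of_nonneg_right h3 (by linarith [hv k])
    linarith
  have h8 : potential (S * (z k - τ)) / S + δ * (y * (v k - 1)) - δ * (v k + 1) / (2 * S) ≤
      potential (S * (z k + δ * v k - (τ + δ))) / S := by
    rw [← sub_nonneg]
    have h9 : potential (S * (z k + δ * v k - (τ + δ))) / S - (potential (S * (z k - τ)) / S +
        δ * (y * (v k - 1)) - δ * (v k + 1) / (2 * S)) =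
        ((potential (S * (z k + δ * v k - (τ + δ))) - potential (S * (z k - τ)) -
        y * (S * δ * (v k - 1)) + δ * (v k + 1) / 2) / S) := by
      field_simp
      ring
    rw [h9]
    refine div_nonneg ?_ hS.le
    have h10 : S * (z k + δ * v k - (τ + δ)) - S * (z k - τ) = S * δ * (v k - 1) := by ring
    rw [h10] at h1
    have h11 : (S * δ * (v k - 1)) ^ 2 ≤ δ * (v k + 1) := by
      have := mul_le_mul_of_nonneg_left h4 hδ
      linarith
    linarith
  have h12 : (z k + δ * v k + (τ + δ)) / (2 * S) =
      (z k + τ) / (2 * S) + δ * (v k + 1) / (2 * S) := by ring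
  have e1 : w k * q k * (τ + potential (S * (z k - τ)) / S + (z k + τ) / (2 * S)) +
      δ * (w k * q k * (1 - y + y * v k)) = w k * q k * (τ + potential (S * (z k - τ)) / S +
      (z k + τ) / (2 * S) + δ * (1 - y + y * v k)) := by ring
  rw [e1, h12]
  refine mul_le_mul_of_nonneg_left ?_ hwq
  linarith

/-- The urgency of an index. -/
noncomputable def urgencyOf (q : ι → ℝ) (S : ℝ) (z : ι → ℝ) (τ : ℝ) (k : ι) : ℝ :=
  if 0 < q k then clamp (1 - S * (z k - τ)) else 0

/-- The order by decreasing weighted urgency. -/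
noncomputable def rank (o : ι → ℝ) (k : ι) : ℝ ×ₗ ι := toLex (-o k, k)

theorem rank_injective (o : ι → ℝ) : Function.Injective (rank o) := fun j k h => by
  simpa using (Prod.ext_iff.mp (toLex.injective h)).2

theorem rank_le {o : ι → ℝ} {j k : ι} (h : rank o j ≤ rank o k) : o k ≤ o j := by
  rcases (Prod.Lex.toLex_le_toLex.mp h) with h | h
  · simp only [neg_lt_neg_iff] at h; exact h.le
  · exact (neg_injective h.1).ge

/-- The speeds of the recursion. -/
noncomputable def speedOf (w q : ι → ℝ) (f : Finset ι → ℝ) (S : ℝ) (z : ι → ℝ) (τ : ℝ) (k : ι) :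
    ℝ :=
  if 0 < urgencyOf q S z τ k then
    marginal (rank fun j => w j * urgencyOf q S z τ j) f k / q k else 0

/-- The step length of the recursion. -/
noncomputable def stepOf (S τ : ℝ) (v : ι → ℝ) : ℝ := min (1 - τ) (1 / (S ^ 2 * (1 + ∑ k, v k)))

/-- One step of the recursion. -/
noncomputable def fluidStep (w q : ι → ℝ) (f : Finset ι → ℝ) (S : ℝ) (Z : (ι → ℝ) × ℝ) :
    (ι → ℝ) × ℝ :=
  let v := speedOf w q f S Z.1 Z.2
  (fun k => Z.1 k + stepOf S Z.2 v * v k, Z.2 + stepOf S Z.2 v)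

theorem marginal_nonneg {α : Type*} [LinearOrder α] {key : ι → α} {f : Finset ι → ℝ}
    (hf : Monotone f) (k : ι) : 0 ≤ marginal key f k := by
  refine sub_nonneg.mpr (hf fun j hj => ?_)
  simp only [lowSet, upSet, Finset.mem_filter, Finset.mem_univ, true_and] at hj ⊢
  exact hj.le

variable {w q : ι → ℝ} {f : Finset ι → ℝ} {S h : ℝ}

theorem urgencyOf_nonneg (z : ι → ℝ) (τ : ℝ) (k : ι) : 0 ≤ urgencyOf q S z τ k := by
  unfold urgencyOf; split_ifs
  · exact clamp_nonneg _
  · exact le_rfl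

theorem urgencyOf_le_one (z : ι → ℝ) (τ : ℝ) (k : ι) : urgencyOf q S z τ k ≤ 1 := by
  unfold urgencyOf; split_ifs
  · exact clamp_le_one _
  · exact zero_le_one

theorem speedOf_nonneg (hf : Polymatroid f) (hq : ∀ k, 0 ≤ q k) (z : ι → ℝ) (τ : ℝ) (k : ι) :
    0 ≤ speedOf w q f S z τ k := by
  unfold speedOf; split_ifs
  · exact div_nonneg (marginal_nonneg hf.mono k) (hq k)
  · exact le_rfl

theorem mul_speedOf (z : ι → ℝ) (τ : ℝ) (k : ι) : q k * speedOf w q f S z τ k =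
    if 0 < urgencyOf q S z τ k then
      marginal (rank fun j => w j * urgencyOf q S z τ j) f k else 0 := by
  unfold speedOf; split_ifs with h
  · have : q k ≠ 0 := by
      intro h0
      simp [urgencyOf, h0] at h
    field_simp
  · simp

theorem sum_mul_speedOf_le (hf : Polymatroid f) (z : ι → ℝ) (τ : ℝ) (A : Finset ι) :
    ∑ k ∈ A, q k * speedOf w q f S z τ k ≤ f A := by
  refine le_trans (Finset.sum_le_sum fun k _ => ?_)
    (sum_marginal_le (rank_injective fun j => w j * urgencyOf q S z τ j) hf.empty hf.submodular A)
  rw [mul_speedOf]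
  split_ifs
  · exact le_rfl
  · exact marginal_nonneg hf.mono k

/-- Weak duality. -/
theorem le_sum_speedOf (hf : Polymatroid f) (hw : ∀ k, 0 ≤ w k) (hq : ∀ k, 0 ≤ q k)
    (hm : IsMaxRate w q f h) (z : ι → ℝ) (τ : ℝ) :
    h ≤ ∑ k, w k * q k *
      ((1 - clamp (1 - S * (z k - τ))) + clamp (1 - S * (z k - τ)) * speedOf w q f S z τ k) := by
  obtain ⟨x, hx, hxq, rfl⟩ := hm.exists_eq
  set y := urgencyOf q S z τ with hy
  have h1 := sum_mul_le_marginal (rank_injective fun j => w j * y j) hf.empty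
    (c := fun j => w j * y j) (fun j k hjk => rank_le hjk)
    (fun k => mul_nonneg (hw k) (urgencyOf_nonneg z τ k)) hx
  have h2 : ∀ k, w k * y k * marginal (rank fun j => w j * y j) f k =
      w k * y k * (q k * speedOf w q f S z τ k) := by
    intro k
    rw [mul_speedOf, ← hy]
    split_ifs with h3
    · rfl
    · have : y k = 0 := le_antisymm (not_lt.mp h3) (urgencyOf_nonneg z τ k)
      simp [this]
  rw [Finset.sum_congr rfl fun k _ => h2 k] at h1
  -- Each x_k is split in the proportions y_k and 1 - y_k. The first part is bounded by the greedy
  -- vertex, the second by the cap.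
  have h3 : ∑ k, w k * (1 - y k) * x k ≤ ∑ k, w k * (1 - y k) * q k :=
    Finset.sum_le_sum fun k _ => mul_le_mul_of_nonneg_left (hxq k)
      (mul_nonneg (hw k) (sub_nonneg.mpr (urgencyOf_le_one z τ k)))
  calc ∑ k, w k * x k = ∑ k, w k * y k * x k + ∑ k, w k * (1 - y k) * x k := by
        rw [← Finset.sum_add_distrib]; exact Finset.sum_congr rfl fun k _ => by ring
    _ ≤ ∑ k, w k * y k * (q k * speedOf w q f S z τ k) + ∑ k, w k * (1 - y k) * q k :=
        add_le_add h1 h3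
    _ = _ := by
        rw [← Finset.sum_add_distrib]
        refine Finset.sum_congr rfl fun k _ => ?_
        -- For q_k = 0 the urgency is set to 0 and may differ from the clamp, but the term carries
        -- the factor q_k.
        rcases (hq k).lt_or_eq with h4 | h4
        · have : y k = clamp (1 - S * (z k - τ)) := by rw [hy, urgencyOf, if_pos h4]
          rw [this]; ring
        · rw [← h4]; ring

/-- The invariants of the recursion after `t` steps. -/
structure FluidInv (w q : ι → ℝ) (f : Finset ι → ℝ) (S h : ℝ) (t : ℕ) (Z : (ι → ℝ) × ℝ) : Prop where
  time_nonneg : 0 ≤ Z.2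
  time_le : Z.2 ≤ 1
  nonneg : ∀ k, 0 ≤ Z.1 k
  le_time : ∀ k, Z.1 k ≤ Z.2 + (1 / S + 1 / S ^ 2)
  sum_le : ∀ A, ∑ k ∈ A, q k * Z.1 k ≤ Z.2 * f A
  growth : Z.2 * h ≤ lyapunov w q S Z.1 Z.2
  progress : Z.2 = 1 ∨ t / S ^ 2 ≤ Z.2 + ∑ k, Z.1 k

theorem FluidInv.zero (hS : 0 < S) : FluidInv w q f S h 0 (0, 0) where
  time_nonneg := le_rfl
  time_le := zero_le_one
  nonneg := fun _ => le_rfl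
  le_time := fun _ => by simp; positivity
  sum_le := fun _ => by simp
  growth := by simp [lyapunov, potential_zero]
  progress := by simp

theorem FluidInv.step (hf : Polymatroid f) (hw : ∀ k, 0 ≤ w k) (hq : ∀ k, 0 ≤ q k)
    (hm : IsMaxRate w q f h) (hS : 0 < S) {t : ℕ} {Z : (ι → ℝ) × ℝ}
    (H : FluidInv w q f S h t Z) : FluidInv w q f S h (t + 1) (fluidStep w q f S Z) := by
  obtain ⟨z, τ⟩ := Z
  obtain ⟨h1, h2, h3, h4, h5, h6, h7⟩ := H
  simp only at h1 h2 h3 h4 h5 h6 h7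
  set v := speedOf w q f S z τ with hv
  set δ := stepOf S τ v with hδ
  have hv0 : ∀ k, 0 ≤ v k := speedOf_nonneg hf hq z τ
  have hs0 : 0 ≤ ∑ k, v k := Finset.sum_nonneg fun k _ => hv0 k
  have hD : 0 < S ^ 2 * (1 + ∑ k, v k) := by positivity
  have hδ0 : 0 ≤ δ := le_min (by linarith) (by positivity)
  have hδ1 : δ ≤ 1 - τ := min_le_left _ _
  have hδ2 : δ ≤ 1 / (S ^ 2 * (1 + ∑ k, v k)) := min_le_right _ _
  have hδ3 : δ * (S ^ 2 * (1 + ∑ k, v k)) ≤ 1 := (le_div_iff₀ hD).mp hδ2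
  have e : fluidStep w q f S (z, τ) = (fun k => z k + δ * v k, τ + δ) := rfl
  rw [e]
  refine ⟨by simp only; linarith, by simp only; linarith, fun k => ?_, fun k => ?_, fun A => ?_, ?_,
    ?_⟩
  · exact add_nonneg (h3 k) (mul_nonneg hδ0 (hv0 k))
  · simp only
    -- An urgent user is ahead of time by less than 1/S before the step and gains at most 1/S² in
    -- it. A user that is not urgent stands still while the time does not decrease.
    by_cases hu : 0 < urgencyOf q S z τ k
    · have h8 : S * (z k - τ) < 1 := by
        by_contra h9
        push Not at h9
        have : urgencyOf q S z τ k ≤ 0 := by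
          unfold urgencyOf clamp
          split_ifs <;> linarith
        linarith
      have h9 : z k - τ < 1 / S := by rw [lt_div_iff₀ hS]; linarith
      have h10 : v k ≤ ∑ k, v k := Finset.single_le_sum (fun j _ => hv0 j) (Finset.mem_univ k)
      have h11 : δ * v k ≤ 1 / S ^ 2 := by
        rw [le_div_iff₀ (by positivity)]
        have : δ * S ^ 2 * v k ≤ δ * S ^ 2 * (1 + ∑ k, v k) :=
          mul_le_mul_of_nonneg_left (by linarith) (by positivity)
        linarith
      linarith
    · have : v k = 0 := by rw [hv, speedOf, if_neg hu]
      rw [this, mul_zero]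
      linarith [h4 k]
  · simp only [mul_add, Finset.sum_add_distrib]
    have h8 := sum_mul_speedOf_le (w := w) (q := q) (S := S) hf z τ A
    have h9 : ∑ k ∈ A, q k * (δ * v k) = δ * ∑ k ∈ A, q k * v k := by
      rw [Finset.mul_sum]; exact Finset.sum_congr rfl fun k _ => by ring
    have h10 := mul_le_mul_of_nonneg_left h8 hδ0
    rw [h9, add_mul]
    linarith [h5 A]
  · have h8 := lyapunov_step (z := z) (τ := τ) hw hq hS hδ0 hv0 (by linarith)
    have h9 := mul_le_mul_of_nonneg_left (le_sum_speedOf (S := S) hf hw hq hm z τ) hδ0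
    simp only
    rw [add_mul]
    linarith
  · simp only
    rcases h7 with h7 | h7
    · left; linarith
    · rcases min_choice (1 - τ) (1 / (S ^ 2 * (1 + ∑ k, v k))) with h8 | h8
      · left
        have : δ = 1 - τ := h8
        linarith
      · right
        have h9 : δ = 1 / (S ^ 2 * (1 + ∑ k, v k)) := h8
        have h10 : δ * (1 + ∑ k, v k) = 1 / S ^ 2 := by
          rw [h9]
          have : (1 + ∑ k, v k) ≠ 0 := by positivity
          field_simp
        rw [Finset.sum_add_distrib, ← Finset.mul_sum]
        push_cast
        rw [add_div]
        linarith

theorem FluidInv.iterate (hf : Polymatroid f) (hw : ∀ k, 0 ≤ w k) (hq : ∀ k, 0 ≤ q k)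
    (hm : IsMaxRate w q f h) (hS : 0 < S) (t : ℕ) :
    FluidInv w q f S h t ((fluidStep w q f S)^[t] (0, 0)) := by
  induction t with
  | zero => exact .zero hS
  | succ t ih =>
    rw [Function.iterate_succ_apply']
    exact ih.step hf hw hq hm hS

/-- The value of a state. -/
noncomputable def payoffOf (w q z : ι → ℝ) : ℝ := ∑ k, w k * q k * min (z k) 1

theorem payoffOf_le (hf : Polymatroid f) (hq : ∀ k, 0 ≤ q k) (hm : IsMaxRate w q f h) {t : ℕ}
    {Z : (ι → ℝ) × ℝ} (H : FluidInv w q f S h t Z) : payoffOf w q Z.1 ≤ h := by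
  have h1 := hm.le (fun k => q k * min (Z.1 k) 1) (fun A => ?_) fun k =>
    (mul_le_mul_of_nonneg_left (min_le_right _ _) (hq k)).trans_eq (mul_one _)
  · simpa only [payoffOf, mul_assoc] using h1
  · calc ∑ k ∈ A, q k * min (Z.1 k) 1 ≤ ∑ k ∈ A, q k * Z.1 k :=
          Finset.sum_le_sum fun k _ => mul_le_mul_of_nonneg_left (min_le_left _ _) (hq k)
      _ ≤ Z.2 * f A := H.sum_le A
      _ ≤ 1 * f A := mul_le_mul_of_nonneg_right H.time_le (hf.nonneg A)
      _ = f A := one_mul _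

/-- Serving user `k` alone up to its cap is feasible because the cap is at most its single rate.
This converts additive errors in w_k q_k into relative errors. -/
theorem mul_le_maxRate (hf : Polymatroid f) (hq : ∀ k, 0 ≤ q k) (hqf : ∀ k, q k ≤ f {k})
    (hm : IsMaxRate w q f h) (k : ι) : w k * q k ≤ h := by
  have h1 := hm.le (Pi.single k (q k)) (fun A => ?_) fun j => ?_
  · rw [Finset.sum_eq_single k] at h1
    · simpa using h1
    · intro j _ hj; simp [hj]
    · simp
  · by_cases hk : k ∈ A
    · rw [Finset.sum_pi_single', if_pos hk]
      exact (hqf k).trans (hf.mono (Finset.singleton_subset_iff.mpr hk))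
    · rw [Finset.sum_pi_single', if_neg hk]
      exact hf.nonneg A
  · by_cases hj : j = k
    · subst hj; simp
    · simp [hj, hq j]

/-- At time 1 the Lyapunov function is at least `h`. It exceeds the payoff by at most w_k q_k
(1/(2S) + 4/(2S)) per user: the first term is the excess of the potential over a minimum, the second
uses z_k ≤ 3. This is at most 3h/S. -/
theorem le_payoffOf (hf : Polymatroid f) (hw : ∀ k, 0 ≤ w k) (hq : ∀ k, 0 ≤ q k)
    (hqf : ∀ k, q k ≤ f {k}) (hm : IsMaxRate w q f h) (hS : 1 ≤ S) {t : ℕ} {Z : (ι → ℝ) × ℝ}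
    (H : FluidInv w q f S h t Z) (hZ : Z.2 = 1) :
    (1 - 3 * Fintype.card ι / S) * h ≤ payoffOf w q Z.1 := by
  have hS0 : 0 < S := by linarith
  have h1 := H.growth
  rw [hZ, one_mul] at h1
  have h2 : ∀ k, w k * q k * (1 + potential (S * (Z.1 k - 1)) / S + (Z.1 k + 1) / (2 * S)) ≤
      w k * q k * min (Z.1 k) 1 + 3 / S * h := by
    intro k
    have h3 := potential_le (S * (Z.1 k - 1))
    have h4 : min (S * (Z.1 k - 1)) 0 = S * (min (Z.1 k) 1 - 1) := by
      rcases le_total (Z.1 k) 1 with h5 | h5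
      · rw [min_eq_left h5, min_eq_left]
        nlinarith
      · rw [min_eq_right h5, min_eq_right]
        · ring
        · exact mul_nonneg hS0.le (by linarith)
    have h5 : potential (S * (Z.1 k - 1)) / S ≤ min (Z.1 k) 1 - 1 + 1 / (2 * S) := by
      rw [div_le_iff₀ hS0]
      have : (min (Z.1 k) 1 - 1 + 1 / (2 * S)) * S = S * (min (Z.1 k) 1 - 1) + 1 / 2 := by
        field_simp
      rw [this, ← h4]
      exact h3
    have h6 := H.le_time k
    rw [hZ] at h6
    have h7 : 1 / S ≤ 1 := by rw [div_le_one hS0]; exact hS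
    have h8 : 1 / S ^ 2 ≤ 1 := by
      rw [div_le_one (by positivity)]; nlinarith
    have h9 : (Z.1 k + 1) / (2 * S) ≤ 4 / (2 * S) :=
      div_le_div_of_nonneg_right (by linarith) (by positivity)
    have h10 : 1 + potential (S * (Z.1 k - 1)) / S + (Z.1 k + 1) / (2 * S) ≤
        min (Z.1 k) 1 + 3 / S := by
      have : 1 / (2 * S) + 4 / (2 * S) ≤ 3 / S := by
        rw [← add_div, div_le_div_iff₀ (by positivity) hS0]
        nlinarith
      linarith
    have h11 := mul_le_mul_of_nonneg_left h10 (mul_nonneg (hw k) (hq k))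
    have h12 := mul_le_mul_of_nonneg_left (mul_le_maxRate hf hq hqf hm k)
      (show 0 ≤ 3 / S by positivity)
    linarith
  have h3 := Finset.sum_le_sum fun k (_ : k ∈ Finset.univ) => h2 k
  rw [Finset.sum_add_distrib, Finset.sum_const, Finset.card_univ, nsmul_eq_mul] at h3
  unfold lyapunov at h1
  unfold payoffOf
  have : 3 * (Fintype.card ι : ℝ) / S * h = Fintype.card ι * (3 / S * h) := by ring
  linarith

/-- Until time 1 is reached, every step adds 1/S² to τ + ∑ z, a quantity that never exceeds 1 +
3|ι|. -/
theorem FluidInv.time_eq_one (hS : 1 ≤ S) {t : ℕ} {Z : (ι → ℝ) × ℝ} (H : FluidInv w q f S h t Z)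
    (ht : (1 + 3 * Fintype.card ι) * S ^ 2 < t) : Z.2 = 1 := by
  have hS0 : 0 < S := by linarith
  rcases H.progress with h1 | h1
  · exact h1
  · exfalso
    have h2 : ∀ k, Z.1 k ≤ 3 := fun k => by
      have h6 := H.le_time k
      have h7 : 1 / S ≤ 1 := by rw [div_le_one hS0]; exact hS
      have h8 : 1 / S ^ 2 ≤ 1 := by
        rw [div_le_one (by positivity)]; nlinarith
      linarith [H.time_le]
    have h3 := Finset.sum_le_sum fun k (_ : k ∈ Finset.univ) => h2 k
    rw [Finset.sum_const, Finset.card_univ, nsmul_eq_mul] at h3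
    have h4 := H.time_le
    rw [div_le_iff₀ (by positivity)] at h1
    have h5 : (Z.2 + ∑ k, Z.1 k) * S ^ 2 ≤ (1 + 3 * Fintype.card ι) * S ^ 2 :=
      mul_le_mul_of_nonneg_right (by linarith) (by positivity)
    linarith

end fluid

end BeamBits

/-! ### Cost-benefit greedy with an approximate submodular objective -/

namespace BeamBits

/-! ## The greedy algorithm with an approximate objective -/

section greedy

variable {Ω : Type*} [Fintype Ω] [DecidableEq Ω]

/-- The data of the greedy algorithm: `v` approximates the monotone submodular function `h` from
below, `s` is the share of the constraints that is used by an element, and `mark G` holds the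
affordable element outside `G` with the best ratio of gain and share, if there is any. -/
structure GreedyData (h v : Finset Ω → ℝ) (s : Ω → ℝ) (aff : Finset Ω) (ε : ℝ)
    (mark : Finset Ω → Finset Ω) : Prop where
  mono : Monotone h
  submodular : ∀ A B, h (A ∪ B) + h (A ∩ B) ≤ h A + h B
  nonneg : ∀ A, 0 ≤ h A
  value_nonneg : ∀ A, 0 ≤ v A
  value_le : ∀ A, v A ≤ h A
  le_value : ∀ A, (1 - ε) * h A ≤ v A
  share_pos : ∀ e, 0 < s e
  eps_nonneg : 0 ≤ ε
  eps_le : ε ≤ 1 / 5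
  eps_card : ε * Fintype.card Ω ≤ 1 / 5
  mark_cases : ∀ G, (mark G = ∅ ∧ aff ⊆ G) ∨ ∃ e, mark G = {e} ∧ e ∈ aff ∧ e ∉ G ∧
    ∀ e' ∈ aff, e' ∉ G → (v (insert e' G) - v G) / s e' ≤ (v (insert e G) - v G) / s e

variable {h v : Finset Ω → ℝ} {s : Ω → ℝ} {aff : Finset Ω} {ε : ℝ} {mark : Finset Ω → Finset Ω}

theorem le_sum_insert (hmono : Monotone h) (hsub : ∀ A B, h (A ∪ B) + h (A ∩ B) ≤ h A + h B)
    (G O : Finset Ω) : h O - h G ≤ ∑ e ∈ O \ G, (h (insert e G) - h G) := by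
  have key : ∀ T : Finset Ω, Disjoint T G →
      h (G ∪ T) - h G ≤ ∑ e ∈ T, (h (insert e G) - h G) := by
    intro T
    induction T using Finset.induction_on with
    | empty => simp
    | insert e T he ih =>
      intro hd
      rw [Finset.disjoint_insert_left] at hd
      rw [Finset.sum_insert he]
      have h1 := ih hd.2
      have h2 := hsub (insert e G) (G ∪ T)
      have h3 : insert e G ∪ (G ∪ T) = G ∪ insert e T := by
        ext x; simp only [Finset.mem_union, Finset.mem_insert]; tauto
      have h4 : insert e G ∩ (G ∪ T) = G := by
        ext x
        simp only [Finset.mem_inter, Finset.mem_union, Finset.mem_insert]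
        constructor
        · rintro ⟨rfl | hx, hx' | hx'⟩
          · exact hx'
          · exact absurd hx' he
          · exact hx
          · exact hx
        · exact fun hx => ⟨.inr hx, .inl hx⟩
      rw [h3, h4] at h2
      linarith
  have h1 := key (O \ G) Finset.sdiff_disjoint
  have h2 : h O ≤ h (G ∪ O \ G) := hmono fun x hx => by
    simp only [Finset.mem_union, Finset.mem_sdiff]; tauto
  linarith

/-- One round of the greedy algorithm. -/
noncomputable def growOf (s : Ω → ℝ) (mark : Finset Ω → Finset Ω) (G : Finset Ω) : Finset Ω :=
  G ∪ (mark G).filter fun e => ∑ e ∈ G, s e + s e ≤ 1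

theorem growOf_eq (s : Ω → ℝ) {mark : Finset Ω → Finset Ω} {G : Finset Ω} {e : Ω}
    (h : mark G = {e}) : growOf s mark G = if ∑ e ∈ G, s e + s e ≤ 1 then insert e G else G := by
  rw [growOf, h, Finset.filter_singleton]
  split_ifs
  · rw [Finset.union_comm, Finset.insert_eq]
  · rw [Finset.union_empty]

/-- The final choice of the greedy algorithm. -/
noncomputable def chooseOf (v : Finset Ω → ℝ) (G M : Finset Ω) : Finset Ω :=
  if v G < v M then M else G

namespace GreedyData

variable (D : GreedyData h v s aff ε mark)
include D

/-- While `h G < h O / 4`, the exact gains over `O \ G` sum to at least (3/4) h(O). Evaluating by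
`v` loses at most ε · (5/4) h(O) per element, in total at most h(O)/4 by `eps_card`. The remaining
h(O)/2 is spread over share at most 2, so some element has ratio at least h(O)/4, hence so has the
marked one. -/
theorem ratio {O G : Finset Ω} (hO : O ⊆ aff) (hs : ∑ e ∈ O, s e ≤ 2)
    (hmax : ∀ e ∈ O, h {e} ≤ h O) (hG : h G < h O / 4) {e : Ω} (he : mark G = {e}) :
    h O / 4 * s e ≤ v (insert e G) - v G := by
  have hne : (O \ G).Nonempty := by
    rw [Finset.sdiff_nonempty]
    intro h1
    linarith [D.mono h1, D.nonneg G]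
  have h1 : ∀ e ∈ O \ G, h (insert e G) - h G - ε * (5 / 4 * h O) ≤ v (insert e G) - v G := by
    intro e he
    have h2 := D.submodular {e} G
    have h3 := D.nonneg ({e} ∩ G)
    have h4 := hmax e (Finset.mem_sdiff.mp he).1
    rw [← Finset.insert_eq] at h2
    have h5 : ε * h (insert e G) ≤ ε * (5 / 4 * h O) :=
      mul_le_mul_of_nonneg_left (by linarith) D.eps_nonneg
    linarith [D.le_value (insert e G), D.value_le G]
  have h2 := Finset.sum_le_sum h1
  rw [Finset.sum_sub_distrib, Finset.sum_const, nsmul_eq_mul] at h2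
  have h3 := le_sum_insert D.mono D.submodular G O
  have h4 : ((O \ G).card : ℝ) * (ε * (5 / 4 * h O)) ≤ 1 / 4 * h O := by
    have h5 : ((O \ G).card : ℝ) ≤ Fintype.card Ω := Nat.cast_le.mpr (Finset.card_le_univ _)
    have h6 : ((O \ G).card : ℝ) * ε ≤ 1 / 5 := by
      have := mul_le_mul_of_nonneg_left h5 D.eps_nonneg
      linarith [D.eps_card]
    have := mul_le_mul_of_nonneg_right h6 (mul_nonneg (by norm_num : (0 : ℝ) ≤ 5 / 4) (D.nonneg O))
    linarith
  have h5 : ∑ e ∈ O \ G, s e ≤ 2 :=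
    (Finset.sum_le_sum_of_subset_of_nonneg Finset.sdiff_subset
      fun e _ _ => (D.share_pos e).le).trans hs
  have h6 : ∑ e ∈ O \ G, h O / 4 * s e ≤ ∑ e ∈ O \ G, (v (insert e G) - v G) := by
    rw [← Finset.mul_sum]
    have := mul_le_mul_of_nonneg_left h5 (show 0 ≤ h O / 4 by linarith [D.nonneg O])
    linarith
  obtain ⟨e', he', h7⟩ := Finset.exists_le_of_sum_le hne h6
  obtain ⟨h8, h9⟩ := Finset.mem_sdiff.mp he'
  rcases D.mark_cases G with ⟨h10, -⟩ | ⟨e₁, h10, -, -, h11⟩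
  · rw [h10] at he; simp at he
  · rw [he, Finset.singleton_inj] at h10
    subst h10
    have h12 := h11 e' (hO h8) h9
    have h13 : h O / 4 ≤ (v (insert e' G) - v G) / s e' := by
      rw [le_div_iff₀ (D.share_pos e')]; exact h7
    have h14 := h13.trans h12
    rwa [le_div_iff₀ (D.share_pos e)] at h14

theorem growOf_subset {G : Finset Ω} (hG : G ⊆ aff) : growOf s mark G ⊆ aff := by
  rcases D.mark_cases G with ⟨h1, -⟩ | ⟨e, h1, h2, -, -⟩
  · rw [growOf, h1]; simpa using hG
  · rw [growOf_eq s h1]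
    split_ifs
    · exact Finset.insert_subset h2 hG
    · exact hG

theorem growOf_spent {G : Finset Ω} (hG : ∑ e ∈ G, s e ≤ 1) : ∑ e ∈ growOf s mark G, s e ≤ 1 := by
  rcases D.mark_cases G with ⟨h1, -⟩ | ⟨e, h1, -, h3, -⟩
  · rw [growOf, h1]; simpa using hG
  · rw [growOf_eq s h1]
    split_ifs with h4
    · rw [Finset.sum_insert h3]; linarith
    · exact hG

theorem growOf_inv {O G : Finset Ω} (hO : O ⊆ aff) (hs : ∑ e ∈ O, s e ≤ 2)
    (hmax : ∀ e ∈ O, h {e} ≤ h O)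
    (hG : h O / 4 ≤ h G ∨ h O / 4 * ∑ e ∈ G, s e ≤ v G) :
    h O / 4 ≤ h (growOf s mark G) ∨
      h O / 4 * ∑ e ∈ growOf s mark G, s e ≤ v (growOf s mark G) := by
  rcases D.mark_cases G with ⟨h1, -⟩ | ⟨e, h1, -, h3, -⟩
  · rw [growOf, h1]; simpa using hG
  · by_cases h5 : h O / 4 ≤ h G
    · exact .inl (h5.trans (D.mono Finset.subset_union_left))
    · have h6 := D.ratio hO hs hmax (not_le.mp h5) h1
      have h7 := hG.resolve_left h5
      right
      rw [growOf_eq s h1]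
      split_ifs
      · rw [Finset.sum_insert h3]; linarith
      · exact h7

/-- A round that changes the set enlarges it. Without a fixed point the cardinality thus keeps up
with the number of rounds, so the process is stationary after |Ω| rounds. -/
theorem iterate (t : ℕ) : (growOf s mark)^[t] ∅ ⊆ aff ∧ ∑ e ∈ (growOf s mark)^[t] ∅, s e ≤ 1 ∧
    (∀ O ⊆ aff, ∑ e ∈ O, s e ≤ 2 → (∀ e ∈ O, h {e} ≤ h O) →
      h O / 4 ≤ h ((growOf s mark)^[t] ∅) ∨
      h O / 4 * ∑ e ∈ (growOf s mark)^[t] ∅, s e ≤ v ((growOf s mark)^[t] ∅)) ∧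
    (growOf s mark ((growOf s mark)^[t] ∅) = (growOf s mark)^[t] ∅ ∨
      t ≤ ((growOf s mark)^[t] ∅).card) := by
  induction t with
  | zero => simp [D.value_nonneg]
  | succ t ih =>
    obtain ⟨h1, h2, h3, h4⟩ := ih
    rw [Function.iterate_succ_apply']
    refine ⟨D.growOf_subset h1, D.growOf_spent h2,
      fun O hO hs hm => D.growOf_inv hO hs hm (h3 O hO hs hm), ?_⟩
    generalize (growOf s mark)^[t] ∅ = G at h4
    rcases h4 with h4 | h4
    · left; rw [h4, h4]
    · by_cases h5 : growOf s mark G = G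
      · left; rw [h5, h5]
      · right
        have h6 : G ⊂ growOf s mark G :=
          (Finset.ssubset_iff_subset_ne).mpr ⟨Finset.subset_union_left, fun e => h5 e.symm⟩
        have := Finset.card_lt_card h6
        omega

/-- If `G` stays below a quarter of the optimum, the run ended because the marked `e` did not fit.
The ratios then give h(O)/4 ≤ v(G ∪ {e}) ≤ h(G) + h({e}); one of the two terms is at least h(O)/8,
and comparing by `v` costs a factor 4/5. -/
theorem guarantee {T : ℕ} (hT : Fintype.card Ω ≤ T) {G : Finset Ω}
    (eG : G = (growOf s mark)^[T] ∅) {O : Finset Ω} (hO : O ⊆ aff) (hs : ∑ e ∈ O, s e ≤ 2)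
    (hmax : ∀ e ∈ O, h {e} ≤ h O) : h O / 10 ≤ h (chooseOf v G (mark G)) := by
  obtain ⟨-, -, h3, h4⟩ := D.iterate T
  rw [← eG] at h3 h4
  have hO0 := D.nonneg O
  have hv : v G ≤ h (chooseOf v G (mark G)) ∧ v (mark G) ≤ h (chooseOf v G (mark G)) := by
    unfold chooseOf
    split_ifs with h5
    · exact ⟨h5.le.trans (D.value_le _), D.value_le _⟩
    · exact ⟨D.value_le _, (not_lt.mp h5).trans (D.value_le _)⟩
  have hapx : ∀ A, h A * (4 / 5) ≤ v A := fun A => by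
    have := mul_le_mul_of_nonneg_right D.eps_le (D.nonneg A)
    linarith [D.le_value A]
  by_cases h5 : h O / 4 ≤ h G
  · linarith [hapx G]
  · rcases D.mark_cases G with ⟨-, h6⟩ | ⟨e, h6, h7, h8, -⟩
    · exact absurd (D.mono (hO.trans h6)) (by linarith [D.nonneg G])
    · have h9 : 1 < ∑ e ∈ G, s e + s e := by
        by_contra h10
        rcases h4 with h4 | h4
        · rw [growOf_eq s h6, if_pos (not_lt.mp h10)] at h4
          exact h8 (h4 ▸ Finset.mem_insert_self e G)
        -- If the set has grown in every round, it is the whole ground set, and no marked element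
        -- outside it exists.
        · have : G = Finset.univ := Finset.eq_univ_of_card G
            (le_antisymm (Finset.card_le_univ G) (hT.trans h4))
          exact h8 (this ▸ Finset.mem_univ e)
      have h10 := (h3 O hO hs hmax).resolve_left h5
      have h11 := D.ratio hO hs hmax (not_le.mp h5) h6
      have h12 : h O / 4 * 1 ≤ h O / 4 * (∑ e ∈ G, s e + s e) :=
        mul_le_mul_of_nonneg_left h9.le (by linarith)
      have h13 := D.value_le (insert e G)
      have h14 := D.submodular {e} G
      have h15 := D.nonneg ({e} ∩ G)
      rw [← Finset.insert_eq] at h14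
      have h16 := hapx G
      have h17 := hapx (mark G)
      rw [h6] at h17 hv ⊢
      linarith [hv.1, hv.2]

/-- The marked single element may have share above 1; it is feasible because it is affordable on its
own. -/
theorem choose_cases (T : ℕ) {G : Finset Ω} (eG : G = (growOf s mark)^[T] ∅) :
    chooseOf v G (mark G) ⊆ aff ∧
      (∑ e ∈ chooseOf v G (mark G), s e ≤ 1 ∨ (chooseOf v G (mark G)).card ≤ 1) := by
  obtain ⟨h1, h2, -, -⟩ := D.iterate T
  rw [← eG] at h1 h2
  unfold chooseOf
  split_ifs
  · rcases D.mark_cases G with ⟨h3, -⟩ | ⟨e, h3, h4, -⟩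
    · rw [h3]; simp
    · rw [h3]; simpa using h4
  · exact ⟨h1, .inl h2⟩

end GreedyData

end greedy

end BeamBits

/-! ### Computing gains and log-determinants from the input tables -/

namespace BeamBits

open scoped ComplexOrder
open Matrix

/-! ## Rank one updates -/

section update

variable {R K : Type*} [Fintype R] [DecidableEq R] [Fintype K] [DecidableEq K]

theorem rankSum_insert_vecMulVec (Y : Matrix R K ℂ) {A : Finset K} {k : K} (hk : k ∉ A) :
    rankSum Y (insert k A) =
      rankSum Y A + vecMulVec (fun r => Y r k) (star fun r => Y r k) := by
  rw [rankSum_insert Y hk, vecMulVec_eq Unit]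
  rfl

theorem inv_rankSum_isHermitian (Y : Matrix R K ℂ) (A : Finset K) : (rankSum Y A)⁻¹.IsHermitian :=
  (rankSum_posDef Y A).1.inv

/-- The ratio of determinants at a rank one update. -/
noncomputable def ratioOf (Y : Matrix R K ℂ) (A : Finset K) (k : K) : ℂ :=
  1 + (star fun r => Y r k) ⬝ᵥ ((rankSum Y A)⁻¹ *ᵥ fun r => Y r k)

theorem ratioOf_eq_re (Y : Matrix R K ℂ) (A : Finset K) (k : K) :
    ratioOf Y A k = ((ratioOf Y A k).re : ℂ) := by
  have h := inv_rankSum_nonneg Y A fun r => Y r k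
  obtain ⟨-, h2⟩ := Complex.le_def.mp h
  apply Complex.ext
  · simp
  · simp only [ratioOf, Complex.add_im, Complex.one_im, ← h2, Complex.ofReal_im, Complex.zero_im,
      add_zero]

theorem one_le_ratioOf (Y : Matrix R K ℂ) (A : Finset K) (k : K) : 1 ≤ (ratioOf Y A k).re := by
  have h := inv_rankSum_nonneg Y A fun r => Y r k
  obtain ⟨h1, -⟩ := Complex.le_def.mp h
  rw [Complex.zero_re] at h1
  simp only [ratioOf, Complex.add_re, Complex.one_re]
  linarith

/-- The Sherman–Morrison formula, verified by multiplying out. The denominator is at least 1, so the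
computation never divides by zero. -/
theorem inv_rankSum_insert (Y : Matrix R K ℂ) {A : Finset K} {k : K} (hk : k ∉ A) :
    (rankSum Y (insert k A))⁻¹ = (rankSum Y A)⁻¹ - (ratioOf Y A k)⁻¹ •
      vecMulVec ((rankSum Y A)⁻¹ *ᵥ fun r => Y r k) (star ((rankSum Y A)⁻¹ *ᵥ fun r => Y r k)) := by
  apply inv_eq_right_inv
  set M := rankSum Y A with hM
  set c : R → ℂ := fun r => Y r k with hc
  have hu : IsUnit M.det := isUnit_iff_ne_zero.mpr (rankSum_posDef Y A).det_pos.ne'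
  have hMJ : M * M⁻¹ = 1 := mul_nonsing_inv M hu
  have hstar : star (M⁻¹ *ᵥ c) = star c ᵥ* M⁻¹ := by
    rw [star_mulVec, (inv_rankSum_isHermitian Y A).eq]
  have hρ : ratioOf Y A k ≠ 0 := by
    intro h0
    have := one_le_ratioOf Y A k
    rw [h0, Complex.zero_re] at this
    linarith
  have e1 : M * vecMulVec (M⁻¹ *ᵥ c) (star (M⁻¹ *ᵥ c)) = vecMulVec c (star (M⁻¹ *ᵥ c)) := by
    rw [mul_vecMulVec, mulVec_mulVec, hMJ, one_mulVec]
  have e2 : vecMulVec c (star c) * M⁻¹ = vecMulVec c (star (M⁻¹ *ᵥ c)) := by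
    rw [vecMulVec_mul, hstar]
  have e3 : vecMulVec c (star c) * vecMulVec (M⁻¹ *ᵥ c) (star (M⁻¹ *ᵥ c)) =
      (star c ⬝ᵥ (M⁻¹ *ᵥ c)) • vecMulVec c (star (M⁻¹ *ᵥ c)) := by
    rw [vecMulVec_mul_vecMulVec, vecMulVec_smul]
  have e4 : star c ⬝ᵥ (M⁻¹ *ᵥ c) = ratioOf Y A k - 1 := by
    rw [ratioOf, add_sub_cancel_left]
  rw [rankSum_insert_vecMulVec Y hk, Matrix.mul_sub, Matrix.mul_smul, Matrix.add_mul,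
    Matrix.add_mul, hMJ, e1, e2, e3, e4]
  ext i j
  simp only [Matrix.sub_apply, Matrix.add_apply, Matrix.smul_apply, smul_eq_mul]
  field_simp
  ring

theorem log_det_rankSum_insert (Y : Matrix R K ℂ) {A : Finset K} {k : K} (hk : k ∉ A) :
    Real.log (rankSum Y (insert k A)).det.re =
      Real.log (rankSum Y A).det.re + Real.log (ratioOf Y A k).re := by
  rw [det_rankSum_insert Y hk]
  change Real.log ((rankSum Y A).det * ratioOf Y A k).re = _
  have h1 := (Complex.lt_def.mp (rankSum_posDef Y A).det_pos).1
  rw [Complex.zero_re] at h1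
  rw [ratioOf_eq_re, Complex.re_mul_ofReal, Complex.ofReal_re, Real.log_mul h1.ne'
    (by linarith [one_le_ratioOf Y A k])]

end update

/-! ## The tables of an instance -/

theorem pad1_val {R : Type} [Zero R] {m : ℕ} (f : Fin m → R) (i : Fin m) : pad1 f i = f i := by
  simp [pad1]

theorem pad2_val {R : Type} [Zero R] {m n : ℕ} (f : Fin m → Fin n → R) (i : Fin m) (j : Fin n) :
    pad2 f i j = f i j := by
  rw [pad2, pad1_val, pad1_val]

theorem pad3_val {R : Type} [Zero R] {m n p : ℕ} (f : Fin m → Fin n → Fin p → R) (i : Fin m)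
    (j : Fin n) (k : Fin p) : pad3 f i j k = f i j k := by
  rw [pad3, pad1_val, pad2_val]

/-- Dividing `x` by the exponential, instead of using the exponential itself, gives 0 at `x = 0`,
where the logarithm has the default value 0. -/
theorem expSqrt_eq {x : ℝ} (hx : 0 ≤ x) : expSqrt x = Real.sqrt x := by
  rcases hx.eq_or_lt with rfl | hx
  · simp [expSqrt]
  · have h1 : Real.exp (Real.log x / 2) = Real.sqrt x := by
      rw [Real.sqrt_eq_rpow, Real.rpow_def_of_pos hx]
      congr 1
      ring
    rw [expSqrt, h1, Real.div_sqrt]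

theorem eqInd_pos {i j : ℕ} : 0 < eqInd i j ↔ i = j := by
  unfold eqInd
  split_ifs with h1 h2
  · rw [Nat.cast_lt] at h1
    simp [h1.ne]
  · rw [Nat.cast_lt] at h2
    simp [h2.ne']
  · rw [Nat.cast_lt] at h1 h2
    simp only [zero_lt_one, true_iff]
    omega

theorem eqInd_eq (i j : ℕ) : eqInd i j = if i = j then 1 else 0 := by
  unfold eqInd
  simp only [Nat.cast_lt]
  split_ifs <;> first | rfl | omega

namespace Uplink

variable (I : Uplink)

theorem K_lt_dim : I.K + 3 < I.dim := by
  have := I.N_pos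
  unfold dim size; omega

theorem nW_lt_dim : I.nW + 3 < I.dim := by
  have := I.N_pos
  unfold dim size; omega

theorem nB_lt_dim : I.nB + 3 < I.dim := by
  have := I.N_pos
  unfold dim size; omega

theorem tab_power (n : Fin I.N) (k : Fin I.K) : I.tab 6 n k 0 = I.power n k := by
  simp [tab, input, pad2_val]

theorem tab_weight (k : Fin I.K) : I.tab 7 k 0 0 = I.weight k := by
  simp [tab, input, pad1_val]

theorem tab_queue (k : Fin I.K) : I.tab 8 k 0 0 = (I.queue k).toReal := by
  simp [tab, input, pad1_val]

theorem tab_alpha (b : Fin I.nB) : I.tab 9 b 0 0 = I.alpha b := by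
  simp [tab, input, pad1_val]

theorem tab_cost (w : Fin I.nW) (b : Fin I.nB) : I.tab 10 w b 0 = I.cost w b := by
  simp [tab, input, pad2_val]

theorem tab_budget : I.tab 11 0 0 0 = I.budget := by
  simp [tab, input]

theorem nat_queue (k : Fin I.K) : I.input.nat 2 k 0 0 = if I.queue k = ∞ then 1 else 0 := by
  simp [input, pad1_val]

theorem ctab_beam (w : Fin I.nW) (r : Fin I.Nr) : I.ctab 0 1 w r 0 = I.beam w r := by
  apply Complex.ext <;> simp [ctab, tab, input, pad2_val]

theorem ctab_tap (l : Fin I.L) (r : Fin I.Nr) (k : Fin I.K) :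
    I.ctab 2 3 l r k = I.tap l r k := by
  apply Complex.ext <;> simp [ctab, tab, input, pad3_val]

theorem ctab_dft (n l : Fin I.N) : I.ctab 4 5 n l 0 = I.phase n l / (Real.sqrt I.N : ℂ) := by
  rw [← dft_eq]
  apply Complex.ext <;> simp [ctab, tab, input, pad2_val]

theorem tab_dft_zero : I.tab 4 0 0 0 = 1 / Real.sqrt I.N := by
  have h := congrArg Complex.re (I.ctab_dft ⟨0, I.N_pos⟩ ⟨0, I.N_pos⟩)
  simp only [phase, Nat.cast_zero, mul_zero, zero_div, neg_zero, Complex.exp_zero] at h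
  rw [← Complex.ofReal_one, ← Complex.ofReal_div, Complex.ofReal_re] at h
  exact h

/-- The corner entry of the DFT table is 1/√N. Its reciprocal undoes the normalization of the table.
-/
theorem route_eq (n : Fin I.N) (w : Fin I.nW) (k : Fin I.K) : I.route n w k = I.paths n w k := by
  have hN : (Real.sqrt I.N : ℂ) ≠ 0 := by
    rw [Complex.ofReal_ne_zero]
    exact (Real.sqrt_pos.mpr (Nat.cast_pos.mpr I.N_pos)).ne'
  rw [route, tab_dft_zero, one_div_one_div, paths, Matrix.mul_apply, Finset.sum_mul,
    Finset.sum_range]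
  refine Finset.sum_congr rfl fun r _ => ?_
  rw [chan_apply, Finset.sum_range, Finset.sum_mul, Finset.mul_sum]
  refine Finset.sum_congr rfl fun l _ => ?_
  have h := I.ctab_dft n (Fin.castLE I.L_le l)
  rw [Fin.val_castLE] at h
  rw [ctab_beam, ctab_tap, h]
  field_simp

theorem psiTab_eq (w : Fin I.nW) : I.psiTab w = I.psi w := by
  rw [psiTab, psi_eq, Finset.sum_range]
  congr 1
  refine Finset.sum_congr rfl fun n _ => ?_
  rw [Finset.sum_range]
  refine Finset.sum_congr rfl fun k _ => ?_
  rw [route_eq, tab_power, tab_dft_zero, div_pow, Real.sq_sqrt (Nat.cast_nonneg _)]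
  ring

theorem gainTab_eq (w : Fin I.nW) (b : Fin I.nB) : I.gainTab w b = I.gain w b := by
  rw [gainTab, tab_alpha, psiTab_eq, gain]

/-- The set of pairs in an array. -/
noncomputable def pairs (g : Arr) : Finset I.Ground :=
  Finset.univ.filter fun e => 0 < g e.1 e.2 0

variable {I} in
theorem mem_pairs {g : Arr} {w : Fin I.nW} {b : Fin I.nB} :
    (w, b) ∈ I.pairs g ↔ 0 < g w b 0 := by simp [pairs]

theorem pairs_boxed (g : Arr) : I.pairs (boxed I.dim g) = I.pairs g := by
  ext ⟨w, b⟩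
  have h1 := I.nW_lt_dim
  have h2 := I.nB_lt_dim
  rw [mem_pairs, mem_pairs, boxed_apply (by omega) (by omega) (by omega)]

/-- Only the highest resolution present survives the inner test, so the sum has at most one nonzero
term. A beam that is absent yields the empty case 0. -/
theorem topGain_eq (g : Arr) (w : Fin I.nW) : I.topGain g w = I.level (I.pairs g) w := by
  have h1 : ∀ b : Fin I.nB, (0 < ∑ b' ∈ Finset.range I.nB, (if (b : ℝ) < (b' : ℝ) then
      (if 0 < g w b' 0 then 1 else 0) else 0 : ℝ)) ↔ ∃ b', b < b' ∧ (w, b') ∈ I.pairs g := by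
    intro b
    rw [Finset.sum_range]
    constructor
    · intro h
      obtain ⟨b', -, h2⟩ := Finset.exists_lt_of_sum_lt (s := Finset.univ)
        (f := fun _ : Fin I.nB => (0 : ℝ)) (by simpa using h)
      refine ⟨b', ?_⟩
      rw [mem_pairs]
      split_ifs at h2 with h3 h4
      · exact ⟨h3, h4⟩
      · exact absurd h2 (lt_irrefl _)
      · exact absurd h2 (lt_irrefl _)
    · rintro ⟨b', h2, h3⟩
      refine Finset.sum_pos' (fun b' _ => ?_) ⟨b', Finset.mem_univ _, ?_⟩
      · split_ifs <;> norm_num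
      · rw [if_pos (Nat.cast_lt.mpr h2), if_pos (mem_pairs.mp h3)]
        exact one_pos
  rw [topGain, Finset.sum_range]
  simp only [h1]
  rcases I.level_cases (I.pairs g) w with ⟨h2, h3⟩ | ⟨b₀, h2, h3⟩
  · rw [h3]
    refine Finset.sum_eq_zero fun b _ => if_neg fun h => h2 b (mem_pairs.mpr h)
  · obtain ⟨b, hb, hmax⟩ := Finset.exists_max_image
      (Finset.univ.filter fun b => (w, b) ∈ I.pairs g) id ⟨b₀, by simpa using h2⟩
    simp only [Finset.mem_filter, Finset.mem_univ, true_and, id] at hb hmax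
    rw [Finset.sum_eq_single b]
    · rw [if_pos (mem_pairs.mp hb), if_neg, gainTab_eq]
      · exact le_antisymm (I.gain_le_level hb) (h3 ▸ I.gain_mono w (hmax b₀ h2))
      · rintro ⟨b', h4, h5⟩
        exact absurd (hmax b' h5) (not_le.mpr h4)
    · intro b' _ hb'
      split_ifs with h4 h5
      · rfl
      · exact absurd ⟨b, lt_of_le_of_ne (hmax b' (mem_pairs.mpr h4)) hb', hb⟩ h5
      · rfl
    · simp

/-- The amplitudes of the beams of a set in an array. -/
noncomputable abbrev amps (g : Arr) : Arr := boxed I.dim (I.amp g)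

/-- The effective channel for a set in an array. -/
noncomputable abbrev eff (g : Arr) (n : Fin I.N) : Matrix (Fin I.nW) (Fin I.K) ℂ :=
  scaled (I.signal n) (I.level (I.pairs g))

theorem column_eq (g : Arr) (n : Fin I.N) (k : Fin I.K) (w : Fin I.nW) :
    I.column (I.amps g) n k w = I.eff g n w k := by
  have h1 := I.nW_lt_dim
  rw [column, amps, boxed_apply (by omega) (by omega) (by omega), amp, topGain_eq, route_eq,
    tab_power, expSqrt_eq (I.level_nonneg _ _), expSqrt_eq (I.power_nonneg _ _), eff, scaled,
    of_apply, signal, of_apply, mul_assoc]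

/-- The set of users in an array. -/
noncomputable def users (A : Arr) : Finset (Fin I.K) := Finset.univ.filter fun k => 0 < A k 0 0

/-- The users in an array among the first `t`. -/
noncomputable def usersBelow (A : Arr) (t : ℕ) : Finset (Fin I.K) :=
  Finset.univ.filter fun k => (k : ℕ) < t ∧ 0 < A k 0 0

theorem usersBelow_succ {A : Arr} (k : Fin I.K) (h : 0 < A k 0 0) :
    I.usersBelow A (k + 1) = insert k (I.usersBelow A k) := by
  ext j
  simp only [usersBelow, Finset.mem_filter, Finset.mem_univ, true_and, Finset.mem_insert]
  constructor
  · rintro ⟨h1, h2⟩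
    by_cases h3 : j = k
    · exact .inl h3
    · exact .inr ⟨by omega, h2⟩
  · rintro (rfl | ⟨h1, h2⟩)
    · exact ⟨by omega, h⟩
    · exact ⟨by omega, h2⟩

theorem usersBelow_succ_of_not {A : Arr} (k : Fin I.K) (h : ¬ 0 < A k 0 0) :
    I.usersBelow A (k + 1) = I.usersBelow A k := by
  ext j
  simp only [usersBelow, Finset.mem_filter, Finset.mem_univ, true_and]
  constructor
  · rintro ⟨h1, h2⟩
    refine ⟨lt_of_le_of_ne (by omega) ?_, h2⟩
    intro h3
    exact h (h3 ▸ h2)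
  · rintro ⟨h1, h2⟩
    exact ⟨by omega, h2⟩

/-- Layers 0 and 1 of the state hold the real and imaginary parts of the inverse, and layer 2
accumulates the log-determinant, read at its corner. Users are inserted one by one, starting from
the identity matrix. -/
theorem iter_invStep (g A : Arr) (n : Fin I.N) {t : ℕ} (ht : t ≤ I.K) :
    (∀ w w' : Fin I.nW, invEntry (iterN I.dim (I.invStep (I.amps g) A n) invInit t) w w' =
      (rankSum (I.eff g n) (I.usersBelow A t))⁻¹ w w') ∧
    iterN I.dim (I.invStep (I.amps g) A n) invInit t 0 0 2 =
      Real.log (rankSum (I.eff g n) (I.usersBelow A t)).det.re := by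
  have d1 := I.nW_lt_dim
  induction t with
  | zero =>
    have h1 : I.usersBelow A 0 = ∅ := by simp [usersBelow]
    rw [h1, rankSum_empty, inv_one, det_one, Complex.one_re, Real.log_one]
    simp only [iterN]
    constructor
    · intro w w'
      rw [invEntry, boxed_apply (by omega) (by omega) (by omega),
        boxed_apply (by omega) (by omega) (by omega), invInit, eqInd_eq, Matrix.one_apply]
      simp only [Fin.val_inj]
      rw [if_pos (by norm_num : ((0 : ℕ) : ℝ) < 1)]
      split_ifs <;> apply Complex.ext <;> simp [invInit]
    · rw [boxed_apply (by omega) (by omega) (by omega), invInit]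
      norm_num
  | succ t ih =>
    obtain ⟨h1, h2⟩ := ih (by omega)
    simp only [iterN]
    set J := iterN I.dim (I.invStep (I.amps g) A n) invInit t with hJ
    obtain ⟨k, rfl⟩ : ∃ k : Fin I.K, (k : ℕ) = t := ⟨⟨t, by omega⟩, rfl⟩
    have e0 : ∀ w w' : Fin I.nW, invEntry (boxed I.dim (I.invStep (I.amps g) A n k J)) w w' =
        if 0 < A k 0 0 then I.invUpdate (I.amps g) n k J w w' else invEntry J w w' := by
      intro w w'
      rw [invEntry, boxed_apply (by omega) (by omega) (by omega),
        boxed_apply (by omega) (by omega) (by omega)]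
      unfold invStep
      split_ifs <;> simp_all [invEntry]
    have e1 : boxed I.dim (I.invStep (I.amps g) A n k J) 0 0 2 =
        if 0 < A k 0 0 then J 0 0 2 + Real.log (I.detRatio (I.amps g) n k J) else J 0 0 2 := by
      rw [boxed_apply (by omega) (by omega) (by omega)]
      unfold invStep
      norm_num
    rw [e1]
    simp only [e0]
    by_cases hA : 0 < A k 0 0
    · simp only [if_pos hA]
      rw [I.usersBelow_succ k hA]
      have hk : k ∉ I.usersBelow A k := by simp [usersBelow]
      set B := I.usersBelow A k with hB
      have e2 : ∀ w : Fin I.nW, I.invCol (I.amps g) n k J w =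
          ((rankSum (I.eff g n) B)⁻¹ *ᵥ fun w => I.eff g n w k) w := by
        intro w
        rw [invCol, Finset.sum_range]
        simp only [h1, column_eq]
        rfl
      have e3 : I.detRatio (I.amps g) n k J = (ratioOf (I.eff g n) B k).re := by
        rw [detRatio, Finset.sum_range, ratioOf, Complex.add_re, Complex.one_re]
        simp only [e2, column_eq]
        rfl
      constructor
      · intro w w'
        rw [invUpdate, e2, e2, e3, h1, inv_rankSum_insert _ hk, Matrix.sub_apply,
          Matrix.smul_apply, vecMulVec_apply, smul_eq_mul, Complex.ofReal_div, Complex.ofReal_one,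
          ← ratioOf_eq_re, Pi.star_apply, Complex.star_def]
        ring
      · rw [h2, e3, log_det_rankSum_insert _ hk]
    · simp only [if_neg hA]
      rw [I.usersBelow_succ_of_not k hA]
      exact ⟨h1, h2⟩

theorem rate_eq (g A : Arr) : I.rate (I.amps g) A = I.sumRate (I.pairs g) (I.users A) := by
  rw [rate, sumRate_eq, Finset.sum_range, Finset.sum_div]
  refine Finset.sum_congr rfl fun n _ => ?_
  have h1 : I.usersBelow A I.K = I.users A := by
    ext k; simp [usersBelow, users]
  rw [(I.iter_invStep g A n le_rfl).2, h1, det_rankSum, ← gram_eq_scaled _ (I.level_nonneg _),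
    Real.logb]

theorem users_boxed (A : Arr) : I.users (boxed I.dim A) = I.users A := by
  ext k
  have h1 := I.K_lt_dim
  simp only [users, Finset.mem_filter, Finset.mem_univ, true_and]
  rw [boxed_apply (by omega) (by omega) (by omega)]

theorem users_unitArr (k : Fin I.K) : I.users (unitArr k) = {k} := by
  ext j
  simp only [users, Finset.mem_filter, Finset.mem_univ, true_and, unitArr, eqInd_pos,
    Finset.mem_singleton, Fin.val_inj]

theorem cap_eq (g : Arr) (k : Fin I.K) :
    I.cap (I.amps g) k 0 0 = I.limit (I.pairs g) k := by
  have hf := (I.sumRate_polymatroid (I.pairs g)).nonneg {k}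
  rw [cap, rate_eq, users_boxed, users_unitArr, nat_queue, tab_queue, limit]
  by_cases hQ : I.queue k = ∞
  · rw [hQ, if_pos rfl, if_pos (by norm_num), min_eq_right le_top, ENNReal.toReal_ofReal hf]
  · rw [if_neg hQ, if_neg (by norm_num), ENNReal.toReal_min hQ ENNReal.ofReal_ne_top,
      ENNReal.toReal_ofReal hf]
    split_ifs with h
    · exact (min_eq_left h.le).symm
    · exact (min_eq_right (not_lt.mp h)).symm

end Uplink

end BeamBits

/-! ### The array recursion is the fluid recursion -/

namespace BeamBits

open Matrix

theorem iterN_const (n : ℕ) (Φ : Arr → Arr) (A : Arr) (t : ℕ) :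
    iterN n (fun _ => Φ) A t = (boxed n ∘ Φ)^[t] (boxed n A) := by
  induction t with
  | zero => rfl
  | succ t ih => rw [iterN, ih, Function.iterate_succ_apply', Function.comp_apply]

theorem boxed_iterate (n : ℕ) (Φ : Arr → Arr) {A : Arr} (hA : boxed n A = A) (t : ℕ) :
    boxed n ((boxed n ∘ Φ)^[t] A) = (boxed n ∘ Φ)^[t] A := by
  cases t with
  | zero => exact hA
  | succ t => rw [Function.iterate_succ_apply', Function.comp_apply, boxed_boxed]

theorem boxed_nestIter (n : ℕ) (Φ : Arr → Arr) (m : ℕ) {A : Arr} (hA : boxed n A = A) :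
    boxed n (nestIter n Φ m A) = (boxed n ∘ Φ)^[n ^ m] A := by
  induction m generalizing A with
  | zero => rw [nestIter_zero, pow_zero, Function.iterate_one, Function.comp_apply]
  | succ m ih =>
    -- Every iterate is again truncated to the box, so the induction hypothesis applies in each
    -- round of the outer loop.
    have h : ∀ t, (boxed n ∘ nestIter n Φ m)^[t] A = ((boxed n ∘ Φ)^[n ^ m])^[t] A := by
      intro t
      induction t with
      | zero => rfl
      | succ t iht =>
        rw [Function.iterate_succ_apply', Function.iterate_succ_apply', iht, Function.comp_apply,
          ih]
        rw [← Function.iterate_mul]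
        exact boxed_iterate n Φ hA _
    rw [nestIter_succ, iterN_const, boxed_iterate n _ (boxed_boxed n A), hA, h,
      ← Function.iterate_mul, pow_succ]

namespace Uplink

variable (I : Uplink)

theorem one_le_fine : 1 ≤ I.fine := by
  have h := I.K_lt_dim
  exact one_le_pow₀ (by exact_mod_cast (by omega : 1 ≤ I.dim))

/-- The state of the recursion in an array. -/
noncomputable def stateOf (Z : Arr) : (Fin I.K → ℝ) × ℝ := (fun k => Z k 0 0, Z 0 1 0)

/-- The limits for a set of pairs in an array. -/
noncomputable abbrev caps (g : Arr) : Arr := boxed I.dim (I.cap (I.amps g))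

theorem caps_apply (g : Arr) (k : Fin I.K) : I.caps g k 0 0 = I.limit (I.pairs g) k := by
  have h1 := I.K_lt_dim
  rw [caps, boxed_apply (by omega) (by omega) (by omega), cap_eq]

theorem urgency_eq (g Z : Arr) (k : Fin I.K) : I.urgency (I.caps g) Z k =
    urgencyOf (I.limit (I.pairs g)) I.fine (I.stateOf Z).1 (I.stateOf Z).2 k := by
  rw [urgency, caps_apply, urgencyOf]
  rfl

theorem rank_le_iff {o : Fin I.K → ℝ} {j k : Fin I.K} :
    rank o j ≤ rank o k ↔ o k < o j ∨ (¬ o j < o k ∧ j ≤ k) := by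
  rw [rank, rank, Prod.Lex.toLex_le_toLex]
  simp only [neg_lt_neg_iff, neg_inj]
  constructor
  · rintro (h | ⟨h, h'⟩)
    · exact .inl h
    · exact .inr ⟨h.not_lt, h'⟩
  · rintro (h | ⟨h, h'⟩)
    · exact .inl h
    · rcases (not_lt.mp h).lt_or_eq with h1 | h1
      · exact .inl h1
      · exact .inr ⟨h1.symm, h'⟩

theorem rank_lt_iff {o : Fin I.K → ℝ} {j k : Fin I.K} :
    rank o j < rank o k ↔ o k < o j ∨ (¬ o j < o k ∧ j < k) := by
  rw [lt_iff_le_and_ne, (rank_injective o).ne_iff, rank_le_iff]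
  constructor
  · rintro ⟨h | ⟨h, h'⟩, h2⟩
    · exact .inl h
    · exact .inr ⟨h, h'.lt_of_ne h2⟩
  · rintro (h | ⟨h, h'⟩)
    · exact ⟨.inl h, fun e => absurd h (e ▸ lt_irrefl _)⟩
    · exact ⟨.inr ⟨h, h'.le⟩, h'.ne⟩

variable {I} in
theorem mem_users {A : Arr} {k : Fin I.K} : k ∈ I.users A ↔ 0 < A k 0 0 := by simp [users]

theorem users_upTo (o : Arr) (k : Fin I.K) :
    I.users (upTo o k) = upSet (rank fun j : Fin I.K => o j 0 0) k := by
  ext j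
  rw [mem_users]
  simp only [upSet, Finset.mem_filter, Finset.mem_univ, true_and, rank_le_iff, upTo]
  split_ifs with h1 h2 h3
  · simp [h1]
  · simp [h1, h2]
  · rw [Nat.cast_lt] at h3
    refine iff_of_false (lt_irrefl _) ?_
    rintro (h | ⟨-, h⟩)
    · exact h1 h
    · exact absurd h (not_le.mpr h3)
  · rw [Nat.cast_lt] at h3
    exact iff_of_true one_pos (.inr ⟨h2, not_lt.mp h3⟩)

theorem users_below (o : Arr) (k : Fin I.K) :
    I.users (below o k) = lowSet (rank fun j : Fin I.K => o j 0 0) k := by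
  ext j
  rw [mem_users]
  simp only [lowSet, Finset.mem_filter, Finset.mem_univ, true_and, rank_lt_iff, below]
  split_ifs with h1 h2 h3
  · simp [h1]
  · simp [h1, h2]
  · rw [Nat.cast_lt] at h3
    exact iff_of_true one_pos (.inr ⟨h2, h3⟩)
  · rw [Nat.cast_lt] at h3
    refine iff_of_false (lt_irrefl _) ?_
    rintro (h | ⟨-, h⟩)
    · exact h1 h
    · exact h3 h

theorem speed_eq (g Z : Arr) (k : Fin I.K) :
    I.speed (I.amps g) (I.caps g) Z (boxed I.dim (I.priority (I.caps g) Z)) k 0 0 =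
    speedOf I.weight (I.limit (I.pairs g)) (I.sumRate (I.pairs g)) I.fine (I.stateOf Z).1
      (I.stateOf Z).2 k := by
  have h1 := I.K_lt_dim
  have h2 : (fun j : Fin I.K => boxed I.dim (I.priority (I.caps g) Z) j 0 0) = fun j =>
      I.weight j * urgencyOf (I.limit (I.pairs g)) I.fine (I.stateOf Z).1 (I.stateOf Z).2 j := by
    funext j
    rw [boxed_apply (by omega) (by omega) (by omega), priority, tab_weight, urgency_eq]
  rw [speed, urgency_eq, rate_eq, rate_eq, users_boxed, users_boxed, users_upTo, users_below, h2,
    caps_apply, speedOf, marginal]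

theorem stateOf_flow (g Z : Arr) : I.stateOf (boxed I.dim (I.flow (I.amps g) (I.caps g) Z)) =
    fluidStep I.weight (I.limit (I.pairs g)) (I.sumRate (I.pairs g)) I.fine (I.stateOf Z) := by
  have h1 := I.K_lt_dim
  set v := boxed I.dim (I.speed (I.amps g) (I.caps g) Z
    (boxed I.dim (I.priority (I.caps g) Z))) with hv
  have h2 : ∀ k : Fin I.K, v k 0 0 = speedOf I.weight (I.limit (I.pairs g))
      (I.sumRate (I.pairs g)) I.fine (I.stateOf Z).1 (I.stateOf Z).2 k := by
    intro k
    rw [hv, boxed_apply (by omega) (by omega) (by omega), speed_eq]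
  have h3 : I.timeStep Z v = stepOf I.fine (I.stateOf Z).2 (speedOf I.weight (I.limit (I.pairs g))
      (I.sumRate (I.pairs g)) I.fine (I.stateOf Z).1 (I.stateOf Z).2) := by
    rw [timeStep, stepOf, Finset.sum_range]
    simp only [h2]
    split_ifs with h
    · exact (min_eq_left h.le).symm
    · exact (min_eq_right (not_lt.mp h)).symm
  unfold fluidStep
  apply Prod.ext
  · funext k
    simp only [stateOf] at h2 h3 ⊢
    rw [boxed_apply (by omega) (by omega) (by omega), flow, ← hv, advance, if_pos (by norm_num), h2,
      h3]
  · simp only [stateOf] at h2 h3 ⊢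
    rw [boxed_apply (by omega) (by omega) (by omega), flow, ← hv, advance, if_neg (by norm_num),
      if_pos (by norm_num), h3]

/-- The approximate weighted sum rate. -/
noncomputable def apxRate (G : Finset I.Ground) : ℝ :=
  payoffOf I.weight (I.limit G)
    ((fluidStep I.weight (I.limit G) (I.sumRate G) I.fine)^[I.dim ^ 12] (0, 0)).1

theorem value_eq (g : Arr) : I.value g = I.apxRate (I.pairs g) := by
  have h0 := I.K_lt_dim
  have h1 : ∀ t, I.stateOf ((boxed I.dim ∘ I.flow (I.amps g) (I.caps g))^[t]
      (boxed I.dim fun _ _ _ => 0)) =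
      (fluidStep I.weight (I.limit (I.pairs g)) (I.sumRate (I.pairs g)) I.fine)^[t] (0, 0) := by
    intro t
    induction t with
    | zero =>
      rw [Function.iterate_zero_apply, Function.iterate_zero_apply, stateOf]
      apply Prod.ext
      · funext k
        simp only
        rw [boxed_apply (by omega) (by omega) (by omega)]
        rfl
      · simp only
        rw [boxed_apply (by omega) (by omega) (by omega)]
    | succ t ih =>
      rw [Function.iterate_succ_apply', Function.iterate_succ_apply', Function.comp_apply,
        stateOf_flow, ih]
  rw [value, flowValue, boxed_nestIter _ _ _ (boxed_boxed _ _), payoff, Finset.sum_range, apxRate,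
    payoffOf, ← h1]
  refine Finset.sum_congr rfl fun k _ => ?_
  rw [tab_weight, ← caps_apply]
  simp only [stateOf]
  congr 1
  split_ifs with h
  · exact (min_eq_left h.le).symm
  · exact (min_eq_right (not_lt.mp h)).symm

theorem limit_le (G : Finset I.Ground) (k : Fin I.K) : I.limit G k ≤ I.sumRate G {k} := by
  have h1 := I.ofReal_limit G k
  have h2 := min_le_right (I.queue k) (ENNReal.ofReal (I.sumRate G {k}))
  rw [← h1] at h2
  exact (ENNReal.ofReal_le_ofReal_iff ((I.sumRate_polymatroid G).nonneg _)).mp h2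

theorem isMaxRate_wsr (G : Finset I.Ground) :
    IsMaxRate I.weight (I.limit G) (I.sumRate G) (I.wsr G) := by
  have h := isMaxRate_minRate (w := I.weight) (u := I.nextWeight) (q := I.limit G)
    (f := I.sumRate G) (fun l => rfl) I.nextWeight_le (I.sumRate_polymatroid G)
  have e : I.wsr G = ∑ l, (I.weight l - I.nextWeight l) *
      minRate (I.limit G) (I.sumRate G) (Finset.Iic l) :=
    Finset.sum_congr rfl fun l _ => by rw [I.queueRate_eq subset_rfl]
  rwa [e]

theorem fluidInv (G : Finset I.Ground) (t : ℕ) :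
    FluidInv I.weight (I.limit G) (I.sumRate G) I.fine (I.wsr G) t
      ((fluidStep I.weight (I.limit G) (I.sumRate G) I.fine)^[t] (0, 0)) :=
  .iterate (I.sumRate_polymatroid G) I.weight_nonneg (I.limit_nonneg G) (I.isMaxRate_wsr G)
    (zero_lt_one.trans_le I.one_le_fine) t

theorem apxRate_le (G : Finset I.Ground) : I.apxRate G ≤ I.wsr G :=
  payoffOf_le (I.sumRate_polymatroid G) (I.limit_nonneg G) (I.isMaxRate_wsr G) (I.fluidInv G _)

theorem apxRate_nonneg (G : Finset I.Ground) : 0 ≤ I.apxRate G := by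
  unfold apxRate payoffOf
  exact Finset.sum_nonneg fun k _ => mul_nonneg (mul_nonneg (I.weight_nonneg k) (I.limit_nonneg G k))
    (le_min ((I.fluidInv G _).nonneg k) zero_le_one)

theorem le_apxRate (G : Finset I.Ground) : (1 - 3 * I.K / I.fine) * I.wsr G ≤ I.apxRate G := by
  have h := le_payoffOf (I.sumRate_polymatroid G) I.weight_nonneg (I.limit_nonneg G) (I.limit_le G)
    (I.isMaxRate_wsr G) I.one_le_fine (I.fluidInv G (I.dim ^ 12))
    ((I.fluidInv G (I.dim ^ 12)).time_eq_one I.one_le_fine ?_)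
  · rwa [Fintype.card_fin] at h
  · have h1 := I.K_lt_dim
    rw [Fintype.card_fin, fine]
    generalize I.dim = d at h1
    -- With S = dim⁵ the step bound is (1 + 3K) dim¹⁰, and 1 + 3K < dim² since K + 3 < dim. This
    -- fixes the nesting depth 12.
    have h2 : (1 + 3 * I.K) * (d ^ 5) ^ 2 < d ^ 12 := by
      have h3 : d ^ 12 = (d * d) * (d ^ 5) ^ 2 := by ring
      have h4 : 1 + 3 * I.K < d * d := by
        have := Nat.mul_le_mul_right d h1.le
        rw [add_mul] at this
        omega
      rw [h3]
      exact Nat.mul_lt_mul_of_pos_right h4 (pow_pos (pow_pos (by omega) 5) 2)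
    exact_mod_cast h2

end Uplink

end BeamBits

/-! ### The array greedy algorithm and its feasibility -/

namespace BeamBits

open Matrix

theorem sum_range_range_pos {m n : ℕ} {F : ℕ → ℕ → ℝ} (hF : ∀ i j, 0 ≤ F i j) :
    0 < ∑ i ∈ Finset.range m, ∑ j ∈ Finset.range n, F i j ↔
      ∃ e : Fin m × Fin n, 0 < F e.1 e.2 := by
  have h : ∑ i ∈ Finset.range m, ∑ j ∈ Finset.range n, F i j =
      ∑ e : Fin m × Fin n, F e.1 e.2 := by
    rw [Fintype.sum_prod_type, Finset.sum_range]
    exact Finset.sum_congr rfl fun i _ => Finset.sum_range _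
  rw [h, Finset.sum_pos_iff_of_nonneg fun e _ => hF _ _]
  simp

theorem prefer_nonneg (sc : Arr) (w b w' b' : ℕ) : 0 ≤ prefer sc w b w' b' := by
  unfold prefer
  split_ifs <;> norm_num

namespace Uplink

variable (I : Uplink)

/-- The share of the constraints that is used by a pair. -/
noncomputable def shareOf (e : I.Ground) : ℝ :=
  I.cost e.1 e.2 / I.budget + 1 / min (I.chains : ℝ) ((I.dim : ℝ) ^ 2)

theorem share_eq (w : Fin I.nW) (b : Fin I.nB) : I.share w b = I.shareOf (w, b) := by
  rw [share, tab_cost, tab_budget, shareOf]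
  congr 2
  split_ifs with h
  · exact (min_eq_left h.le).symm
  · exact (min_eq_right (not_lt.mp h)).symm

theorem min_chains_pos : 0 < min (I.chains : ℝ) ((I.dim : ℝ) ^ 2) := by
  have h := I.K_lt_dim
  exact lt_min (Nat.cast_pos.mpr I.chains_pos) (pow_pos (Nat.cast_pos.mpr (by omega)) 2)

theorem shareOf_pos (e : I.Ground) : 0 < I.shareOf e :=
  add_pos_of_nonneg_of_pos (div_nonneg (I.cost_nonneg _ _) I.budget_nonneg)
    (one_div_pos.mpr I.min_chains_pos)

/-- The pairs that are not too expensive on their own. -/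
noncomputable def affordable : Finset I.Ground :=
  Finset.univ.filter fun e => I.cost e.1 e.2 ≤ I.budget

/-- The gain of the value relative to the share. -/
noncomputable def scoreOf (G : Finset I.Ground) (e : I.Ground) : ℝ :=
  (I.apxRate (insert e G) - I.apxRate G) / I.shareOf e

/-- The order of the candidates: by score, then lexicographically. -/
noncomputable def keyOf (G : Finset I.Ground) (e : I.Ground) :
    ℝ ×ₗ (Fin I.nW ×ₗ Fin I.nB)ᵒᵈ :=
  toLex (I.scoreOf G e, OrderDual.toDual (toLex e))

theorem keyOf_injective (G : Finset I.Ground) : Function.Injective (I.keyOf G) := fun e e' h => by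
  simpa using (Prod.ext_iff.mp (toLex.injective h)).2

/-- The best candidate. -/
noncomputable def markOf (G : Finset I.Ground) : Finset I.Ground :=
  (I.affordable \ G).filter fun e => ∀ e' ∈ I.affordable \ G, I.keyOf G e' ≤ I.keyOf G e

theorem markOf_cases (G : Finset I.Ground) : (I.markOf G = ∅ ∧ I.affordable ⊆ G) ∨
    ∃ e, I.markOf G = {e} ∧ e ∈ I.affordable ∧ e ∉ G ∧
      ∀ e' ∈ I.affordable, e' ∉ G → I.scoreOf G e' ≤ I.scoreOf G e := by
  rcases (I.affordable \ G).eq_empty_or_nonempty with h | h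
  · left
    exact ⟨by rw [markOf, h, Finset.filter_empty], Finset.sdiff_eq_empty_iff_subset.mp h⟩
  · right
    obtain ⟨e, he, hmax⟩ := Finset.exists_max_image _ (I.keyOf G) h
    refine ⟨e, ?_, (Finset.mem_sdiff.mp he).1, (Finset.mem_sdiff.mp he).2, fun e' h1 h2 => ?_⟩
    · ext e'
      rw [markOf, Finset.mem_filter, Finset.mem_singleton]
      constructor
      · rintro ⟨h1, h2⟩
        exact I.keyOf_injective G (le_antisymm (hmax e' h1) (h2 e he))
      · rintro rfl
        exact ⟨he, hmax⟩
    · have h3 := hmax e' (Finset.mem_sdiff.mpr ⟨h1, h2⟩)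
      rcases Prod.Lex.toLex_le_toLex.mp h3 with h4 | h4
      · exact h4.le
      · exact h4.1.le

theorem candidate_pos (g : Arr) (w : Fin I.nW) (b : Fin I.nB) :
    0 < I.candidate g w b ↔ (w, b) ∈ I.affordable \ I.pairs g := by
  rw [candidate, tab_budget, tab_cost, Finset.mem_sdiff, mem_pairs, affordable, Finset.mem_filter]
  simp only [Finset.mem_univ, true_and]
  split_ifs with h1 h2
  · simp [h1]
  · simp [h2]
  · simp [h1, not_lt.mp h2]

theorem pairs_addPair (g : Arr) (w : Fin I.nW) (b : Fin I.nB) :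
    I.pairs (addPair g w b) = insert (w, b) (I.pairs g) := by
  ext ⟨w', b'⟩
  rw [mem_pairs, Finset.mem_insert, mem_pairs, addPair, eqInd_eq, eqInd_eq]
  simp only [Fin.val_inj, Prod.mk.injEq]
  by_cases h1 : w' = w <;> by_cases h2 : b' = b <;> simp [h1, h2]

theorem score_eq (g : Arr) (w : Fin I.nW) (b : Fin I.nB) :
    boxed I.dim (I.score g) w b 0 = I.scoreOf (I.pairs g) (w, b) := by
  have h1 := I.nW_lt_dim
  have h2 := I.nB_lt_dim
  rw [boxed_apply (by omega) (by omega) (by omega), score, value_eq, value_eq, pairs_boxed,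
    pairs_addPair, share_eq, scoreOf]

/-- The key reverses the index order, so at equal scores the earlier pair is the larger one.
Injective keys make the best candidate unique. -/
theorem prefer_pos (g : Arr) (w w' : Fin I.nW) (b b' : Fin I.nB) :
    0 < prefer (boxed I.dim (I.score g)) w b w' b' ↔
      I.keyOf (I.pairs g) (w, b) < I.keyOf (I.pairs g) (w', b') := by
  rw [prefer, score_eq, score_eq, keyOf, keyOf, Prod.Lex.toLex_lt_toLex, OrderDual.toDual_lt_toDual,
    Prod.Lex.toLex_lt_toLex]
  simp only [Nat.cast_lt]
  generalize I.scoreOf (I.pairs g) (w, b) = x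
  generalize I.scoreOf (I.pairs g) (w', b') = y
  split_ifs with h1 h2 h3 h4 h5
  · exact iff_of_true one_pos (.inl h1)
  · refine iff_of_false (lt_irrefl _) ?_
    rintro (h | ⟨h, -⟩)
    · exact h1 h
    · exact h2.ne' h
  · exact iff_of_true one_pos (.inr ⟨le_antisymm (not_lt.mp h2) (not_lt.mp h1), .inl h3⟩)
  · refine iff_of_false (lt_irrefl _) ?_
    rintro (h | ⟨-, h | ⟨h, -⟩⟩)
    · exact h1 h
    · exact h3 h
    · rw [h] at h4; exact lt_irrefl _ h4
  · exact iff_of_true one_pos (.inr ⟨le_antisymm (not_lt.mp h2) (not_lt.mp h1),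
      .inr ⟨le_antisymm (not_lt.mp h4) (not_lt.mp h3), h5⟩⟩)
  · refine iff_of_false (lt_irrefl _) ?_
    rintro (h | ⟨-, h | ⟨-, h⟩⟩)
    · exact h1 h
    · exact h3 h
    · exact h5 h

theorem pairs_mark (g : Arr) : I.pairs (I.mark g) = I.markOf (I.pairs g) := by
  rw [mark, pairs_boxed]
  ext ⟨w, b⟩
  have h0 : ∀ w' b' : ℕ, (0 : ℝ) ≤ if 0 < I.candidate g w' b' then
      prefer (boxed I.dim (I.score g)) w b w' b' else 0 := by
    intro w' b'
    split_ifs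
    · exact prefer_nonneg _ _ _ _ _
    · exact le_rfl
  have hs := sum_range_range_pos (m := I.nW) (n := I.nB) h0
  rw [mem_pairs, best, markOf, Finset.mem_filter]
  simp only [hs]
  clear hs
  by_cases h1 : (w, b) ∈ I.affordable \ I.pairs g
  · rw [if_pos ((I.candidate_pos g w b).mpr h1)]
    simp only [h1, true_and]
    split_ifs with h2
    · refine iff_of_false (lt_irrefl _) fun h3 => ?_
      obtain ⟨⟨w', b'⟩, h2⟩ := h2
      split_ifs at h2 with h4
      · exact not_lt.mpr (h3 _ ((I.candidate_pos g w' b').mp h4)) ((I.prefer_pos g w w' b b').mp h2)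
      · exact lt_irrefl _ h2
    · refine iff_of_true one_pos fun e' he' => ?_
      by_contra h3
      refine h2 ⟨e', ?_⟩
      rw [if_pos ((I.candidate_pos g e'.1 e'.2).mpr he')]
      exact (I.prefer_pos g w e'.1 b e'.2).mpr (not_le.mp h3)
  · rw [if_neg fun h => h1 ((I.candidate_pos g w b).mp h)]
    exact iff_of_false (lt_irrefl _) fun h => h1 h.1

theorem spent_eq (g : Arr) : I.spent g = ∑ e ∈ I.pairs g, I.shareOf e := by
  rw [spent, pairs, Finset.sum_filter, Fintype.sum_prod_type, Finset.sum_range]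
  refine Finset.sum_congr rfl fun w _ => ?_
  rw [Finset.sum_range]
  exact Finset.sum_congr rfl fun b _ => by rw [share_eq]

theorem pairs_grow (g : Arr) :
    I.pairs (I.grow g) = growOf I.shareOf I.markOf (I.pairs g) := by
  ext ⟨w, b⟩
  rw [growOf, Finset.mem_union, Finset.mem_filter, ← pairs_mark, mem_pairs, mem_pairs, mem_pairs,
    grow, addIfFits, spent_eq, share_eq]
  split_ifs with h1 h2 h3
  · simp [h1]
  · simp [h1, not_le.mpr h3]
  · simp [h2, not_lt.mp h3]
  · simp [h1, h2]

theorem pairs_greedy :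
    I.pairs I.greedy = (growOf I.shareOf I.markOf)^[I.dim ^ 2] ∅ := by
  have h : ∀ t, I.pairs ((boxed I.dim ∘ I.grow)^[t] (boxed I.dim fun _ _ _ => 0)) =
      (growOf I.shareOf I.markOf)^[t] ∅ := by
    intro t
    induction t with
    | zero =>
      rw [Function.iterate_zero_apply, Function.iterate_zero_apply, pairs_boxed]
      simp [pairs]
    | succ t ih =>
      rw [Function.iterate_succ_apply', Function.iterate_succ_apply', Function.comp_apply,
        pairs_boxed, pairs_grow, ih]
  rw [greedy, boxed_nestIter _ _ _ (boxed_boxed _ _), h]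

theorem pairs_result : I.pairs I.result =
    chooseOf I.apxRate (I.pairs I.greedy) (I.markOf (I.pairs I.greedy)) := by
  rw [← pairs_mark]
  ext ⟨w, b⟩
  rw [mem_pairs, result, choose, chooseOf, value_eq, value_eq]
  split_ifs <;> rw [mem_pairs]

theorem card_ground_le : Fintype.card I.Ground ≤ I.dim ^ 2 := by
  have h1 := I.nW_lt_dim
  have h2 := I.nB_lt_dim
  rw [Fintype.card_prod, Fintype.card_fin, Fintype.card_fin, sq]
  exact Nat.mul_le_mul (by omega) (by omega)

theorem greedyData : GreedyData I.wsr I.apxRate I.shareOf I.affordable (3 * I.K / I.fine)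
    I.markOf where
  mono := fun _ _ h => I.wsr_mono h
  submodular := I.wsr_submodular
  nonneg := I.wsr_nonneg
  value_nonneg := I.apxRate_nonneg
  value_le := I.apxRate_le
  le_value := I.le_apxRate
  share_pos := I.shareOf_pos
  eps_nonneg := div_nonneg (by positivity) (zero_le_one.trans I.one_le_fine)
  eps_le := by
    have h := I.K_lt_dim
    rw [div_le_div_iff₀ (zero_lt_one.trans_le I.one_le_fine) (by norm_num), fine]
    have h1 : 3 * I.K * 5 ≤ 1 * I.dim ^ 5 := by
      have h2 : 4 ^ 4 ≤ I.dim ^ 4 := Nat.pow_le_pow_left (by omega) 4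
      have h3 := Nat.mul_le_mul h2 (show I.K ≤ I.dim by omega)
      have h4 : I.dim ^ 4 * I.dim = I.dim ^ 5 := by ring
      omega
    exact_mod_cast h1
  eps_card := by
    have h := I.K_lt_dim
    have h0 := I.card_ground_le
    rw [div_mul_eq_mul_div, div_le_div_iff₀ (zero_lt_one.trans_le I.one_le_fine) (by norm_num),
      fine]
    have h1 : 3 * I.K * Fintype.card I.Ground * 5 ≤ 1 * I.dim ^ 5 := by
      have h2 : 4 ^ 2 ≤ I.dim ^ 2 := Nat.pow_le_pow_left (by omega) 2
      have h3 := Nat.mul_le_mul (Nat.mul_le_mul h2 (show I.K ≤ I.dim by omega)) h0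
      -- The exponent 5 of the accuracy pays for the constant 15 ≤ 4² ≤ dim², for `K` and for the
      -- size of the ground set.
      have h4 : I.dim ^ 2 * I.dim * I.dim ^ 2 = I.dim ^ 5 := by ring
      rw [h4] at h3
      refine le_trans ?_ (h3.trans_eq (one_mul _).symm)
      have h5 : 3 * I.K * Fintype.card I.Ground * 5 = 15 * (I.K * Fintype.card I.Ground) := by ring
      have h6 : 4 ^ 2 * I.K * Fintype.card I.Ground = 16 * (I.K * Fintype.card I.Ground) := by ring
      rw [h5, h6]
      exact Nat.mul_le_mul_right _ (by norm_num)
    exact_mod_cast h1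
  mark_cases := I.markOf_cases

variable {I}

theorem Feasible.subset_affordable {G : Finset I.Ground} (h : I.Feasible G) : G ⊆ I.affordable := by
  intro e he
  rw [affordable, Finset.mem_filter]
  exact ⟨Finset.mem_univ e, (Finset.single_le_sum (fun e _ => I.cost_nonneg e.1 e.2) he).trans h.1⟩

theorem sum_shareOf (G : Finset I.Ground) : ∑ e ∈ G, I.shareOf e =
    (∑ e ∈ G, I.cost e.1 e.2) / I.budget + G.card / min (I.chains : ℝ) ((I.dim : ℝ) ^ 2) := by
  simp only [shareOf, Finset.sum_add_distrib, Finset.sum_const, nsmul_eq_mul, Finset.sum_div,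
    mul_one_div]

theorem Feasible.sum_shareOf_le {G : Finset I.Ground} (h : I.Feasible G) :
    ∑ e ∈ G, I.shareOf e ≤ 2 := by
  rw [sum_shareOf]
  have h1 : (∑ e ∈ G, I.cost e.1 e.2) / I.budget ≤ 1 := div_le_one_of_le₀ h.1 I.budget_nonneg
  have h2 : (G.card : ℝ) / min (I.chains : ℝ) ((I.dim : ℝ) ^ 2) ≤ 1 := by
    -- The cardinality is below both entries of the minimum: the first by feasibility, the second
    -- because the ground set has at most dim² pairs.
    refine div_le_one_of_le₀ (le_min (Nat.cast_le.mpr h.2) ?_) I.min_chains_pos.le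
    exact_mod_cast (Finset.card_le_univ G).trans I.card_ground_le
  linarith

theorem feasible_of_sum_shareOf_le {G : Finset I.Ground} (hG : G ⊆ I.affordable)
    (h : ∑ e ∈ G, I.shareOf e ≤ 1) : I.Feasible G := by
  rw [sum_shareOf] at h
  have h1 : 0 ≤ (∑ e ∈ G, I.cost e.1 e.2) / I.budget :=
    div_nonneg (Finset.sum_nonneg fun e _ => I.cost_nonneg _ _) I.budget_nonneg
  have h2 : 0 ≤ (G.card : ℝ) / min (I.chains : ℝ) ((I.dim : ℝ) ^ 2) :=
    div_nonneg (Nat.cast_nonneg _) I.min_chains_pos.le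
  constructor
  -- For budget 0 the quotient is 0 by convention and carries no information, but affordable pairs
  -- then cost nothing.
  · rcases I.budget_nonneg.eq_or_lt with h3 | h3
    · rw [← h3]
      refine Finset.sum_nonpos fun e he => ?_
      rw [h3]
      exact (Finset.mem_filter.mp (hG he)).2
    · have : (∑ e ∈ G, I.cost e.1 e.2) / I.budget ≤ 1 := by linarith
      rwa [div_le_one h3] at this
  · have h4 : (G.card : ℝ) / min (I.chains : ℝ) ((I.dim : ℝ) ^ 2) ≤ 1 := by linarith
    rw [div_le_one I.min_chains_pos] at h4
    exact_mod_cast h4.trans (min_le_left _ _)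

theorem feasible_of_card_le_one {G : Finset I.Ground} (hG : G ⊆ I.affordable)
    (h : G.card ≤ 1) : I.Feasible G := by
  refine ⟨?_, h.trans I.chains_pos⟩
  rcases G.eq_empty_or_nonempty with rfl | ⟨e, he⟩
  · simpa using I.budget_nonneg
  · have : G = {e} := Finset.eq_singleton_iff_unique_mem.mpr
      ⟨he, fun x hx => Finset.card_le_one.mp h x hx e he⟩
    subst this
    rw [Finset.sum_singleton]
    exact (Finset.mem_filter.mp (hG he)).2

variable (I)

theorem feasible_result : I.Feasible (I.pairs I.result) := by
  rw [pairs_result]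
  obtain ⟨h1, h2 | h2⟩ := I.greedyData.choose_cases _ I.pairs_greedy
  · exact feasible_of_sum_shareOf_le h1 h2
  · exact feasible_of_card_le_one h1 h2

theorem wsr_le_result {G : Finset I.Ground} (hG : I.Feasible G) :
    I.wsr G / 10 ≤ I.wsr (I.pairs I.result) := by
  rw [pairs_result]
  exact I.greedyData.guarantee I.card_ground_le I.pairs_greedy hG.subset_affordable
    hG.sum_shareOf_le fun e he => I.wsr_mono (Finset.singleton_subset_iff.mpr he)

end Uplink

end BeamBits

theorem corollary1 :
    ∃ (P : BeamBits.Prog) (p : Polynomial ℕ), ∀ I : BeamBits.Uplink,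
      ∃ (t : ℕ) (s : BeamBits.Store),
        BeamBits.Run P I.input t s ∧ t ≤ p.eval I.size ∧ I.Feasible (I.output s) ∧
        ∀ G : Finset I.Ground, I.Feasible G →
          1 / (2 * (1 + 2 * Real.exp 1)) * I.wsr G ≤ I.wsr (I.output s) := by
  obtain ⟨P, p, h⟩ := BeamBits.ImplA.result.output
  refine ⟨P, p, fun I => ?_⟩
  obtain ⟨t, s, hr, ht, ho⟩ := h I
  have e : I.output s = I.pairs I.result := ho
  refine ⟨t, s, hr, ht, e ▸ I.feasible_result, fun G hG => ?_⟩
  rw [e]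
  refine le_trans ?_ (I.wsr_le_result hG)
  -- Already e ≥ 2 gives 2(1 + 2e) ≥ 10.
  have h1 : 1 / (2 * (1 + 2 * Real.exp 1)) ≤ 1 / 10 := by
    have := Real.exp_one_gt_d9
    exact one_div_le_one_div_of_le (by norm_num) (by linarith)
  have := mul_le_mul_of_nonneg_right h1 (I.wsr_nonneg G)
  linarith
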